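/- Let $\mathbb T=\mathbb R/\mathbb Z$, $\Omega=\mathbb T\times\mathbb R$, and $\nu,\eta>0$. Consider on $\Omega$ the MHD system with horizontal dissipation $$\partial_t u+u\cdot\nabla u-\nu\partial_1^2u+\nabla p=b\cdot\nabla b,\qquad \partial_t b+u\cdot\nabla b-\eta\partial_1^2 b=b\cdot\nabla u,\qquad \nabla\cdot u=\nabla\cdot b=0,$$ with $u(0)=u_0$, $b(0)=b_0$. For $s\ge 2$, a global $H^s$ solution is a pair $(u,b)$ with $u,b\in C([0,\infty);L^2(\Omega))$, bounded in $H^s(\Omega)$ on every bounded time interval, divergence-free, taking the initial data at $t=0$, and satisfying the equations in the sense of distributions on $(0,\infty)\times\Omega$ for some locally integrable pressure $p$. For $f$ on $\Omega$ put $\bar f(y)=\int_{\mathbb T}f(x',y)\,dx'$ and $\widetilde f(x,y)=f(x,y)-\bar f(y)$. **Theorem.** There is $\delta>0$, depending only on $\nu,\eta$, such that the following holds. Let $s\ge2$ be real and let $u_0,b_0\in H^s(\Omega;\mathbb R^2)$ be divergence-free with $$\|(u_0,b_0)\|_{L^2}^2+\|(\partial_2u_0,\partial_2b_0)\|_{L^2}^2\le\delta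 .$$ Then there are constants $C,\widetilde C>0$, depending only on $\nu,\eta$ and $(u_0,b_0)$, such that every global $H^s$ solution $(u,b)$ with initial data $(u_0,b_0)$ satisfies $$\|(\widetilde u,\widetilde b)(t)\|_{L^2(\Omega)}\le Ce^{-\widetilde C t}\qquad\text{for all } t\ge0 .$$ In particular $\|u(t)-\bar u(t)\|_{L^2}\to0$ and $\|b(t)-\bar b(t)\|_{L^2}\to0$ as $t\to\infty$. -/

import Mathlib

open MeasureTheory Filter Topology
open scoped ENNReal NNReal ContDiff FourierTransform

noncomputable section

namespace MHD

/-- The strip `Ω = 𝕋 × ℝ`, where `𝕋 = ℝ / ℤ` is the circle of length one. It carries the product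
Lebesgue measure, for which `𝕋` has total mass one. -/
abbrev Strip : Type := UnitAddCircle × ℝ

/-- Values of planar vector fields; index `0` is the component along `x ∈ 𝕋`, index `1` the
component along `y ∈ ℝ`. -/
abbrev Vec : Type := EuclideanSpace ℝ (Fin 2)

/-- `L²(Ω; ℝ²)`, with norm `‖v‖² = ∫_Ω |v|² dx dy`. -/
abbrev L2Field : Type := Lp Vec 2 (volume : Measure Strip)

/-! ### Test functions and partial derivatives on the strip -/

/-- The classical partial derivative `∂₁ f = ∂f/∂x` of a function on the strip. -/
def d1 (f : Strip → ℝ) (z : Strip) : ℝ :=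
  deriv (fun h : ℝ => f (z.1 + (h : UnitAddCircle), z.2)) 0

/-- The classical partial derivative `∂₂ f = ∂f/∂y` of a function on the strip. -/
def d2 (f : Strip → ℝ) (z : Strip) : ℝ :=
  deriv (fun y : ℝ => f (z.1, y)) z.2

/-- `ψ ∈ C_c^∞(Ω)`. Smoothness is that of the lift to the universal cover `ℝ × ℝ`. -/
structure IsTestFunction (ψ : Strip → ℝ) : Prop where
  smooth : ContDiff ℝ ∞ (fun q : ℝ × ℝ => ψ ((q.1 : UnitAddCircle), q.2))
  compactSupport : HasCompactSupport ψ

/-- `φ ∈ C_c^∞((0, ∞) × Ω)`; the first argument of `φ` is time. -/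
structure IsSpaceTimeTestFunction (φ : ℝ → Strip → ℝ) : Prop where
  smooth : ContDiff ℝ ∞
    (fun q : ℝ × ℝ × ℝ => φ q.1 ((q.2.1 : UnitAddCircle), q.2.2))
  compactSupport : HasCompactSupport (fun q : ℝ × Strip => φ q.1 q.2)
  support_subset : tsupport (fun q : ℝ × Strip => φ q.1 q.2) ⊆ Set.Ioi (0 : ℝ) ×ˢ Set.univ

/-- `∇ · v = 0` in the sense of distributions on the strip. -/
def IsDivergenceFree (v : L2Field) : Prop :=
  ∀ ψ : Strip → ℝ, IsTestFunction ψ → ∫ z, (v z 0 * d1 ψ z + v z 1 * d2 ψ z) = 0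

/-- `w = ∂₂ v` in the sense of distributions, componentwise. -/
def IsWeakD2 (v w : L2Field) : Prop :=
  ∀ ψ : Strip → ℝ, IsTestFunction ψ → ∀ i : Fin 2,
    ∫ z, v z i * d2 ψ z = - ∫ z, w z i * ψ z

/-! ### Sobolev spaces of real order through the Fourier transform -/

/-- The `k`-th Fourier coefficient in `x`, as a function of `y`. -/
def xCoeff (f : Lp ℂ 2 (volume : Measure Strip)) (k : ℤ) (y : ℝ) : ℂ :=
  ∫ x : UnitAddCircle, fourier (-k) x * f (x, y)

theorem xCoeff_memLp (f : Lp ℂ 2 (volume : Measure Strip)) (k : ℤ) :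
    MemLp (xCoeff f k) 2 (volume : Measure ℝ) := by
  have hprob : IsProbabilityMeasure (volume : Measure UnitAddCircle) := ⟨by simp⟩
  have hf : StronglyMeasurable f := Lp.stronglyMeasurable f
  have hg : StronglyMeasurable (fun z : Strip => fourier (-k) z.1 * f z) :=
    (((fourier (-k)).continuous.comp continuous_fst).stronglyMeasurable).mul hf
  refine ⟨(hg.integral_prod_left').aestronglyMeasurable, ?_⟩
  have hfin := (Lp.memLp f).2
  rw [eLpNorm_lt_top_iff_lintegral_rpow_enorm_lt_top (by norm_num) (by norm_num)] at hfin ⊢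
  refine lt_of_le_of_lt ?_ hfin
  have hmeas : Measurable (fun z : Strip => ‖f z‖ₑ ^ (2 : ℝ≥0∞).toReal) :=
    hf.enorm.pow_const _
  change _ ≤ ∫⁻ z, ‖f z‖ₑ ^ (2 : ℝ≥0∞).toReal
    ∂((volume : Measure UnitAddCircle).prod (volume : Measure ℝ))
  rw [lintegral_prod_symm' _ hmeas]
  refine lintegral_mono fun y => ?_
  have h1 : ‖xCoeff f k y‖ₑ ≤ eLpNorm (fun x : UnitAddCircle => f (x, y)) 1 volume := by
    rw [eLpNorm_one_eq_lintegral_enorm]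
    refine (enorm_integral_le_lintegral_enorm _).trans (le_of_eq ?_)
    refine lintegral_congr fun x => ?_
    rw [enorm_mul]
    have : ‖fourier (-k) x‖ₑ = 1 := by
      have hn : ‖fourier (-k) x‖ = 1 := by rw [fourier_apply]; exact Circle.norm_coe _
      rw [← ofReal_norm, hn, ENNReal.ofReal_one]
    rw [this, one_mul]
  have h2 := h1.trans (eLpNorm_le_eLpNorm_of_exponent_le (p := 1) (q := 2) (by norm_num)
    (hf.comp_measurable measurable_prodMk_right).aestronglyMeasurable)
  refine (ENNReal.rpow_le_rpow h2 (by norm_num)).trans (le_of_eq ?_)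
  rw [eLpNorm_eq_lintegral_rpow_enorm_toReal (by norm_num) (by norm_num), ← ENNReal.rpow_mul]
  norm_num

/-- The Fourier transform `f̂(k, ξ)` of `f ∈ L²(Ω)`, with `k ∈ ℤ` dual to `x` and `ξ ∈ ℝ` dual
to `y`, normalized so that `f̂(k, ξ) = ∫_Ω f(x, y) exp(-2πi(kx + ξy)) dx dy` for integrable `f`. -/
def fourierStrip (f : Lp ℂ 2 (volume : Measure Strip)) (k : ℤ) :
    Lp ℂ 2 (volume : Measure ℝ) :=
  𝓕 ((xCoeff_memLp f k).toLp (xCoeff f k))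

/-- The squared norm of `f` in `H^s(Ω)`, possibly infinite:
`∑ₖ ∫ (1 + (2πk)² + (2πξ)²)^s |f̂(k, ξ)|² dξ`. -/
def sobolevNormSq (s : ℝ) (f : Lp ℂ 2 (volume : Measure Strip)) : ℝ≥0∞ :=
  ∑' k : ℤ, ∫⁻ ξ : ℝ,
    ENNReal.ofReal ((1 + (2 * Real.pi * k) ^ 2 + (2 * Real.pi * ξ) ^ 2) ^ s) *
      ‖fourierStrip f k ξ‖ₑ ^ 2

/-- The `i`-th component of a vector field, regarded as a complex-valued function. -/
def component (i : Fin 2) (v : L2Field) : Lp ℂ 2 (volume : Measure Strip) :=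
  (Complex.ofRealCLM.comp (EuclideanSpace.proj i : Vec →L[ℝ] ℝ)).compLp v

/-- The squared norm of a vector field in `H^s(Ω)`, possibly infinite. -/
def fieldSobolevNormSq (s : ℝ) (v : L2Field) : ℝ≥0∞ :=
  ∑ i : Fin 2, sobolevNormSq s (component i v)

/-- `v ∈ H^s(Ω; ℝ²)`. -/
def MemSobolev (s : ℝ) (v : L2Field) : Prop :=
  fieldSobolevNormSq s v < ⊤

/-! ### The MHD system with horizontal dissipation -/

/-- `∂ₜ u + u · ∇u - ν ∂₁² u + ∇p = b · ∇b` in the sense of distributions on `(0, ∞) × Ω`. For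
divergence-free fields `u · ∇u = ∇ · (u ⊗ u)` and `b · ∇b = ∇ · (b ⊗ b)`. -/
def MomentumEquation (ν : ℝ) (u b : ℝ → L2Field) (p : ℝ → Strip → ℝ) : Prop :=
  ∀ φ : ℝ → Strip → ℝ, IsSpaceTimeTestFunction φ → ∀ i : Fin 2,
    ∫ t in Set.Ioi (0 : ℝ), ∫ z : Strip,
      (u t z i * deriv (fun τ => φ τ z) t
        + u t z i * (u t z 0 * d1 (φ t) z + u t z 1 * d2 (φ t) z)
        + ν * (u t z i * d1 (d1 (φ t)) z)
        + p t z * (if i = 0 then d1 (φ t) z else d2 (φ t) z)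
        - b t z i * (b t z 0 * d1 (φ t) z + b t z 1 * d2 (φ t) z)) = 0

/-- `∂ₜ b + u · ∇b - η ∂₁² b = b · ∇u` in the sense of distributions on `(0, ∞) × Ω`. For
divergence-free fields `u · ∇b = ∇ · (b ⊗ u)` and `b · ∇u = ∇ · (u ⊗ b)`. -/
def InductionEquation (η : ℝ) (u b : ℝ → L2Field) : Prop :=
  ∀ φ : ℝ → Strip → ℝ, IsSpaceTimeTestFunction φ → ∀ i : Fin 2,
    ∫ t in Set.Ioi (0 : ℝ), ∫ z : Strip,
      (b t z i * deriv (fun τ => φ τ z) t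
        + b t z i * (u t z 0 * d1 (φ t) z + u t z 1 * d2 (φ t) z)
        + η * (b t z i * d1 (d1 (φ t)) z)
        - u t z i * (b t z 0 * d1 (φ t) z + b t z 1 * d2 (φ t) z)) = 0

/-- `(u, b)` is a global `H^s` solution of the system with initial data `(u₀, b₀)`: the fields are
continuous in time with values in `L²`, bounded in `H^s` on every bounded time interval,
divergence-free, and solve the equations for some locally integrable pressure. -/
structure IsGlobalSolution (ν η s : ℝ) (u₀ b₀ : L2Field) (u b : ℝ → L2Field) : Prop where
  continuousOn_u : ContinuousOn u (Set.Ici 0)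
  continuousOn_b : ContinuousOn b (Set.Ici 0)
  initial_u : u 0 = u₀
  initial_b : b 0 = b₀
  sobolev_bound : ∀ T : ℝ, ∃ M : ℝ≥0, ∀ t ∈ Set.Icc 0 T,
    fieldSobolevNormSq s (u t) ≤ M ∧ fieldSobolevNormSq s (b t) ≤ M
  divFree_u : ∀ t : ℝ, 0 ≤ t → IsDivergenceFree (u t)
  divFree_b : ∀ t : ℝ, 0 ≤ t → IsDivergenceFree (b t)
  momentum : ∃ p : ℝ → Strip → ℝ,
    LocallyIntegrableOn (fun q : ℝ × Strip => p q.1 q.2) (Set.Ioi (0 : ℝ) ×ˢ Set.univ) ∧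
      MomentumEquation ν u b p
  induction : InductionEquation η u b

/-! ### The average in `x` and the remainder -/

/-- The `x`-average `f̄(y) = ∫_𝕋 f(x', y) dx'`. -/
def xAverage (f : Strip → Vec) (y : ℝ) : Vec := ∫ x : UnitAddCircle, f (x, y)

/-- The remainder `f̃(x, y) = f(x, y) - f̄(y)`. -/
def remainder (f : Strip → Vec) (z : Strip) : Vec := f z - xAverage f z.2

/-- `‖(f, g)‖_{L²(Ω)} = (‖f‖²_{L²} + ‖g‖²_{L²})^{1/2}`, possibly infinite. -/
def pairL2Norm (f g : Strip → Vec) : ℝ≥0∞ :=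
  (eLpNorm f 2 volume ^ 2 + eLpNorm g 2 volume ^ 2) ^ (1 / 2 : ℝ)

end MHD

end

/-! Everything rests on two quadratic functionals of a solution: the energy `E = ‖(u,b)‖² +
‖∂₂(u,b)‖²` (`quad oneSubLap`) and the squared norm of the remainder (`quad (fun f => f - avg f)`).
Put `m = min ν η`. Dissipation acts only in `x`, so each nonlinear contribution must be bounded by
`√E` times a square of horizontal derivatives; small energy then lets the dissipation absorb it.

Two structural facts make this possible. The top-order transport terms cancel: advection by a
solenoidal field is skew, and the two exchange terms between `u` and `b` compensate each other
(`inner_rhs_add`, `advectMain_skew`). What is left always contains a factor of zero horizontal mean: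
a `∂₁` derivative, the second component of a solenoidal field (`avg_eq_zero_of_div`), or its `∂₂`
derivative, which is minus `∂₁` of the first component. For such triple products `abs_tri_le` yields
one horizontal derivative besides the mean-zero factor, because means alone integrate to zero
(`tri_avg_avg`) and oscillations obey a horizontal Poincaré inequality. The underlying product
estimate bounds one factor by a function of `y`, the other by a function of `x`.

Hence `flux_oneSubLap_nonpos`: while `E ≤ (m/128)²`, the energy does not increase. A continuity
argument (`le_initial_of_threshold`) makes the bound global. Under it, `flux_sub_avg_le` and
Poincaré give `q' ≤ -m q` in integrated form for the squared remainder `q`, and exponential decay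
follows.

The rest justifies these computations for solutions that are only continuous in `L²` and locally
bounded in `H^s`. Derivatives are strong `L²` derivatives of translations, so they commute with
every bounded translation-invariant operator; Plancherel gives two of them from `s ≥ 2`. The
pressure disappears on testing with curls of test functions, whose closure contains every solenoidal
`H¹` field (`mem_closure_curlSpan`). `quadratic_sub_eq_integral` differentiates bounded quadratic
functionals along such weak solutions; the unbounded `1 - ∂₂²` is reached through difference
quotients (`energy_balance`). -/

noncomputable section

namespace MHD

/-! ### Translations on the strip and their generators -/

instance : IsProbabilityMeasure (volume : Measure UnitAddCircle) := ⟨by simp⟩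

instance : (volume : Measure Strip).IsAddLeftInvariant :=
  inferInstanceAs ((volume : Measure UnitAddCircle).prod (volume : Measure ℝ)).IsAddLeftInvariant

/-- The one-parameter group of translations along the `i`-th coordinate. -/
def dir (i : Fin 2) (s : ℝ) : Strip := if i = 0 then ((s : UnitAddCircle), 0) else (0, s)

@[simp] theorem dir_zero (i : Fin 2) : dir i 0 = 0 := by
  unfold dir; split <;> simp

theorem dir_add (i : Fin 2) (s t : ℝ) : dir i (s + t) = dir i s + dir i t := by
  unfold dir; split <;> simp

theorem dir_neg (i : Fin 2) (s : ℝ) : dir i (-s) = -dir i s := by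
  unfold dir; split <;> simp

theorem continuous_dir (i : Fin 2) : Continuous (dir i) := by
  unfold dir
  split
  · exact (AddCircle.continuous_mk' 1).prodMk continuous_const
  · exact continuous_const.prodMk continuous_id

variable {E : Type*} [NormedAddCommGroup E] [NormedSpace ℝ E]

/-- Translation of an `L²` function: `(shift a f)(z) = f(z + a)`. -/
def shift (a : Strip) : Lp E 2 (volume : Measure Strip) →ₗᵢ[ℝ] Lp E 2 (volume : Measure Strip) :=
  Lp.compMeasurePreservingₗᵢ ℝ (fun z => z + a) (measurePreserving_add_right volume a)

theorem coeFn_shift (a : Strip) (f : Lp E 2 (volume : Measure Strip)) :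
    shift a f =ᵐ[volume] fun z => f (z + a) :=
  Lp.coeFn_compMeasurePreserving f (measurePreserving_add_right volume a)

theorem ae_shift {p : Strip → Prop} (a : Strip) (h : ∀ᵐ z, p z) : ∀ᵐ z, p (z + a) :=
  (measurePreserving_add_right volume a).quasiMeasurePreserving.ae h

theorem shift_shift (a b : Strip) (f : Lp E 2 (volume : Measure Strip)) :
    shift a (shift b f) = shift (a + b) f := by
  apply Lp.ext
  filter_upwards [coeFn_shift a (shift b f), coeFn_shift (a + b) f,
    ae_shift a (coeFn_shift b f)] with z h1 h2 h3
  rw [h1, h2, h3, add_assoc]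

@[simp] theorem shift_zero (f : Lp E 2 (volume : Measure Strip)) : shift 0 f = f := by
  apply Lp.ext
  filter_upwards [coeFn_shift 0 f] with z h1
  rw [h1, add_zero]

theorem continuous_shift (f : Lp E 2 (volume : Measure Strip)) :
    Continuous fun a : Strip => shift a f := by
  refine Continuous.compMeasurePreservingLp (f := fun _ : Strip => f)
    (g := fun a : Strip => (⟨fun z => z + a, by fun_prop⟩ : C(Strip, Strip)))
    continuous_const ?_ (fun a => measurePreserving_add_right volume a) (by norm_num)
  refine ContinuousMap.continuous_of_continuous_uncurry _ ?_
  exact continuous_snd.add continuous_fst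

theorem continuous_shift_dir (i : Fin 2) (f : Lp E 2 (volume : Measure Strip)) :
    Continuous fun s : ℝ => shift (dir i s) f :=
  (continuous_shift f).comp (continuous_dir i)

/-- `w` is the strong `L²` derivative of `f` in the `i`-th direction. -/
def HasPD (i : Fin 2) (f w : Lp E 2 (volume : Measure Strip)) : Prop :=
  HasDerivAt (fun s : ℝ => shift (dir i s) f) w 0

/-- The strong `L²` derivative in the `i`-th direction (zero if it does not exist). -/
def pd (i : Fin 2) (f : Lp E 2 (volume : Measure Strip)) : Lp E 2 (volume : Measure Strip) :=
  deriv (fun s : ℝ => shift (dir i s) f) 0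

theorem HasPD.pd_eq {i : Fin 2} {f w : Lp E 2 (volume : Measure Strip)} (h : HasPD i f w) :
    pd i f = w := HasDerivAt.deriv h

theorem HasPD.add {i : Fin 2} {f g v w : Lp E 2 (volume : Measure Strip)} (h : HasPD i f v)
    (h' : HasPD i g w) : HasPD i (f + g) (v + w) := by
  unfold HasPD at *
  simpa only [map_add] using HasDerivAt.fun_add h h'

theorem HasPD.sub {i : Fin 2} {f g v w : Lp E 2 (volume : Measure Strip)} (h : HasPD i f v)
    (h' : HasPD i g w) : HasPD i (f - g) (v - w) := by
  unfold HasPD at *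
  simpa only [map_sub] using HasDerivAt.fun_sub h h'

/-- A bounded operator that commutes with translations passes through the difference quotient. This
is why strong derivatives are used: averages, components, complexification, the curl projection and
difference quotients all qualify. -/
theorem HasPD.map {F : Type*} [NormedAddCommGroup F] [NormedSpace ℝ F] {i : Fin 2}
    {f w : Lp E 2 (volume : Measure Strip)} (h : HasPD i f w)
    (A : Lp E 2 (volume : Measure Strip) →L[ℝ] Lp F 2 (volume : Measure Strip))
    (hA : ∀ a g, A (shift a g) = shift a (A g)) : HasPD i (A f) (A w) := by
  have := A.hasFDerivAt.comp_hasDerivAt (0 : ℝ) h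
  simpa [HasPD, Function.comp_def, hA] using this

theorem HasPD.shift {i : Fin 2} {f w : Lp E 2 (volume : Measure Strip)} (h : HasPD i f w)
    (a : Strip) : HasPD i (shift a f) (shift a w) :=
  h.map (MHD.shift a).toContinuousLinearMap fun b g => by
    simp [shift_shift, add_comm]

theorem HasPD.hasDerivAt {i : Fin 2} {f w : Lp E 2 (volume : Measure Strip)} (h : HasPD i f w)
    (s : ℝ) : HasDerivAt (fun s : ℝ => MHD.shift (dir i s) f) (MHD.shift (dir i s) w) s := by
  have h1 : HasDerivAt (fun r : ℝ => MHD.shift (dir i r) (MHD.shift (dir i s) f))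
      (MHD.shift (dir i s) w) (s - s) := by
    rw [sub_self]; exact h.shift (dir i s)
  have := h1.comp_sub_const s s
  refine this.congr_of_eventuallyEq (Eventually.of_forall fun r => ?_)
  simp only [shift_shift, ← dir_add, sub_add_cancel]

theorem HasPD.tendsto {i : Fin 2} {f w : Lp E 2 (volume : Measure Strip)} (h : HasPD i f w) :
    Tendsto (fun s : ℝ => s⁻¹ • (MHD.shift (dir i s) f - f)) (𝓝[≠] 0) (𝓝 w) := by
  simpa using hasDerivAt_iff_tendsto_slope_zero.1 h

/-- The orbit has derivative `shift (dir i s) w` at every time, of constant norm `‖w‖`, so the mean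
value inequality applies. -/
theorem HasPD.norm_shift_sub_le {i : Fin 2} {f w : Lp E 2 (volume : Measure Strip)}
    (h : HasPD i f w) (s : ℝ) : ‖MHD.shift (dir i s) f - f‖ ≤ ‖w‖ * |s| := by
  have := Convex.norm_image_sub_le_of_norm_hasDerivWithin_le (s := Set.univ)
    (f := fun s : ℝ => MHD.shift (dir i s) f) (C := ‖w‖) (x := 0) (y := s)
    (fun x _ => (h.hasDerivAt x).hasDerivWithinAt) (fun x _ => by simp) convex_univ trivial trivial
  simpa using this

theorem HasPD.shift_eq_of_zero {i : Fin 2} {f : Lp E 2 (volume : Measure Strip)}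
    (h : HasPD i f 0) (s : ℝ) : MHD.shift (dir i s) f = f := by
  have := h.norm_shift_sub_le s
  simpa [sub_eq_zero] using this

section Inner

variable {F : Type*} [NormedAddCommGroup F] [InnerProductSpace ℝ F]

theorem inner_shift_left (a : Strip) (f g : Lp F 2 (volume : Measure Strip)) :
    inner ℝ (shift a f) g = inner ℝ f (shift (-a) g) := by
  have := (shift (-a)).inner_map_map (shift a f) g
  rw [← this, shift_shift]; simp

/-- Integration by parts for strong derivatives. -/
theorem HasPD.inner_left {i : Fin 2} {f g v w : Lp F 2 (volume : Measure Strip)}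
    (h : HasPD i f v) (h' : HasPD i g w) : inner ℝ v g = -inner ℝ f w := by
  have h1 : HasDerivAt (fun s : ℝ => inner ℝ (MHD.shift (dir i s) f) (MHD.shift (dir i s) g))
      (inner ℝ f w + inner ℝ v g) 0 := by
    simpa using HasDerivAt.inner ℝ h h'
  -- Translating both arguments leaves the pairing constant, so its derivative vanishes.
  simp only [LinearIsometry.inner_map_map] at h1
  have := h1.unique (hasDerivAt_const 0 (inner ℝ f g))
  linarith

end Inner

end MHD

namespace MHD

/-! ### The Fourier transform on the strip -/

theorem ae_ae_of_ae_strip {p : Strip → Prop} (h : ∀ᵐ z, p z) :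
    ∀ᵐ y : ℝ, ∀ᵐ x : UnitAddCircle, p (x, y) :=
  Measure.ae_ae_of_ae_prod
    ((Measure.measurePreserving_swap (μ := (volume : Measure ℝ))
      (ν := (volume : Measure UnitAddCircle))).quasiMeasurePreserving.ae h)

/-- The Fourier transform on `L²(ℝ)` turns translations into modulations. -/
theorem fourier_comp_add_right_Lp (s : ℝ) (g : Lp ℂ 2 (volume : Measure ℝ)) :
    (𝓕 (Lp.compMeasurePreservingₗᵢ ℂ (fun y : ℝ => y + s)
        (measurePreserving_add_right volume s) g) : Lp ℂ 2 (volume : Measure ℝ)) =ᵐ[volume]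
      fun ξ => Complex.exp (2 * Real.pi * Complex.I * s * ξ) *
        (𝓕 g : Lp ℂ 2 (volume : Measure ℝ)) ξ := by
  have hm : MemLp (fun ξ : ℝ => Complex.exp (2 * Real.pi * Complex.I * s * ξ)) ∞
      (volume : Measure ℝ) := by
    refine memLp_top_of_bound (Continuous.aestronglyMeasurable (by fun_prop)) 1
      (Eventually.of_forall fun ξ => ?_)
    rw [show 2 * Real.pi * Complex.I * s * ξ = ((2 * Real.pi * s * ξ : ℝ) : ℂ) * Complex.I by
      push_cast; ring, Complex.norm_exp_ofReal_mul_I]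
  -- Modulation as a bounded operator: both sides of the identity are then continuous in `g`, and
  -- Schwartz functions suffice.
  let M : Lp ℂ 2 (volume : Measure ℝ) →L[ℂ] Lp ℂ 2 (volume : Measure ℝ) :=
    (ContinuousLinearMap.mul ℂ ℂ).holderL volume ∞ 2 2 (hm.toLp _)
  have hM : ∀ h : Lp ℂ 2 (volume : Measure ℝ), M h =ᵐ[volume]
      fun ξ => Complex.exp (2 * Real.pi * Complex.I * s * ξ) * h ξ := by
    intro h
    have h1 := (ContinuousLinearMap.mul ℂ ℂ).coeFn_holder (r := 2) (hm.toLp _) h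
    filter_upwards [h1, hm.coeFn_toLp] with ξ h1 h2
    change ((ContinuousLinearMap.mul ℂ ℂ).holder 2 (hm.toLp _) h) ξ = _
    rw [h1, ContinuousLinearMap.mul_apply', h2]
  let τ := Lp.compMeasurePreservingₗᵢ ℂ (E := ℂ) (p := 2) (fun y : ℝ => y + s)
    (measurePreserving_add_right volume s)
  suffices 𝓕 (τ g) = M (𝓕 g) by
    change (𝓕 (τ g) : Lp ℂ 2 (volume : Measure ℝ)) =ᵐ[volume] _
    rw [this]; exact hM _
  refine DenseRange.induction_on (p := fun g => 𝓕 (τ g) = M (𝓕 g))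
    (SchwartzMap.denseRange_toLpCLM (E := ℝ) (F := ℂ) (μ := volume) (p := 2)
      ENNReal.ofNat_ne_top) g ?_ ?_
  · refine isClosed_eq ?_ ?_
    · exact (Lp.fourierTransformₗᵢ ℝ ℂ).continuous.comp τ.continuous
    · exact M.continuous.comp (Lp.fourierTransformₗᵢ ℝ ℂ).continuous
  · intro f
    change 𝓕 (τ (f.toLp 2)) = M (𝓕 (f.toLp 2))
    have h1 : τ (f.toLp 2) = (f.compSubConstCLM ℝ (-s)).toLp 2 := by
      apply Lp.ext
      have h2 : τ (f.toLp 2) =ᵐ[volume] fun y => (f.toLp 2 : Lp ℂ 2 (volume : Measure ℝ)) (y + s) :=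
        Lp.coeFn_compMeasurePreserving _ _
      have h3 := (measurePreserving_add_right (volume : Measure ℝ) s).quasiMeasurePreserving.ae
        (SchwartzMap.coeFn_toLp f 2 volume)
      filter_upwards [h2, h3, SchwartzMap.coeFn_toLp (f.compSubConstCLM ℝ (-s)) 2 volume]
        with y h2 h3 h4
      rw [h2, h3, h4, SchwartzMap.compSubConstCLM_apply, sub_neg_eq_add]
    rw [h1, SchwartzMap.toLp_fourier_eq, SchwartzMap.toLp_fourier_eq]
    apply Lp.ext
    filter_upwards [hM ((𝓕 f).toLp 2), SchwartzMap.coeFn_toLp (𝓕 f) 2 volume,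
      SchwartzMap.coeFn_toLp (𝓕 (f.compSubConstCLM ℝ (-s))) 2 volume] with ξ h1 h2 h3
    rw [h1, h2, h3, SchwartzMap.fourier_coe, SchwartzMap.fourier_coe]
    have h4 := congrFun (VectorFourier.fourierIntegral_comp_add_right Real.fourierChar
      (volume : Measure ℝ) (innerₗ ℝ) f s) ξ
    have h5 : ⇑(f.compSubConstCLM ℝ (-s)) = (f ∘ fun v => v + s) := by
      ext y; simp [SchwartzMap.compSubConstCLM_apply]
    rw [h5]
    change VectorFourier.fourierIntegral Real.fourierChar volume (innerₗ ℝ) (f ∘ fun v => v + s) ξ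
      = _ * VectorFourier.fourierIntegral Real.fourierChar volume (innerₗ ℝ) f ξ
    rw [h4, Circle.smul_def, Real.fourierChar_apply, smul_eq_mul]
    congr 2
    simp
    ring

/-- The `k`-th Fourier coefficient in `x`, as an element of `L²(ℝ)`. -/
def xCoeffLp (f : Lp ℂ 2 (volume : Measure Strip)) (k : ℤ) : Lp ℂ 2 (volume : Measure ℝ) :=
  (xCoeff_memLp f k).toLp (xCoeff f k)

theorem coeFn_xCoeffLp (f : Lp ℂ 2 (volume : Measure Strip)) (k : ℤ) :
    xCoeffLp f k =ᵐ[volume] xCoeff f k := (xCoeff_memLp f k).coeFn_toLp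

/-- Almost every horizontal slice of an `L²` function on the strip is in `L²(𝕋)`. -/
theorem ae_memLp_slice {E : Type*} [NormedAddCommGroup E] (f : Lp E 2 (volume : Measure Strip)) :
    ∀ᵐ y : ℝ, MemLp (fun x : UnitAddCircle => f (x, y)) 2 volume := by
  have hf : StronglyMeasurable f := Lp.stronglyMeasurable f
  have hfin := (Lp.memLp f).2
  rw [eLpNorm_lt_top_iff_lintegral_rpow_enorm_lt_top (by norm_num) (by norm_num)] at hfin
  have hmeas : Measurable (fun z : Strip => ‖f z‖ₑ ^ (2 : ℝ≥0∞).toReal) :=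
    hf.enorm.pow_const _
  change ∫⁻ z, ‖f z‖ₑ ^ (2 : ℝ≥0∞).toReal
    ∂((volume : Measure UnitAddCircle).prod (volume : Measure ℝ)) < ⊤ at hfin
  rw [lintegral_prod_symm' _ hmeas] at hfin
  filter_upwards [ae_lt_top hmeas.lintegral_prod_left' hfin.ne] with y hy
  refine ⟨(hf.comp_measurable measurable_prodMk_right).aestronglyMeasurable, ?_⟩
  rw [eLpNorm_lt_top_iff_lintegral_rpow_enorm_lt_top (by norm_num) (by norm_num)]
  exact hy

theorem integrable_fourier_mul_slice {f : UnitAddCircle → ℂ} (hf : MemLp f 2 volume) (k : ℤ) :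
    Integrable (fun x => fourier k x * f x) := by
  refine (hf.integrable (by norm_num)).bdd_mul (c := 1)
    (fourier k).continuous.aestronglyMeasurable (Eventually.of_forall fun x => ?_)
  rw [fourier_apply]; exact (Circle.norm_coe _).le

theorem xCoeffLp_sub (f g : Lp ℂ 2 (volume : Measure Strip)) (k : ℤ) :
    xCoeffLp (f - g) k = xCoeffLp f k - xCoeffLp g k := by
  apply Lp.ext
  filter_upwards [coeFn_xCoeffLp (f - g) k, coeFn_xCoeffLp f k, coeFn_xCoeffLp g k,
    Lp.coeFn_sub (xCoeffLp f k) (xCoeffLp g k), ae_memLp_slice f, ae_memLp_slice g,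
    ae_ae_of_ae_strip (Lp.coeFn_sub f g)] with y h1 h2 h3 h4 h5 h6 h7
  rw [h4, Pi.sub_apply, h1, h2, h3]
  unfold xCoeff
  rw [← integral_sub (integrable_fourier_mul_slice h5 _) (integrable_fourier_mul_slice h6 _)]
  refine integral_congr_ae ?_
  filter_upwards [h7] with x hx
  rw [hx, Pi.sub_apply, mul_sub]

theorem xCoeffLp_smul (c : ℝ) (f : Lp ℂ 2 (volume : Measure Strip)) (k : ℤ) :
    xCoeffLp (c • f) k = (c : ℂ) • xCoeffLp f k := by
  apply Lp.ext
  filter_upwards [coeFn_xCoeffLp (c • f) k, coeFn_xCoeffLp f k,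
    Lp.coeFn_smul (c : ℂ) (xCoeffLp f k), ae_ae_of_ae_strip (Lp.coeFn_smul c f)] with y h1 h2 h4 h7
  rw [h4, Pi.smul_apply, h1, h2, smul_eq_mul]
  unfold xCoeff
  rw [← integral_const_mul]
  refine integral_congr_ae ?_
  filter_upwards [h7] with x hx
  rw [hx, Pi.smul_apply, Complex.real_smul]
  ring

theorem xCoeffLp_shift (a : Strip) (f : Lp ℂ 2 (volume : Measure Strip)) (k : ℤ) :
    xCoeffLp (shift a f) k = (fourier k a.1 : ℂ) •
      Lp.compMeasurePreservingₗᵢ ℂ (fun y : ℝ => y + a.2)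
        (measurePreserving_add_right volume a.2) (xCoeffLp f k) := by
  apply Lp.ext
  have h2 : Lp.compMeasurePreservingₗᵢ ℂ (fun y : ℝ => y + a.2)
        (measurePreserving_add_right volume a.2) (xCoeffLp f k) =ᵐ[volume]
      fun y => xCoeffLp f k (y + a.2) := Lp.coeFn_compMeasurePreserving _ _
  filter_upwards [coeFn_xCoeffLp (shift a f) k, h2,
    (measurePreserving_add_right (volume : Measure ℝ) a.2).quasiMeasurePreserving.ae
      (coeFn_xCoeffLp f k),
    Lp.coeFn_smul (fourier k a.1 : ℂ) (Lp.compMeasurePreservingₗᵢ ℂ (fun y : ℝ => y + a.2)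
        (measurePreserving_add_right volume a.2) (xCoeffLp f k)),
    ae_ae_of_ae_strip (coeFn_shift a f)] with y h1 h2 h3 h4 h7
  rw [h1, h4, Pi.smul_apply, h2, h3, smul_eq_mul]
  unfold xCoeff
  rw [← integral_add_right_eq_self (fun x => fourier (-k) x * f (x, y + a.2)) a.1,
    ← integral_const_mul]
  refine integral_congr_ae ?_
  filter_upwards [h7] with x hx
  rw [hx]
  have h8 : (fourier k a.1 : ℂ) * fourier (-k) a.1 = 1 := by
    rw [← fourier_add, add_neg_cancel, fourier_zero]
  have h9 : (fourier (-k) (x + a.1) : ℂ) = fourier (-k) x * fourier (-k) a.1 := by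
    simp only [fourier_apply, smul_add, AddCircle.toCircle_add, Circle.coe_mul]
  rw [h9, show ((x, y) : Strip) + a = (x + a.1, y + a.2) from rfl]
  linear_combination (-(fourier (-k) x : ℂ) * f (x + a.1, y + a.2)) * h8

/-- Parseval's identity in the horizontal variable. -/
theorem lintegral_enorm_sq_eq_tsum_xCoeff (f : Lp ℂ 2 (volume : Measure Strip)) :
    ∫⁻ z, ‖f z‖ₑ ^ 2 = ∑' k : ℤ, ∫⁻ y, ‖xCoeff f k y‖ₑ ^ 2 := by
  have hf : StronglyMeasurable f := Lp.stronglyMeasurable f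
  change ∫⁻ z, ‖f z‖ₑ ^ 2 ∂((volume : Measure UnitAddCircle).prod (volume : Measure ℝ)) = _
  rw [lintegral_prod_symm' _ (hf.enorm.pow_const 2), ← lintegral_tsum fun k =>
    (xCoeff_memLp f k).1.enorm.pow_const 2]
  refine lintegral_congr_ae ?_
  filter_upwards [ae_memLp_slice f] with y hy
  -- The circle has length one, so its volume is the normalized Haar measure of the Fourier series
  -- theory.
  have hv : (AddCircle.haarAddCircle : Measure UnitAddCircle) = volume := by
    simp [AddCircle.volume_eq_smul_haarAddCircle]
  have h1 := hasSum_sq_fourierCoeff ((hv ▸ hy :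
    MemLp (fun x : UnitAddCircle => f (x, y)) 2 AddCircle.haarAddCircle).toLp _)
  have hc : ∀ k, fourierCoeff ((hv ▸ hy :
      MemLp (fun x : UnitAddCircle => f (x, y)) 2 AddCircle.haarAddCircle).toLp _) k
      = xCoeff f k y := by
    intro k
    rw [fourierCoeff_congr_ae (MemLp.coeFn_toLp _)]
    simp only [fourierCoeff, xCoeff, smul_eq_mul, hv]
  simp only [hc] at h1
  have h2 : ∫ t : UnitAddCircle, ‖((hv ▸ hy :
      MemLp (fun x : UnitAddCircle => f (x, y)) 2 AddCircle.haarAddCircle).toLp _) t‖ ^ 2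
      ∂AddCircle.haarAddCircle = ∫ x : UnitAddCircle, ‖f (x, y)‖ ^ 2 := by
    refine (integral_congr_ae (g := fun x => ‖f (x, y)‖ ^ 2) ?_).trans (by rw [hv])
    exact (MemLp.coeFn_toLp _).fun_comp fun w => ‖w‖ ^ 2
  rw [h2] at h1
  have h3 : ∀ w : ℂ, ‖w‖ₑ ^ 2 = ENNReal.ofReal (‖w‖ ^ 2) := fun w => by
    rw [ENNReal.ofReal_pow (norm_nonneg _), ofReal_norm]
  simp only [h3]
  rw [← ENNReal.ofReal_tsum_of_nonneg (fun k => by positivity) h1.summable, h1.tsum_eq,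
    ofReal_integral_eq_lintegral_ofReal hy.norm.integrable_sq
      (Eventually.of_forall fun x => by positivity)]

/-- The measure on the frequency space `ℤ × ℝ`. -/
abbrev freqMeasure : Measure (ℤ × ℝ) := (Measure.count : Measure ℤ).prod volume

/-- The Fourier transform as a function on frequency space. -/
def ft (f : Lp ℂ 2 (volume : Measure Strip)) (p : ℤ × ℝ) : ℂ := fourierStrip f p.1 p.2

theorem measurable_ft (f : Lp ℂ 2 (volume : Measure Strip)) : Measurable (ft f) :=
  measurable_from_prod_countable_right fun k =>
    (Lp.stronglyMeasurable (fourierStrip f k)).measurable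

theorem lintegral_freq {g : ℤ × ℝ → ℝ≥0∞} (hg : Measurable g) :
    ∫⁻ p, g p ∂freqMeasure = ∑' k : ℤ, ∫⁻ ξ, g (k, ξ) := by
  rw [lintegral_prod _ hg.aemeasurable, lintegral_count]

theorem ae_freq {p : ℤ × ℝ → Prop} (hp : MeasurableSet {q | p q}) (h : ∀ k, ∀ᵐ ξ, p (k, ξ)) :
    ∀ᵐ q ∂freqMeasure, p q :=
  (Measure.ae_prod_iff_ae_ae hp).2 (Eventually.of_forall h)

theorem enorm_sq_eq_lintegral {α E : Type*} [MeasurableSpace α] {μ : Measure α}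
    [NormedAddCommGroup E] (f : Lp E 2 μ) :
    ‖f‖ₑ ^ 2 = ∫⁻ z, ‖f z‖ₑ ^ 2 ∂μ := by
  rw [Lp.enorm_def, eLpNorm_eq_lintegral_rpow_enorm_toReal (by norm_num) (by norm_num),
    ← ENNReal.rpow_natCast, ← ENNReal.rpow_mul]
  norm_num

/-- Plancherel's identity on the strip. -/
theorem enorm_sq_eq_lintegral_ft (f : Lp ℂ 2 (volume : Measure Strip)) :
    ‖f‖ₑ ^ 2 = ∫⁻ p, ‖ft f p‖ₑ ^ 2 ∂freqMeasure := by
  rw [enorm_sq_eq_lintegral, lintegral_enorm_sq_eq_tsum_xCoeff,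
    lintegral_freq ((measurable_ft f).enorm.pow_const 2)]
  refine tsum_congr fun k => ?_
  have h1 : ‖fourierStrip f k‖ₑ = ‖xCoeffLp f k‖ₑ := by
    rw [← ofReal_norm, ← ofReal_norm]
    congr 1
    exact Lp.norm_fourier_eq _
  have h2 := enorm_sq_eq_lintegral (fourierStrip f k)
  rw [h1, enorm_sq_eq_lintegral] at h2
  exact (lintegral_congr_ae ((coeFn_xCoeffLp f k).fun_comp fun w => ‖w‖ₑ ^ 2)).symm.trans h2

theorem fourierStrip_eq (f : Lp ℂ 2 (volume : Measure Strip)) (k : ℤ) :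
    fourierStrip f k = Lp.fourierTransformₗᵢ ℝ ℂ (xCoeffLp f k) := rfl

theorem ft_sub (f g : Lp ℂ 2 (volume : Measure Strip)) :
    ft (f - g) =ᵐ[freqMeasure] fun p => ft f p - ft g p := by
  refine ae_freq (measurableSet_eq_fun (measurable_ft _) ((measurable_ft f).sub (measurable_ft g)))
    fun k => ?_
  have h : fourierStrip (f - g) k = fourierStrip f k - fourierStrip g k := by
    simp only [fourierStrip_eq, xCoeffLp_sub, map_sub]
  filter_upwards [Lp.coeFn_sub (fourierStrip f k) (fourierStrip g k)] with ξ h1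
  simp only [ft, h, h1, Pi.sub_apply]

theorem ft_smul (c : ℝ) (f : Lp ℂ 2 (volume : Measure Strip)) :
    ft (c • f) =ᵐ[freqMeasure] fun p => c * ft f p := by
  refine ae_freq (measurableSet_eq_fun (measurable_ft _) ((measurable_ft f).const_mul _))
    fun k => ?_
  have h : fourierStrip (c • f) k = (c : ℂ) • fourierStrip f k := by
    simp only [fourierStrip_eq, xCoeffLp_smul, map_smul]
  filter_upwards [Lp.coeFn_smul (c : ℂ) (fourierStrip f k)] with ξ h1
  simp only [ft, h, h1, Pi.smul_apply, smul_eq_mul]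

/-- The angular frequency dual to the `i`-th coordinate. -/
def freq (i : Fin 2) (p : ℤ × ℝ) : ℝ := 2 * Real.pi * (if i = 0 then (p.1 : ℝ) else p.2)

theorem measurable_freq (i : Fin 2) : Measurable (freq i) := by
  unfold freq
  split
  · exact (measurable_from_top.comp measurable_fst).const_mul _
  · exact measurable_snd.const_mul _

theorem ft_shift (i : Fin 2) (s : ℝ) (f : Lp ℂ 2 (volume : Measure Strip)) :
    ft (shift (dir i s) f) =ᵐ[freqMeasure]
      fun p => Complex.exp (Complex.I * freq i p * s) * ft f p := by
  have hm : Measurable fun p => Complex.exp (Complex.I * freq i p * s) :=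
    (((measurable_freq i).complex_ofReal.const_mul _).mul_const _).cexp
  refine ae_freq (measurableSet_eq_fun (measurable_ft _) (hm.mul (measurable_ft f)))
    fun k => ?_
  have h : fourierStrip (shift (dir i s) f) k = (fourier k (dir i s).1 : ℂ) •
      (𝓕 (Lp.compMeasurePreservingₗᵢ ℂ (fun y : ℝ => y + (dir i s).2)
        (measurePreserving_add_right volume (dir i s).2) (xCoeffLp f k)) :
          Lp ℂ 2 (volume : Measure ℝ)) := by
    rw [fourierStrip_eq, xCoeffLp_shift, map_smul]; rfl
  filter_upwards [Lp.coeFn_smul (fourier k (dir i s).1 : ℂ)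
    (𝓕 (Lp.compMeasurePreservingₗᵢ ℂ (fun y : ℝ => y + (dir i s).2)
        (measurePreserving_add_right volume (dir i s).2) (xCoeffLp f k))),
    fourier_comp_add_right_Lp (dir i s).2 (xCoeffLp f k)] with ξ h1 h2
  change fourierStrip _ k ξ = _ * (𝓕 (xCoeffLp f k) : Lp ℂ 2 (volume : Measure ℝ)) ξ
  rw [h, h1, Pi.smul_apply, h2, smul_eq_mul, ← mul_assoc]
  congr 1
  unfold dir freq
  split
  · simp only [fourier_coe_apply]
    rw [← Complex.exp_add]; congr 1; push_cast; ring
  · simp only [fourier_eval_zero]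
    rw [one_mul]; congr 1; push_cast; ring

theorem ft_ae_eq_zero_iff (f : Lp ℂ 2 (volume : Measure Strip)) :
    ft f =ᵐ[freqMeasure] 0 ↔ f = 0 := by
  have h := enorm_sq_eq_lintegral_ft f
  constructor
  · intro hf
    have h1 := lintegral_congr_ae (hf.fun_comp fun w => ‖w‖ₑ ^ 2)
    rw [Function.comp_def, Function.comp_def] at h1
    rw [h1] at h
    simpa using h
  · rintro rfl
    simp only [enorm_zero, ne_eq, OfNat.ofNat_ne_zero, not_false_eq_true, zero_pow] at h
    have := (lintegral_eq_zero_iff ((measurable_ft 0).enorm.pow_const 2)).1 h.symm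
    filter_upwards [this] with p hp
    simpa using hp

theorem eq_of_ft_ae_eq {f g : Lp ℂ 2 (volume : Measure Strip)}
    (h : ft f =ᵐ[freqMeasure] ft g) : f = g := by
  rw [← sub_eq_zero, ← ft_ae_eq_zero_iff]
  filter_upwards [h, ft_sub f g] with p h1 h2
  simp [h2, h1]

end MHD

namespace MHD

/-! ### Strong derivatives from Fourier moments -/

theorem enorm_eq_eLpNorm_ft (f : Lp ℂ 2 (volume : Measure Strip)) :
    ‖f‖ₑ = eLpNorm (ft f) 2 freqMeasure := by
  have h := enorm_sq_eq_lintegral_ft f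
  rw [eLpNorm_eq_lintegral_rpow_enorm_toReal (by norm_num) (by norm_num)]
  have h2 : ∀ p, ‖ft f p‖ₑ ^ (2 : ℝ≥0∞).toReal = ‖ft f p‖ₑ ^ 2 := fun p => by
    rw [← ENNReal.rpow_natCast]; norm_num
  simp only [h2]
  rw [← h, ← ENNReal.rpow_natCast, ← ENNReal.rpow_mul]
  norm_num

/-- On the Fourier side the difference quotient multiplies by `(exp(iθs) - 1)/s`, which tends to
`iθ` and is bounded by `|θ|`. Dominated convergence gives convergence in frequency space. By
Plancherel the quotients are Cauchy, and completeness provides the derivative without inverting the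
transform. -/
theorem exists_hasPD_of_moment (i : Fin 2) (f : Lp ℂ 2 (volume : Measure Strip))
    (h : ∫⁻ p, ‖freq i p‖ₑ ^ 2 * ‖ft f p‖ₑ ^ 2 ∂freqMeasure ≠ ⊤) :
    ∃ w, HasPD i f w ∧ ft w =ᵐ[freqMeasure] fun p => Complex.I * freq i p * ft f p := by
  let m : ℝ → ℤ × ℝ → ℂ := fun s p =>
    (s⁻¹ : ℝ) * (Complex.exp (Complex.I * freq i p * s) - 1)
  have hfr : Measurable fun p => (freq i p : ℂ) := (measurable_freq i).complex_ofReal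
  have hm : ∀ s, Measurable (m s) := fun s =>
    ((((hfr.const_mul _).mul_const _).cexp).sub_const _).const_mul _
  have hθ : Measurable fun p => Complex.I * (freq i p : ℂ) := hfr.const_mul _
  have hft := measurable_ft f
  let δ : ℝ → Lp ℂ 2 (volume : Measure Strip) := fun s => s⁻¹ • (shift (dir i s) f - f)
  have hδ : ∀ s, ft (δ s) =ᵐ[freqMeasure] fun p => m s p * ft f p := by
    intro s
    filter_upwards [ft_smul s⁻¹ (shift (dir i s) f - f), ft_sub (shift (dir i s) f) f,
      ft_shift i s f] with p h1 h2 h3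
    rw [h1, h2, h3]; ring
  let N : ℝ → ℝ≥0∞ := fun s =>
    eLpNorm (fun p => m s p * ft f p - Complex.I * freq i p * ft f p) 2 freqMeasure
  have hmeasN : ∀ s, Measurable fun p => m s p * ft f p - Complex.I * freq i p * ft f p :=
    fun s => ((hm s).mul hft).sub (hθ.mul hft)
  have hmle : ∀ s p, ‖m s p‖ ≤ |freq i p| := by
    intro s p
    rcases eq_or_ne s 0 with rfl | hs
    · simp [m]
    have h1 := Real.norm_exp_I_mul_ofReal_sub_one_le (x := freq i p * s)
    have h2 : ‖m s p‖ = |s|⁻¹ * ‖Complex.exp (Complex.I * (freq i p * s : ℝ)) - 1‖ := by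
      simp only [m, norm_mul, Complex.norm_real, Real.norm_eq_abs, abs_inv]
      push_cast; rw [mul_assoc Complex.I]
    rw [h2]
    rw [Real.norm_eq_abs, abs_mul] at h1
    calc |s|⁻¹ * ‖Complex.exp (Complex.I * (freq i p * s : ℝ)) - 1‖
        ≤ |s|⁻¹ * (|freq i p| * |s|) := by gcongr
      _ = |freq i p| := by field_simp
  have hN : Tendsto N (𝓝[≠] 0) (𝓝 0) := by
    have h1 : Tendsto (fun s => ∫⁻ p, ‖m s p * ft f p - Complex.I * freq i p * ft f p‖ₑ ^ 2
        ∂freqMeasure) (𝓝[≠] 0) (𝓝 (∫⁻ p, 0 ∂freqMeasure)) := by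
      refine tendsto_lintegral_filter_of_dominated_convergence
        (fun p => 4 * (‖freq i p‖ₑ ^ 2 * ‖ft f p‖ₑ ^ 2))
        (Eventually.of_forall fun s => (hmeasN s).enorm.pow_const 2)
        (Eventually.of_forall fun s => Eventually.of_forall fun p => ?_) ?_
        (Eventually.of_forall fun p => ?_)
      · rw [← sub_mul, enorm_mul, mul_pow, ← mul_assoc]
        gcongr
        have h2 : ‖m s p - Complex.I * freq i p‖ₑ ≤ 2 * ‖freq i p‖ₑ := by
          refine enorm_sub_le.trans ?_
          rw [two_mul]
          gcongr
          · rw [enorm_le_iff_norm_le]; exact hmle s p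
          · rw [enorm_le_iff_norm_le]; simp
        calc _ ≤ (2 * ‖freq i p‖ₑ) ^ 2 := by gcongr
          _ = _ := by rw [mul_pow]; norm_num
      · rw [lintegral_const_mul' _ _ (by norm_num)]
        exact ENNReal.mul_ne_top (by norm_num) h
      · have h2 : HasDerivAt (fun s : ℝ => Complex.exp (Complex.I * freq i p * s))
            (Complex.I * freq i p) 0 := by
          have := ((hasDerivAt_id (0 : ℝ)).ofReal_comp.const_mul
            (Complex.I * freq i p)).cexp
          simpa using this
        have h3 := hasDerivAt_iff_tendsto_slope_zero.1 h2
        have h4 : Tendsto (fun s : ℝ => m s p * ft f p - Complex.I * freq i p * ft f p)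
            (𝓝[≠] 0) (𝓝 (Complex.I * freq i p * ft f p - Complex.I * freq i p * ft f p)) := by
          refine Tendsto.sub_const (Tendsto.mul_const _ ?_) _
          simpa [m] using h3
        rw [sub_self] at h4
        have h5 := ((continuous_enorm.tendsto (0 : ℂ)).comp h4)
        rw [enorm_zero] at h5
        have h6 := ((ENNReal.continuous_pow 2).tendsto 0).comp h5
        simpa [Function.comp_def] using h6
    have h2 := ((ENNReal.continuous_rpow_const (y := (1 / 2 : ℝ))).tendsto _).comp h1
    simp only [lintegral_zero] at h2
    rw [ENNReal.zero_rpow_of_pos (by norm_num)] at h2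
    refine h2.congr fun s => ?_
    simp only [N, Function.comp_apply]
    rw [eLpNorm_eq_lintegral_rpow_enorm_toReal (by norm_num) (by norm_num)]
    simp
  have hdist : ∀ s r, edist (δ s) (δ r) ≤ N s + N r := by
    intro s r
    rw [edist_eq_enorm_sub, enorm_eq_eLpNorm_ft]
    have h1 : ft (δ s - δ r) =ᵐ[freqMeasure]
        (fun p => m s p * ft f p - Complex.I * freq i p * ft f p) -
          (fun p => m r p * ft f p - Complex.I * freq i p * ft f p) := by
      filter_upwards [ft_sub (δ s) (δ r), hδ s, hδ r] with p h1 h2 h3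
      rw [h1, h2, h3, Pi.sub_apply]; ring
    rw [eLpNorm_congr_ae h1]
    exact eLpNorm_sub_le (hmeasN s).aestronglyMeasurable (hmeasN r).aestronglyMeasurable
      (by norm_num)
  have hc : Cauchy (map δ (𝓝[≠] 0)) := by
    rw [EMetric.cauchy_iff]
    refine ⟨(inferInstance : NeBot (map δ (𝓝[≠] 0))).ne, fun ε hε => ?_⟩
    have hε2 : 0 < ε / 2 := ENNReal.half_pos hε.ne'
    refine ⟨δ '' {s | N s < ε / 2}, image_mem_map (hN (gt_mem_nhds hε2)), ?_⟩
    rintro _ ⟨s, hs, rfl⟩ _ ⟨r, hr, rfl⟩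
    calc edist (δ s) (δ r) ≤ N s + N r := hdist s r
      _ < ε / 2 + ε / 2 := ENNReal.add_lt_add hs hr
      _ = ε := ENNReal.add_halves ε
  obtain ⟨w, hw⟩ := CompleteSpace.complete hc
  refine ⟨w, ?_, ?_⟩
  · rw [HasPD, hasDerivAt_iff_tendsto_slope_zero]
    simpa [δ] using (show Tendsto δ (𝓝[≠] 0) (𝓝 w) from hw)
  · have hw' : Tendsto δ (𝓝[≠] 0) (𝓝 w) := hw
    have hz : eLpNorm (fun p => ft w p - Complex.I * freq i p * ft f p) 2 freqMeasure = 0 := by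
      refine le_antisymm ?_ bot_le
      have hlim : Tendsto (fun s => edist w (δ s) + N s) (𝓝[≠] 0) (𝓝 (0 + 0)) := by
        refine Tendsto.add ?_ hN
        have := (tendsto_const_nhds (x := w)).edist hw'
        rwa [edist_self] at this
      rw [add_zero] at hlim
      refine ge_of_tendsto hlim (Eventually.of_forall fun s => ?_)
      rw [edist_eq_enorm_sub, enorm_eq_eLpNorm_ft]
      have h1 : (fun p => ft w p - Complex.I * freq i p * ft f p) =ᵐ[freqMeasure]
          ft (w - δ s) + (fun p => m s p * ft f p - Complex.I * freq i p * ft f p) := by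
        filter_upwards [ft_sub w (δ s), hδ s] with p h1 h2
        rw [Pi.add_apply, h1, h2]; ring
      rw [eLpNorm_congr_ae h1]
      exact eLpNorm_add_le (measurable_ft _).aestronglyMeasurable
        (hmeasN s).aestronglyMeasurable (by norm_num)
    have hmeas : Measurable fun p => ft w p - Complex.I * freq i p * ft f p :=
      (measurable_ft w).sub (hθ.mul hft)
    rw [eLpNorm_eq_zero_iff hmeas.aestronglyMeasurable two_ne_zero] at hz
    filter_upwards [hz] with p hp
    exact sub_eq_zero.1 hp

/-- Invariance under the vertical translation by one forces `exp(2πiξ) = 1` wherever the transform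
is nonzero, that is `ξ ∈ ℤ`, a null set. -/
theorem eq_zero_of_hasPD_zero {f : Lp ℂ 2 (volume : Measure Strip)} (h : HasPD 1 f 0) :
    f = 0 := by
  have h1 := h.shift_eq_of_zero 1
  rw [← ft_ae_eq_zero_iff]
  have h2 := ft_shift 1 1 f
  rw [h1] at h2
  have h3 : ∀ᵐ p : ℤ × ℝ ∂freqMeasure, p.2 ∉ Set.range ((↑) : ℤ → ℝ) := by
    refine ae_freq (measurable_snd (Set.countable_range _).measurableSet.compl) fun k => ?_
    exact (Set.countable_range _).ae_notMem volume
  filter_upwards [h2, h3] with p h2 h3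
  by_contra hne
  refine h3 ?_
  have h4 : Complex.exp (Complex.I * freq 1 p * (1 : ℝ)) = 1 := by
    have := mul_right_cancel₀ hne ((one_mul _).trans h2)
    exact this.symm
  obtain ⟨n, hn⟩ := Complex.exp_eq_one_iff.1 h4
  refine ⟨n, ?_⟩
  have h5 : (2 * Real.pi * Complex.I) * ((p.2 : ℂ) - n) = 0 := by
    simp only [freq, Fin.isValue, one_ne_zero, if_false] at hn
    push_cast at hn
    linear_combination hn
  have h6 : (p.2 : ℂ) - n = 0 := by
    rcases mul_eq_zero.1 h5 with h | h
    · exact absurd h Complex.two_pi_I_ne_zero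
    · exact h
  have := sub_eq_zero.1 h6
  exact_mod_cast this.symm

/-! ### Sobolev regularity -/

section Regularity

variable {E : Type*} [NormedAddCommGroup E] [NormedSpace ℝ E]

/-- `f` and its strong first derivatives are in `L²`. -/
def IsH1 (f : Lp E 2 (volume : Measure Strip)) : Prop := ∀ i, HasPD i f (pd i f)

/-- `f` and its strong derivatives of order at most two are in `L²`. -/
structure IsH2 (f : Lp E 2 (volume : Measure Strip)) : Prop where
  isH1 : IsH1 f
  isH1_pd : ∀ i, IsH1 (pd i f)
  pd_comm : ∀ i j, pd i (pd j f) = pd j (pd i f)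

variable {F : Type*} [NormedAddCommGroup F] [NormedSpace ℝ F]

theorem pd_map {A : Lp E 2 (volume : Measure Strip) →L[ℝ] Lp F 2 (volume : Measure Strip)}
    (hA : ∀ a g, A (shift a g) = shift a (A g)) {f : Lp E 2 (volume : Measure Strip)}
    (hf : IsH1 f) (i : Fin 2) : pd i (A f) = A (pd i f) :=
  ((hf i).map A hA).pd_eq

theorem IsH1.map {A : Lp E 2 (volume : Measure Strip) →L[ℝ] Lp F 2 (volume : Measure Strip)}
    (hA : ∀ a g, A (shift a g) = shift a (A g)) {f : Lp E 2 (volume : Measure Strip)}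
    (hf : IsH1 f) : IsH1 (A f) := fun i => by
  rw [pd_map hA hf]; exact (hf i).map A hA

theorem IsH2.map {A : Lp E 2 (volume : Measure Strip) →L[ℝ] Lp F 2 (volume : Measure Strip)}
    (hA : ∀ a g, A (shift a g) = shift a (A g)) {f : Lp E 2 (volume : Measure Strip)}
    (hf : IsH2 f) : IsH2 (A f) where
  isH1 := hf.isH1.map hA
  isH1_pd i := by rw [pd_map hA hf.isH1]; exact (hf.isH1_pd i).map hA
  pd_comm i j := by
    rw [pd_map hA hf.isH1, pd_map hA hf.isH1, pd_map hA (hf.isH1_pd j), pd_map hA (hf.isH1_pd i),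
      hf.pd_comm]

theorem compLpL_shift (L : E →L[ℝ] F) (a : Strip) (f : Lp E 2 (volume : Measure Strip)) :
    L.compLpL 2 volume (shift a f) = shift a (L.compLpL 2 volume f) := by
  apply Lp.ext
  filter_upwards [L.coeFn_compLpL (shift a f), coeFn_shift a f,
    coeFn_shift a (L.compLpL 2 volume f), ae_shift a (L.coeFn_compLpL f)] with z h1 h2 h3 h4
  rw [h1, h2, h3, h4]

end Regularity

/-- The Sobolev weight has base at least one, so its power `s ≥ 2` dominates the square. Multipliers
of order at most two are therefore controlled. -/
theorem lintegral_moment_le {s : ℝ} (hs : 2 ≤ s) (f : Lp ℂ 2 (volume : Measure Strip))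
    (c : ℤ × ℝ → ℝ) (hc : Measurable c)
    (hle : ∀ p, c p ^ 2 ≤ (1 + freq 0 p ^ 2 + freq 1 p ^ 2) ^ 2) :
    ∫⁻ p, ‖c p‖ₑ ^ 2 * ‖ft f p‖ₑ ^ 2 ∂freqMeasure ≤ sobolevNormSq s f := by
  have hmeas : Measurable fun p => ‖c p‖ₑ ^ 2 * ‖ft f p‖ₑ ^ 2 :=
    (hc.enorm.pow_const 2).mul ((measurable_ft f).enorm.pow_const 2)
  rw [lintegral_freq hmeas]
  refine ENNReal.tsum_le_tsum fun k => lintegral_mono fun ξ => ?_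
  dsimp only
  rw [show ft f (k, ξ) = fourierStrip f k ξ from rfl]
  gcongr
  rw [show ‖c (k, ξ)‖ₑ ^ 2 = ENNReal.ofReal (c (k, ξ) ^ 2) by
    rw [← sq_abs, ENNReal.ofReal_pow (abs_nonneg _), ← Real.norm_eq_abs, ofReal_norm]]
  refine ENNReal.ofReal_le_ofReal ((hle _).trans ?_)
  have h0 : freq 0 (k, ξ) = 2 * Real.pi * k := by simp [freq]
  have h1 : freq 1 (k, ξ) = 2 * Real.pi * ξ := by simp [freq]
  rw [h0, h1, ← Real.rpow_natCast]
  have hone : 1 ≤ 1 + (2 * Real.pi * k) ^ 2 + (2 * Real.pi * ξ) ^ 2 := by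
    nlinarith [sq_nonneg (2 * Real.pi * k), sq_nonneg (2 * Real.pi * ξ)]
  exact Real.rpow_le_rpow_of_exponent_le hone (by exact_mod_cast hs)

/-- The moment criterion is applied to `f` and again to its first derivatives. Mixed derivatives
commute because their symbols do and the transform is injective. -/
theorem isH2_of_sobolevNormSq {s : ℝ} (hs : 2 ≤ s) {f : Lp ℂ 2 (volume : Measure Strip)} {M : ℝ≥0}
    (h : sobolevNormSq s f ≤ M) :
    IsH2 f ∧ (∀ i, ‖pd i f‖ₑ ^ 2 ≤ M) ∧ ∀ i j, ‖pd i (pd j f)‖ₑ ^ 2 ≤ M := by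
  have hb1 : ∀ i, ∫⁻ p, ‖freq i p‖ₑ ^ 2 * ‖ft f p‖ₑ ^ 2 ∂freqMeasure ≤ M := fun i => by
    refine (lintegral_moment_le hs f _ (measurable_freq i) fun p => ?_).trans h
    have h01 : freq i p ^ 2 ≤ freq 0 p ^ 2 + freq 1 p ^ 2 := by
      fin_cases i <;> simp [sq_nonneg]
    nlinarith [sq_nonneg (freq 0 p), sq_nonneg (freq 1 p)]
  have hb2 : ∀ i j, ∫⁻ p, ‖freq i p * freq j p‖ₑ ^ 2 * ‖ft f p‖ₑ ^ 2 ∂freqMeasure ≤ M :=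
    by
    intro i j
    refine (lintegral_moment_le hs f _ ((measurable_freq i).mul (measurable_freq j))
      fun p => ?_).trans h
    have h01 : ∀ i, freq i p ^ 2 ≤ 1 + freq 0 p ^ 2 + freq 1 p ^ 2 := fun i => by
      fin_cases i <;> simp <;> nlinarith [sq_nonneg (freq 0 p), sq_nonneg (freq 1 p)]
    calc (freq i p * freq j p) ^ 2 = freq i p ^ 2 * freq j p ^ 2 := by ring
      _ ≤ (1 + freq 0 p ^ 2 + freq 1 p ^ 2) * (1 + freq 0 p ^ 2 + freq 1 p ^ 2) :=
          mul_le_mul (h01 i) (h01 j) (sq_nonneg _) (by positivity)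
      _ = _ := by ring
  choose D hD hDft using fun i => exists_hasPD_of_moment i f ((hb1 i).trans_lt (by simp)).ne
  have he : ∀ i p, ‖Complex.I * (freq i p : ℂ)‖ₑ = ‖freq i p‖ₑ := fun i p => by
    rw [← ofReal_norm, ← ofReal_norm]; simp
  have hsq : ∀ i j, ∫⁻ p, ‖freq i p‖ₑ ^ 2 * ‖ft (D j) p‖ₑ ^ 2 ∂freqMeasure =
      ∫⁻ p, ‖freq i p * freq j p‖ₑ ^ 2 * ‖ft f p‖ₑ ^ 2 ∂freqMeasure := fun i j => by
    refine lintegral_congr_ae ?_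
    filter_upwards [hDft j] with p hp
    rw [hp, enorm_mul, he, enorm_mul, mul_pow, mul_pow, mul_assoc]
  choose D2 hD2 hD2ft using fun i j => exists_hasPD_of_moment i (D j)
    ((hsq i j).trans_le (hb2 i j) |>.trans_lt (by simp)).ne
  have hpd : ∀ i, pd i f = D i := fun i => (hD i).pd_eq
  have hpd2 : ∀ i j, pd i (pd j f) = D2 i j := fun i j => by rw [hpd]; exact (hD2 i j).pd_eq
  refine ⟨⟨fun i => by rw [hpd]; exact hD i, fun i j => ?_, fun i j => ?_⟩, fun i => ?_,
    fun i j => ?_⟩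
  · rw [hpd2, hpd]; exact hD2 j i
  · rw [hpd2, hpd2]
    refine eq_of_ft_ae_eq ?_
    filter_upwards [hD2ft i j, hD2ft j i, hDft i, hDft j] with p h1 h2 h3 h4
    rw [h1, h2, h3, h4]; ring
  · rw [hpd, enorm_sq_eq_lintegral_ft]
    refine le_trans (le_of_eq ?_) (hb1 i)
    refine lintegral_congr_ae ?_
    filter_upwards [hDft i] with p hp
    rw [hp, enorm_mul, he, mul_pow]
  · rw [hpd2, enorm_sq_eq_lintegral_ft]
    refine le_trans (le_of_eq ?_) (hb2 i j)
    rw [← hsq]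
    refine lintegral_congr_ae ?_
    filter_upwards [hD2ft i j] with p hp
    rw [hp, enorm_mul, he, mul_pow]

/-! ### Real-valued functions, components of fields, and their regularity -/

/-- Real-valued square integrable functions on the strip. -/
abbrev L2Fun : Type := Lp ℝ 2 (volume : Measure Strip)

/-- The complexification of a real-valued function. -/
def complexify : L2Fun →L[ℝ] Lp ℂ 2 (volume : Measure Strip) :=
  Complex.ofRealCLM.compLpL 2 volume

theorem coeFn_complexify (f : L2Fun) : complexify f =ᵐ[volume] fun z => (f z : ℂ) :=
  Complex.ofRealCLM.coeFn_compLpL f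

theorem complexify_shift (a : Strip) (f : L2Fun) : complexify (shift a f) = shift a (complexify f) :=
  compLpL_shift _ a f

theorem norm_complexify (f : L2Fun) : ‖complexify f‖ = ‖f‖ := by
  rw [Lp.norm_def, Lp.norm_def]
  congr 1
  refine eLpNorm_congr_norm_ae ?_
  filter_upwards [coeFn_complexify f] with z hz
  rw [hz]; simp

/-- The real part of a complex-valued function. -/
def realPart : Lp ℂ 2 (volume : Measure Strip) →L[ℝ] L2Fun := Complex.reCLM.compLpL 2 volume

theorem realPart_shift (a : Strip) (f : Lp ℂ 2 (volume : Measure Strip)) :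
    realPart (shift a f) = shift a (realPart f) := compLpL_shift _ a f

@[simp] theorem realPart_complexify (f : L2Fun) : realPart (complexify f) = f := by
  apply Lp.ext
  filter_upwards [Complex.reCLM.coeFn_compLpL (complexify f), coeFn_complexify f] with z h1 h2
  rw [realPart, h1, h2]; simp

/-- The `i`-th component of a vector field. -/
def coord (i : Fin 2) : L2Field →L[ℝ] L2Fun :=
  (EuclideanSpace.proj i : Vec →L[ℝ] ℝ).compLpL 2 volume

theorem coeFn_coord (i : Fin 2) (v : L2Field) : coord i v =ᵐ[volume] fun z => v z i :=
  (EuclideanSpace.proj i : Vec →L[ℝ] ℝ).coeFn_compLpL v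

theorem coord_shift (i : Fin 2) (a : Strip) (v : L2Field) :
    coord i (shift a v) = shift a (coord i v) := compLpL_shift _ a v

theorem component_eq (i : Fin 2) (v : L2Field) : component i v = complexify (coord i v) := by
  apply Lp.ext
  filter_upwards [(Complex.ofRealCLM.comp (EuclideanSpace.proj i : Vec →L[ℝ] ℝ)).coeFn_compLp v,
    coeFn_complexify (coord i v), coeFn_coord i v] with z h1 h2 h3
  rw [h2, h3]; exact h1

theorem eq_zero_of_hasPD_one_zero {f : L2Fun} (h : HasPD 1 f 0) : f = 0 := by
  have h1 := h.map complexify complexify_shift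
  rw [map_zero] at h1
  rw [← realPart_complexify f, eq_zero_of_hasPD_zero h1, map_zero]

theorem norm_sq_le_of_enorm_sq_le {E : Type*} [NormedAddCommGroup E] {x : E} {M : ℝ≥0}
    (h : ‖x‖ₑ ^ 2 ≤ M) : ‖x‖ ^ 2 ≤ M := by
  rw [← ofReal_norm, ← ENNReal.ofReal_pow (norm_nonneg _), ENNReal.ofReal_le_coe] at h
  exact h

/-- The Fourier argument is run on the complexification. Taking real parts commutes with
translations and brings regularity back; complexification is isometric and brings back the bounds.
-/
theorem isH2_coord {s : ℝ} (hs : 2 ≤ s) {v : L2Field} {M : ℝ≥0}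
    (h : fieldSobolevNormSq s v ≤ M) (c : Fin 2) :
    IsH2 (coord c v) ∧ (∀ i, ‖pd i (coord c v)‖ ^ 2 ≤ M) ∧
      ∀ i j, ‖pd i (pd j (coord c v))‖ ^ 2 ≤ M := by
  have h1 : sobolevNormSq s (complexify (coord c v)) ≤ M := by
    rw [← component_eq]
    exact (Finset.single_le_sum (f := fun i => sobolevNormSq s (component i v))
      (fun _ _ => zero_le) (Finset.mem_univ c)).trans h
  obtain ⟨h2, h3, h4⟩ := isH2_of_sobolevNormSq hs h1
  have hreal : IsH2 (coord c v) := by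
    have := h2.map realPart_shift
    rwa [realPart_complexify] at this
  refine ⟨hreal, fun i => ?_, fun i j => ?_⟩
  · rw [← norm_complexify, ← pd_map complexify_shift hreal.isH1]
    exact norm_sq_le_of_enorm_sq_le (h3 i)
  · rw [← norm_complexify, ← pd_map complexify_shift (hreal.isH1_pd j),
      ← pd_map complexify_shift hreal.isH1]
    exact norm_sq_le_of_enorm_sq_le (h4 i j)

end MHD

namespace MHD

/-! ### Pointwise bounds by strong derivatives -/

theorem measurePreserving_shear (i : Fin 2) (s : ℝ) :
    MeasurePreserving (fun q : ℝ × Strip => (q.1, q.2 + dir i q.1))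
      ((volume.restrict (Set.Ioc 0 s)).prod volume)
      ((volume.restrict (Set.Ioc 0 s)).prod volume) := by
  refine MeasurePreserving.skew_product (g := fun r z => z + dir i r)
    (MeasurePreserving.id _) ?_ ?_
  · exact (continuous_snd.add ((continuous_dir i).comp continuous_fst)).measurable
  · exact Eventually.of_forall fun r => (measurePreserving_add_right volume (dir i r)).map_eq

/-- Paired with the indicator of a set of finite measure, the orbit of `f` is a scalar `C¹` function
with an ordinary fundamental theorem of calculus. Fubini, licensed by the shear, turns the resulting
equality of set integrals into one almost everywhere. -/
theorem HasPD.ae_shift_sub {i : Fin 2} {f w : L2Fun} (h : HasPD i f w) {s : ℝ} (hs : 0 ≤ s) :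
    ∀ᵐ z, f (z + dir i s) - f z = ∫ r in Set.Ioc 0 s, w (z + dir i r) := by
  have hmem : MemLp (fun q : ℝ × Strip => w (q.2 + dir i q.1)) 2
      ((volume.restrict (Set.Ioc 0 s)).prod volume) :=
    ((Lp.memLp w).comp_snd (volume.restrict (Set.Ioc 0 s))).comp_measurePreserving
      (measurePreserving_shear i s)
  have hint : ∀ A : Set Strip, volume A < ⊤ →
      Integrable (fun q : ℝ × Strip => w (q.2 + dir i q.1))
        ((volume.restrict (Set.Ioc 0 s)).prod (volume.restrict A)) := by
    intro A hA
    have : IsFiniteMeasure ((volume : Measure Strip).restrict A) := ⟨by simpa using hA⟩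
    refine MemLp.integrable (q := 2) (by norm_num) ?_
    refine hmem.mono_measure ?_
    rw [← Measure.restrict_univ (μ := (volume.restrict (Set.Ioc 0 s) : Measure ℝ)),
      Measure.prod_restrict, Measure.restrict_univ]
    exact Measure.restrict_le_self
  have hL : ∀ᵐ z, (MHD.shift (dir i s) f - f) z = f (z + dir i s) - f z := by
    filter_upwards [coeFn_shift (dir i s) f, Lp.coeFn_sub (MHD.shift (dir i s) f) f]
      with z h1 h2
    rw [h2, Pi.sub_apply, h1]
  have key : (MHD.shift (dir i s) f - f : L2Fun) =ᵐ[volume]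
      fun z => ∫ r in Set.Ioc 0 s, w (z + dir i r) := by
    refine ae_eq_of_forall_setIntegral_eq_of_sigmaFinite (fun A _ hA => ?_)
      (fun A _ hA => (hint A hA).integral_prod_right) (fun A hAm hA => ?_)
    · have : IsFiniteMeasure ((volume : Measure Strip).restrict A) := ⟨by simpa using hA⟩
      exact ((Lp.memLp _).restrict A).integrable (by norm_num)
    · rw [← integral_integral_swap (f := fun r z => w (z + dir i r)) (hint A hA)]
      let χ : L2Fun := indicatorConstLp 2 hAm hA.ne 1
      have hχ : ∀ g : L2Fun, inner ℝ χ g = ∫ z in A, g z := fun g =>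
        L2.inner_indicatorConstLp_one hAm hA.ne g
      have hd : ∀ r, HasDerivAt (fun r : ℝ => inner ℝ χ (MHD.shift (dir i r) f))
          (inner ℝ χ (MHD.shift (dir i r) w)) r := fun r => by
        simpa using (hasDerivAt_const r χ).inner ℝ (h.hasDerivAt r)
      have hftc := intervalIntegral.integral_eq_sub_of_hasDerivAt (a := 0) (b := s)
        (fun r _ => hd r)
        ((continuous_const.inner (continuous_shift_dir i w)).intervalIntegrable _ _)
      rw [← hχ, inner_sub_right]
      simp only [dir_zero, shift_zero] at hftc
      rw [← hftc, intervalIntegral.integral_of_le hs]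
      refine integral_congr_ae (Eventually.of_forall fun r => ?_)
      dsimp only
      rw [hχ]
      exact integral_congr_ae (ae_restrict_of_ae (coeFn_shift (dir i r) w))
  filter_upwards [hL, key] with z h1 h2
  rw [← h1, h2]

theorem HasPD.ae_enorm_shift_sub_le {i : Fin 2} {f w : L2Fun} (h : HasPD i f w) {s : ℝ}
    (hs : 0 ≤ s) (hs1 : s ≤ 1) :
    ∀ᵐ z, ‖f (z + dir i s) - f z‖ₑ ≤ ∫⁻ r in Set.Ioc (0 : ℝ) 1, ‖w (z + dir i r)‖ₑ := by
  filter_upwards [h.ae_shift_sub hs] with z hz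
  rw [hz]
  exact (enorm_integral_le_lintegral_enorm _).trans
    (lintegral_mono_set (Set.Ioc_subset_Ioc_right hs1))

theorem sq_lintegral_le {α : Type*} [MeasurableSpace α] {μ : Measure α} [IsProbabilityMeasure μ]
    {g : α → ℝ} (hg : Measurable g) : (∫⁻ x, ‖g x‖ₑ ∂μ) ^ 2 ≤ ∫⁻ x, ‖g x‖ₑ ^ 2 ∂μ := by
  have h := eLpNorm_le_eLpNorm_of_exponent_le (p := 1) (q := 2) (μ := μ) (by norm_num)
    hg.aestronglyMeasurable
  rw [eLpNorm_one_eq_lintegral_enorm,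
    eLpNorm_eq_lintegral_rpow_enorm_toReal (by norm_num) (by norm_num)] at h
  calc (∫⁻ x, ‖g x‖ₑ ∂μ) ^ 2
      ≤ ((∫⁻ x, ‖g x‖ₑ ^ (2 : ℝ≥0∞).toReal ∂μ) ^ (1 / (2 : ℝ≥0∞).toReal)) ^ 2 := by gcongr
    _ = ∫⁻ x, ‖g x‖ₑ ^ 2 ∂μ := by
      rw [← ENNReal.rpow_natCast, ← ENNReal.rpow_mul]; norm_num

theorem measurable_coeFn (f : L2Fun) : Measurable f := (Lp.stronglyMeasurable f).measurable

instance : IsProbabilityMeasure ((volume : Measure ℝ).restrict (Set.Ioc (0 : ℝ) 1)) :=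
  ⟨by simp⟩

theorem enorm_add_sq_le (a b : ℝ) : ‖a + b‖ₑ ^ 2 ≤ 2 * (‖a‖ₑ ^ 2 + ‖b‖ₑ ^ 2) := by
  have h : ∀ x : ℝ, ‖x‖ₑ ^ 2 = ENNReal.ofReal (x ^ 2) := fun x => by
    rw [← sq_abs, ENNReal.ofReal_pow (abs_nonneg _), ← Real.norm_eq_abs, ofReal_norm]
  rw [h, h, h, ← ENNReal.ofReal_add (sq_nonneg _) (sq_nonneg _),
    show (2 : ℝ≥0∞) = ENNReal.ofReal 2 by simp, ← ENNReal.ofReal_mul (by norm_num)]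
  exact ENNReal.ofReal_le_ofReal (by nlinarith [sq_nonneg (a - b)])

theorem ennreal_add_sq_le (a b : ℝ≥0∞) : (a + b) ^ 2 ≤ 2 * (a ^ 2 + b ^ 2) := by
  rcases eq_or_ne a ⊤ with rfl | ha
  · simp
  rcases eq_or_ne b ⊤ with rfl | hb
  · simp
  lift a to ℝ≥0 using ha
  lift b to ℝ≥0 using hb
  norm_cast
  rw [← NNReal.coe_le_coe]
  push_cast
  nlinarith [sq_nonneg ((a : ℝ) - b)]

/-- One-dimensional Sobolev embedding in the vertical variable. -/
theorem HasPD.ae_enorm_sq_le_vertical {f w : L2Fun} (h : HasPD 1 f w) :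
    ∀ᵐ z : Strip, ‖f z‖ₑ ^ 2 ≤ 2 * ∫⁻ y : ℝ, (‖f (z.1, y)‖ₑ ^ 2 + ‖w (z.1, y)‖ₑ ^ 2) := by
  have hf := measurable_coeFn f
  have hw := measurable_coeFn w
  have hd : Measurable fun q : ℝ × Strip => q.2 + dir 1 q.1 :=
    (continuous_snd.add ((continuous_dir 1).comp continuous_fst)).measurable
  let W : Strip → ℝ≥0∞ := fun z => ∫⁻ r in Set.Ioc (0 : ℝ) 1, ‖w (z + dir 1 r)‖ₑ
  have hW : Measurable W :=
    ((hw.comp hd).enorm).lintegral_prod_left' (μ := volume.restrict (Set.Ioc (0 : ℝ) 1))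
  -- The value at `z` is compared with its vertical translates of length `s ∈ (0, 1]`. Exchanging
  -- the null sets of `s` and `z` permits averaging over `s` at fixed `z`.
  have h1 : ∀ᵐ q : ℝ × Strip ∂((volume.restrict (Set.Ioc (0 : ℝ) 1)).prod volume),
      ‖f q.2‖ₑ ≤ ‖f (q.2 + dir 1 q.1)‖ₑ + W q.2 := by
    rw [Measure.ae_prod_iff_ae_ae]
    · refine (ae_restrict_iff' measurableSet_Ioc).2 (Eventually.of_forall fun s hs => ?_)
      filter_upwards [h.ae_enorm_shift_sub_le hs.1.le hs.2] with z hz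
      calc ‖f z‖ₑ = ‖f (z + dir 1 s) - (f (z + dir 1 s) - f z)‖ₑ := by rw [sub_sub_cancel]
        _ ≤ ‖f (z + dir 1 s)‖ₑ + ‖f (z + dir 1 s) - f z‖ₑ := enorm_sub_le
        _ ≤ _ := by gcongr
    · exact measurableSet_le (hf.comp measurable_snd).enorm
        ((hf.comp hd).enorm.add (hW.comp measurable_snd))
  have h2 := Measure.ae_ae_of_ae_prod ((Measure.measurePreserving_swap (μ := (volume : Measure Strip))
    (ν := volume.restrict (Set.Ioc (0 : ℝ) 1))).quasiMeasurePreserving.ae h1)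
  filter_upwards [h2] with z hz
  simp only [Prod.swap] at hz
  have hsl : ∀ (g : L2Fun), Measurable fun r : ℝ => g (z + dir 1 r) := fun g =>
    (measurable_coeFn g).comp (continuous_const.add (continuous_dir 1)).measurable
  have hle : ∀ (g : L2Fun), ∫⁻ r in Set.Ioc (0 : ℝ) 1, ‖g (z + dir 1 r)‖ₑ ^ 2 ≤
      ∫⁻ y : ℝ, ‖g (z.1, y)‖ₑ ^ 2 := fun g => by
    refine (setLIntegral_le_lintegral _ _).trans (le_of_eq ?_)
    rw [← lintegral_add_left_eq_self (fun y : ℝ => ‖g (z.1, y)‖ₑ ^ 2) z.2]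
    refine lintegral_congr fun r => ?_
    have : z + dir 1 r = (z.1, z.2 + r) := by
      rw [dir]; simp only [Fin.isValue, one_ne_zero, if_false]
      exact Prod.ext (add_zero _) rfl
    rw [this]
  calc ‖f z‖ₑ ^ 2 = ∫⁻ r in Set.Ioc (0 : ℝ) 1, ‖f z‖ₑ ^ 2 := by simp
    _ ≤ ∫⁻ r in Set.Ioc (0 : ℝ) 1, 2 * (‖f (z + dir 1 r)‖ₑ ^ 2 + W z ^ 2) := by
        refine lintegral_mono_ae ?_
        filter_upwards [hz] with r hr
        calc _ ≤ (‖f (z + dir 1 r)‖ₑ + W z) ^ 2 := by gcongr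
          _ ≤ _ := ennreal_add_sq_le _ _
    _ = 2 * ((∫⁻ r in Set.Ioc (0 : ℝ) 1, ‖f (z + dir 1 r)‖ₑ ^ 2) + W z ^ 2) := by
        rw [lintegral_const_mul' _ _ (by norm_num),
          lintegral_add_left ((hsl f).enorm.pow_const 2)]
        simp
    _ ≤ 2 * ((∫⁻ r in Set.Ioc (0 : ℝ) 1, ‖f (z + dir 1 r)‖ₑ ^ 2) +
          ∫⁻ r in Set.Ioc (0 : ℝ) 1, ‖w (z + dir 1 r)‖ₑ ^ 2) := by
        gcongr
        exact sq_lintegral_le (hsl w)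
    _ ≤ 2 * ((∫⁻ y : ℝ, ‖f (z.1, y)‖ₑ ^ 2) + ∫⁻ y : ℝ, ‖w (z.1, y)‖ₑ ^ 2) := by
        gcongr 2 * (?_ + ?_)
        · exact hle f
        · exact hle w
    _ = _ := by
        have hm : Measurable fun y : ℝ => ‖f (z.1, y)‖ₑ ^ 2 :=
          (hf.comp measurable_prodMk_left).enorm.pow_const 2
        rw [lintegral_add_left hm]

/-- The horizontal average, as a function of the vertical variable. -/
def xMean (f : L2Fun) (y : ℝ) : ℝ := ∫ x : UnitAddCircle, f (x, y)

/-- Horizontal oscillation is controlled by the horizontal derivative. -/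
theorem HasPD.ae_enorm_sq_le_horizontal {f w : L2Fun} (h : HasPD 0 f w) :
    ∀ᵐ z : Strip, ‖f z - xMean f z.2‖ₑ ^ 2 ≤ ∫⁻ x : UnitAddCircle, ‖w (x, z.2)‖ₑ ^ 2 := by
  have hf := measurable_coeFn f
  have hw := measurable_coeFn w
  let V : ℝ → ℝ≥0∞ := fun y => ∫⁻ x : UnitAddCircle, ‖w (x, y)‖ₑ
  have hV : Measurable V := hw.enorm.lintegral_prod_left' (μ := (volume : Measure UnitAddCircle))
  -- A unit interval of horizontal translations covers the circle once, so the integral does not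
  -- depend on the starting point.
  have hslice : ∀ z : Strip, ∫⁻ r in Set.Ioc (0 : ℝ) 1, ‖w (z + dir 0 r)‖ₑ = V z.2 := by
    intro z
    have h1 : ∀ r : ℝ, w (z + dir 0 r) = w (z.1 + (r : UnitAddCircle), z.2) := fun r => by
      rw [dir]; simp only [if_true]
      congr 1
      exact Prod.ext rfl (add_zero _)
    simp only [h1]
    have := UnitAddCircle.lintegral_preimage 0 fun x => ‖w (z.1 + x, z.2)‖ₑ
    rw [zero_add] at this
    rw [this, lintegral_add_left_eq_self (fun x => ‖w (x, z.2)‖ₑ)]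
  have hd : Measurable fun q : UnitAddCircle × Strip => q.2 + ((q.1, 0) : Strip) := by
    fun_prop
  have h1 : ∀ᵐ q : UnitAddCircle × Strip ∂(volume.prod volume),
      ‖f (q.2 + (q.1, 0)) - f q.2‖ₑ ≤ V q.2.2 := by
    rw [Measure.ae_prod_iff_ae_ae]
    · refine Eventually.of_forall fun a => ?_
      obtain ⟨s, hs, rfl⟩ : ∃ s ∈ Set.Ico (0 : ℝ) (0 + 1), (s : UnitAddCircle) = a :=
        ⟨AddCircle.equivIco 1 0 a, (AddCircle.equivIco 1 0 a).2, by simp⟩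
      rw [zero_add] at hs
      filter_upwards [h.ae_enorm_shift_sub_le hs.1 hs.2.le] with z hz
      rw [hslice] at hz
      simpa [dir] using hz
    · exact measurableSet_le ((hf.comp hd).sub (hf.comp measurable_snd)).enorm
        (hV.comp (measurable_snd.comp measurable_snd))
  have h2 := Measure.ae_ae_of_ae_prod ((Measure.measurePreserving_swap (μ := (volume : Measure Strip))
    (ν := (volume : Measure UnitAddCircle))).quasiMeasurePreserving.ae h1)
  have h3 : ∀ᵐ z : Strip, MemLp (fun x : UnitAddCircle => f (x, z.2)) 2 volume :=
    Measure.quasiMeasurePreserving_snd.ae (ae_memLp_slice f)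
  filter_upwards [h2, h3] with z hz hz3
  simp only [Prod.swap] at hz
  have hsl : Integrable fun a : UnitAddCircle => f (z.1 + a, z.2) := by
    have := hz3.integrable (by norm_num)
    exact this.comp_add_left z.1
  have h4 : f z - xMean f z.2 = ∫ a : UnitAddCircle, (f z - f (z.1 + a, z.2)) := by
    rw [integral_sub (integrable_const _) hsl,
      integral_add_left_eq_self (fun x => f (x, z.2)) z.1]
    simp [xMean]
  have h5 : ‖f z - xMean f z.2‖ₑ ≤ V z.2 := by
    rw [h4]
    refine (enorm_integral_le_lintegral_enorm _).trans ?_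
    calc ∫⁻ a : UnitAddCircle, ‖f z - f (z.1 + a, z.2)‖ₑ ≤ ∫⁻ a : UnitAddCircle, V z.2 := by
          refine lintegral_mono_ae ?_
          filter_upwards [hz] with a ha
          rw [enorm_sub_rev]
          have h6 : z + ((a, 0) : Strip) = (z.1 + a, z.2) := Prod.ext rfl (add_zero _)
          rwa [h6] at ha
      _ = V z.2 := by simp
  calc _ ≤ V z.2 ^ 2 := by gcongr
    _ ≤ _ := sq_lintegral_le (hw.comp measurable_prodMk_right)

end MHD

namespace MHD

/-! ### The horizontal averaging operator -/

theorem lintegral_strip_symm {g : Strip → ℝ≥0∞} (hg : Measurable g) :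
    ∫⁻ z, g z = ∫⁻ y : ℝ, ∫⁻ x : UnitAddCircle, g (x, y) :=
  lintegral_prod_symm' (μ := (volume : Measure UnitAddCircle)) (ν := (volume : Measure ℝ)) g hg

theorem enorm_xMean_sq_le (f : L2Fun) (y : ℝ) :
    ‖xMean f y‖ₑ ^ 2 ≤ ∫⁻ x : UnitAddCircle, ‖f (x, y)‖ₑ ^ 2 :=
  (pow_le_pow_left' (enorm_integral_le_lintegral_enorm _) 2).trans
    (sq_lintegral_le ((measurable_coeFn f).comp measurable_prodMk_right))

theorem measurable_xMean (f : L2Fun) : Measurable (xMean f) :=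
  ((Lp.stronglyMeasurable f).integral_prod_left' (μ := (volume : Measure UnitAddCircle))).measurable

theorem lintegral_enorm_xMean_sq_le (f : L2Fun) : ∫⁻ y, ‖xMean f y‖ₑ ^ 2 ≤ ‖f‖ₑ ^ 2 := by
  rw [enorm_sq_eq_lintegral, lintegral_strip_symm ((measurable_coeFn f).enorm.pow_const 2)]
  exact lintegral_mono fun y => enorm_xMean_sq_le f y

theorem memLp_two_of_lintegral {α : Type*} [MeasurableSpace α] {μ : Measure α} {g : α → ℝ}
    (hg : Measurable g) (h : ∫⁻ x, ‖g x‖ₑ ^ 2 ∂μ < ⊤) : MemLp g 2 μ := by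
  refine ⟨hg.aestronglyMeasurable, ?_⟩
  rw [eLpNorm_lt_top_iff_lintegral_rpow_enorm_lt_top (by norm_num) (by norm_num)]
  simpa using h

theorem memLp_xMean (f : L2Fun) : MemLp (xMean f) 2 volume :=
  memLp_two_of_lintegral (measurable_xMean f)
    ((lintegral_enorm_xMean_sq_le f).trans_lt (by simp))

theorem memLp_xMean_snd (f : L2Fun) : MemLp (fun z : Strip => xMean f z.2) 2 volume :=
  (memLp_xMean f).comp_snd (volume : Measure UnitAddCircle)

theorem ae_integrable_slice (f : L2Fun) :
    ∀ᵐ y : ℝ, Integrable fun x : UnitAddCircle => f (x, y) := by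
  filter_upwards [ae_memLp_slice f] with y hy using hy.integrable (by norm_num)

theorem ae_snd {p : ℝ → Prop} (h : ∀ᵐ y : ℝ, p y) : ∀ᵐ z : Strip, p z.2 :=
  Measure.quasiMeasurePreserving_snd.ae h

theorem xMean_add (f g : L2Fun) : ∀ᵐ y, xMean (f + g) y = xMean f y + xMean g y := by
  filter_upwards [ae_integrable_slice f, ae_integrable_slice g,
    ae_ae_of_ae_strip (Lp.coeFn_add f g)] with y h1 h2 h3
  rw [xMean, xMean, xMean, ← integral_add h1 h2]
  exact integral_congr_ae h3

theorem xMean_smul (c : ℝ) (f : L2Fun) : ∀ᵐ y, xMean (c • f) y = c * xMean f y := by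
  filter_upwards [ae_ae_of_ae_strip (Lp.coeFn_smul c f)] with y h3
  rw [xMean, xMean, ← integral_const_mul]
  exact integral_congr_ae h3

/-- The horizontal averaging operator on `L²(Ω)`. -/
def avg : L2Fun →L[ℝ] L2Fun :=
  LinearMap.mkContinuous
    { toFun := fun f => (memLp_xMean_snd f).toLp _
      map_add' := fun f g => by
        apply Lp.ext
        filter_upwards [(memLp_xMean_snd (f + g)).coeFn_toLp, (memLp_xMean_snd f).coeFn_toLp,
          (memLp_xMean_snd g).coeFn_toLp, ae_snd (xMean_add f g),
          Lp.coeFn_add ((memLp_xMean_snd f).toLp _) ((memLp_xMean_snd g).toLp _)]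
          with z h1 h2 h3 h4 h5
        rw [h1, h5, Pi.add_apply, h2, h3, h4]
      map_smul' := fun c f => by
        apply Lp.ext
        filter_upwards [(memLp_xMean_snd (c • f)).coeFn_toLp, (memLp_xMean_snd f).coeFn_toLp,
          ae_snd (xMean_smul c f), Lp.coeFn_smul c ((memLp_xMean_snd f).toLp _)]
          with z h1 h2 h4 h5
        rw [h1, RingHom.id_apply, h5, Pi.smul_apply, h2, h4, smul_eq_mul] } 1 fun f => by
    rw [one_mul, ← enorm_le_iff_norm_le, ← ENNReal.pow_le_pow_left_iff two_ne_zero,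
      enorm_sq_eq_lintegral]
    refine le_trans (le_of_eq ?_) (lintegral_enorm_xMean_sq_le f)
    have h1 : ∫⁻ z : Strip, ‖((memLp_xMean_snd f).toLp _ : L2Fun) z‖ₑ ^ 2 =
        ∫⁻ z : Strip, ‖xMean f z.2‖ₑ ^ 2 := by
      refine lintegral_congr_ae ?_
      filter_upwards [(memLp_xMean_snd f).coeFn_toLp] with z hz
      rw [hz]
    refine h1.trans ?_
    have hm : Measurable fun z : Strip => ‖xMean f z.2‖ₑ ^ 2 :=
      ((measurable_xMean f).comp measurable_snd).enorm.pow_const 2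
    rw [lintegral_strip_symm hm]
    simp

theorem coeFn_avg (f : L2Fun) : avg f =ᵐ[volume] fun z => xMean f z.2 :=
  (memLp_xMean_snd f).coeFn_toLp

theorem norm_avg_le (f : L2Fun) : ‖avg f‖ ≤ ‖f‖ := by
  have := avg.le_of_opNorm_le (LinearMap.mkContinuous_norm_le _ zero_le_one _) f
  rwa [one_mul] at this

theorem xMean_shift (a : Strip) (f : L2Fun) : ∀ᵐ y, xMean (shift a f) y = xMean f (y + a.2) := by
  filter_upwards [ae_ae_of_ae_strip (coeFn_shift a f)] with y h
  rw [xMean, xMean, ← integral_add_right_eq_self (fun x => f (x, y + a.2)) a.1]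
  exact integral_congr_ae h

theorem avg_shift (a : Strip) (f : L2Fun) : avg (shift a f) = shift a (avg f) := by
  apply Lp.ext
  filter_upwards [coeFn_avg (shift a f), coeFn_shift a (avg f), ae_shift a (coeFn_avg f),
    ae_snd (xMean_shift a f)] with z h1 h2 h3 h4
  rw [h1, h2, h3, h4]; rfl

theorem shift_zero_avg (s : ℝ) (f : L2Fun) : shift (dir 0 s) (avg f) = avg f := by
  apply Lp.ext
  filter_upwards [coeFn_avg f, coeFn_shift (dir 0 s) (avg f), ae_shift (dir 0 s) (coeFn_avg f)]
    with z h1 h2 h3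
  rw [h1, h2, h3]; simp [dir]

theorem hasPD_zero_avg (f : L2Fun) : HasPD 0 (avg f) 0 := by
  unfold HasPD
  simp only [shift_zero_avg]
  exact hasDerivAt_const _ _

theorem xMean_avg (f : L2Fun) : ∀ᵐ y, xMean (avg f) y = xMean f y := by
  filter_upwards [ae_ae_of_ae_strip (coeFn_avg f)] with y hy
  rw [xMean, integral_congr_ae hy]; simp

theorem avg_avg (f : L2Fun) : avg (avg f) = avg f := by
  apply Lp.ext
  filter_upwards [coeFn_avg f, coeFn_avg (avg f), ae_snd (xMean_avg f)] with z h1 h2 h3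
  rw [h1, h2, h3]

theorem inner_eq_integral (f g : L2Fun) : inner ℝ f g = ∫ z, f z * g z := by
  rw [L2.inner_def]
  refine integral_congr_ae (Eventually.of_forall fun z => ?_)
  simp [mul_comm]

theorem integral_strip_symm {g : Strip → ℝ} (hg : Integrable g) :
    ∫ z, g z = ∫ y : ℝ, ∫ x : UnitAddCircle, g (x, y) :=
  integral_prod_symm (μ := (volume : Measure UnitAddCircle)) (ν := (volume : Measure ℝ)) g hg

theorem inner_avg (f g : L2Fun) : inner ℝ (avg f) g = ∫ y, xMean f y * xMean g y := by
  have hi : Integrable fun z => avg f z * g z :=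
    (Lp.memLp (avg f)).integrable_mul (Lp.memLp g)
  rw [inner_eq_integral, integral_strip_symm hi]
  refine integral_congr_ae ?_
  filter_upwards [ae_ae_of_ae_strip (coeFn_avg f)] with y hy
  rw [show xMean f y * xMean g y = ∫ x : UnitAddCircle, xMean f y * g (x, y) by
    rw [integral_const_mul]; rfl]
  refine integral_congr_ae ?_
  filter_upwards [hy] with x hx
  rw [hx]

theorem inner_avg_left (f g : L2Fun) : inner ℝ (avg f) g = inner ℝ f (avg g) := by
  rw [real_inner_comm (avg g) f, inner_avg, inner_avg]
  simp only [mul_comm]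

theorem xMean_eq_zero {m : L2Fun} (h : avg m = 0) : ∀ᵐ y, xMean m y = 0 := by
  have h1 : ‖avg m‖ ^ 2 = ∫ y, xMean m y * xMean m y := by
    rw [← real_inner_self_eq_norm_sq, ← inner_avg, inner_avg_left, avg_avg, ← inner_avg_left]
  rw [h] at h1
  have h2 : (∫ y, xMean m y * xMean m y) = 0 := by simpa using h1.symm
  rw [integral_eq_zero_iff_of_nonneg (fun y => mul_self_nonneg _)
    ((memLp_xMean m).integrable_mul (memLp_xMean m))] at h2
  filter_upwards [h2] with y hy
  simpa using hy

/-- Poincaré's inequality in the horizontal variable. -/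
theorem HasPD.norm_sub_avg_le {f w : L2Fun} (h : HasPD 0 f w) : ‖f - avg f‖ ≤ ‖w‖ := by
  rw [← enorm_le_iff_norm_le, ← ENNReal.pow_le_pow_left_iff two_ne_zero, enorm_sq_eq_lintegral,
    enorm_sq_eq_lintegral, lintegral_strip_symm ((measurable_coeFn _).enorm.pow_const 2),
    lintegral_strip_symm ((measurable_coeFn _).enorm.pow_const 2)]
  refine lintegral_mono_ae ?_
  filter_upwards [ae_ae_of_ae_strip h.ae_enorm_sq_le_horizontal,
    ae_ae_of_ae_strip (Lp.coeFn_sub f (avg f)), ae_ae_of_ae_strip (coeFn_avg f)] with y h1 h2 h3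
  calc _ ≤ ∫⁻ _ : UnitAddCircle, ∫⁻ x : UnitAddCircle, ‖w (x, y)‖ₑ ^ 2 := by
        refine lintegral_mono_ae ?_
        filter_upwards [h1, h2, h3] with x h1 h2 h3
        rw [h2, Pi.sub_apply, h3]; exact h1
    _ = _ := by simp

/-! ### Products of functions with one derivative -/

/-- The majorant of the product is a tensor product, so its integral factorizes. One derivative on
each factor, in complementary directions, is then enough for an `L²` bound. -/
theorem lintegral_enorm_mul_sq_le {g h : L2Fun} {G : ℝ → ℝ≥0∞} {H : UnitAddCircle → ℝ≥0∞}
    (hG : Measurable G) (hH : Measurable H) (hg : ∀ᵐ z : Strip, ‖g z‖ₑ ^ 2 ≤ G z.2)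
    (hh : ∀ᵐ z : Strip, ‖h z‖ₑ ^ 2 ≤ H z.1) :
    ∫⁻ z, ‖g z * h z‖ₑ ^ 2 ≤ (∫⁻ y, G y) * ∫⁻ x, H x := by
  calc ∫⁻ z, ‖g z * h z‖ₑ ^ 2 ≤ ∫⁻ z : Strip, H z.1 * G z.2 := by
        refine lintegral_mono_ae ?_
        filter_upwards [hg, hh] with z h1 h2
        rw [enorm_mul, mul_pow, mul_comm]
        gcongr
    _ = (∫⁻ x, H x) * ∫⁻ y, G y := lintegral_prod_mul hH.aemeasurable hG.aemeasurable
    _ = _ := mul_comm _ _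

theorem measurable_lintegral_fst (f : L2Fun) :
    Measurable fun y : ℝ => ∫⁻ x : UnitAddCircle, ‖f (x, y)‖ₑ ^ 2 :=
  ((measurable_coeFn f).enorm.pow_const 2).lintegral_prod_left'
    (μ := (volume : Measure UnitAddCircle))

theorem lintegral_lintegral_fst (f : L2Fun) :
    ∫⁻ y : ℝ, ∫⁻ x : UnitAddCircle, ‖f (x, y)‖ₑ ^ 2 = ‖f‖ₑ ^ 2 := by
  rw [enorm_sq_eq_lintegral, lintegral_strip_symm ((measurable_coeFn _).enorm.pow_const 2)]

theorem HasPD.exists_vertical_bound {h w : L2Fun} (hh : HasPD 1 h w) :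
    ∃ H : UnitAddCircle → ℝ≥0∞, Measurable H ∧ (∀ᵐ z : Strip, ‖h z‖ₑ ^ 2 ≤ H z.1) ∧
      ∫⁻ x, H x = 2 * (‖h‖ₑ ^ 2 + ‖w‖ₑ ^ 2) := by
  have hm : Measurable fun z : Strip => ‖h z‖ₑ ^ 2 + ‖w z‖ₑ ^ 2 :=
    ((measurable_coeFn h).enorm.pow_const 2).add ((measurable_coeFn w).enorm.pow_const 2)
  refine ⟨_, (hm.lintegral_prod_right' (ν := (volume : Measure ℝ))).const_mul 2,
    hh.ae_enorm_sq_le_vertical, ?_⟩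
  rw [lintegral_const_mul' _ _ (by norm_num)]
  congr 1
  rw [← lintegral_prod _ hm.aemeasurable, lintegral_add_left
    ((measurable_coeFn h).enorm.pow_const 2), enorm_sq_eq_lintegral, enorm_sq_eq_lintegral]
  rfl

theorem ofReal_sq_enorm {E : Type*} [NormedAddCommGroup E] (x : E) :
    ‖x‖ₑ ^ 2 = ENNReal.ofReal (‖x‖ ^ 2) := by
  rw [ENNReal.ofReal_pow (norm_nonneg _), ofReal_norm]

theorem two_mul_ofReal (a : ℝ) : 2 * ENNReal.ofReal a = ENNReal.ofReal (2 * a) := by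
  rw [ENNReal.ofReal_mul zero_le_two, ENNReal.ofReal_ofNat]

/-- The majorant of `g` depending on `y` alone comes from splitting `g` into horizontal mean and
oscillation; the one of `h` depending on `x` alone comes from the vertical embedding. -/
theorem HasPD.lintegral_mul_sq_le {g g' h h' : L2Fun} (hg : HasPD 0 g g') (hh : HasPD 1 h h') :
    ∫⁻ z, ‖g z * h z‖ₑ ^ 2 ≤
      ENNReal.ofReal ((2 * (‖g‖ + ‖g'‖) * (‖h‖ + ‖h'‖)) ^ 2) := by
  obtain ⟨H, hHm, hH, hHi⟩ := hh.exists_vertical_bound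
  have hG : ∀ᵐ z : Strip, ‖g z‖ₑ ^ 2 ≤
      2 * ((∫⁻ x : UnitAddCircle, ‖g' (x, z.2)‖ₑ ^ 2) + ∫⁻ x : UnitAddCircle, ‖g (x, z.2)‖ₑ ^ 2) := by
    filter_upwards [hg.ae_enorm_sq_le_horizontal] with z hz
    calc ‖g z‖ₑ ^ 2 = ‖(g z - xMean g z.2) + xMean g z.2‖ₑ ^ 2 := by rw [sub_add_cancel]
      _ ≤ _ := enorm_add_sq_le _ _
      _ ≤ _ := by
        gcongr
        exact enorm_xMean_sq_le g z.2
  have hGm : Measurable fun y : ℝ => 2 * ((∫⁻ x : UnitAddCircle, ‖g' (x, y)‖ₑ ^ 2) +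
      ∫⁻ x : UnitAddCircle, ‖g (x, y)‖ₑ ^ 2) :=
    ((measurable_lintegral_fst g').add (measurable_lintegral_fst g)).const_mul 2
  refine (lintegral_enorm_mul_sq_le hGm hHm hG hH).trans ?_
  rw [hHi, lintegral_const_mul' _ _ (by norm_num), lintegral_add_left (measurable_lintegral_fst g'),
    lintegral_lintegral_fst, lintegral_lintegral_fst]
  simp only [ofReal_sq_enorm]
  rw [← ENNReal.ofReal_add (by positivity) (by positivity),
    ← ENNReal.ofReal_add (by positivity) (by positivity),
    two_mul_ofReal, two_mul_ofReal, ← ENNReal.ofReal_mul (by positivity)]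
  refine ENNReal.ofReal_le_ofReal ?_
  have h1 : ∀ a b : ℝ, 0 ≤ a → 0 ≤ b → a ^ 2 + b ^ 2 ≤ (a + b) ^ 2 := fun a b ha hb => by
    nlinarith [mul_nonneg ha hb]
  have h2 := h1 _ _ (norm_nonneg g') (norm_nonneg g)
  have h3 := h1 _ _ (norm_nonneg h) (norm_nonneg h')
  have h4 := mul_le_mul h2 h3 (by positivity) (by positivity)
  nlinarith

/-- With no mean to estimate, `g` enters through its horizontal derivative only, a quantity the
dissipation controls. -/
theorem HasPD.lintegral_mul_sq_le_of_avg {g g' h h' : L2Fun} (hg : HasPD 0 g g')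
    (hh : HasPD 1 h h') (h0 : avg g = 0) :
    ∫⁻ z, ‖g z * h z‖ₑ ^ 2 ≤ ENNReal.ofReal ((2 * ‖g'‖ * (‖h‖ + ‖h'‖)) ^ 2) := by
  obtain ⟨H, hHm, hH, hHi⟩ := hh.exists_vertical_bound
  have hG : ∀ᵐ z : Strip, ‖g z‖ₑ ^ 2 ≤ ∫⁻ x : UnitAddCircle, ‖g' (x, z.2)‖ₑ ^ 2 := by
    filter_upwards [hg.ae_enorm_sq_le_horizontal, ae_snd (xMean_eq_zero h0)] with z hz hz0
    rwa [hz0, sub_zero] at hz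
  refine (lintegral_enorm_mul_sq_le (measurable_lintegral_fst g') hHm hG hH).trans ?_
  rw [hHi, lintegral_lintegral_fst]
  simp only [ofReal_sq_enorm]
  rw [← ENNReal.ofReal_add (by positivity) (by positivity),
    two_mul_ofReal, ← ENNReal.ofReal_mul (by positivity)]
  refine ENNReal.ofReal_le_ofReal ?_
  have h3 : ‖h‖ ^ 2 + ‖h'‖ ^ 2 ≤ (‖h‖ + ‖h'‖) ^ 2 := by
    nlinarith [mul_nonneg (norm_nonneg h) (norm_nonneg h')]
  have h4 := mul_le_mul_of_nonneg_left h3 (sq_nonneg ‖g'‖)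
  nlinarith [sq_nonneg ‖g'‖, mul_nonneg (sq_nonneg ‖g'‖) (sq_nonneg (‖h‖ + ‖h'‖))]

open Classical in
/-- The pointwise product of two `L²` functions, if it is in `L²` (and zero otherwise). -/
def prodL2 (g h : L2Fun) : L2Fun :=
  if hm : MemLp (fun z => g z * h z) 2 volume then hm.toLp _ else 0

theorem HasPD.memLp_mul {g g' h h' : L2Fun} (hg : HasPD 0 g g') (hh : HasPD 1 h h') :
    MemLp (fun z => g z * h z) 2 volume :=
  memLp_two_of_lintegral ((measurable_coeFn g).mul (measurable_coeFn h))
    ((hg.lintegral_mul_sq_le hh).trans_lt ENNReal.ofReal_lt_top)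

theorem coeFn_prodL2 {g h : L2Fun} (hm : MemLp (fun z => g z * h z) 2 volume) :
    prodL2 g h =ᵐ[volume] fun z => g z * h z := by
  rw [prodL2, dif_pos hm]; exact hm.coeFn_toLp

theorem norm_prodL2_le {g h : L2Fun} (hm : MemLp (fun z => g z * h z) 2 volume) {C : ℝ}
    (hC : 0 ≤ C) (hle : ∫⁻ z, ‖g z * h z‖ₑ ^ 2 ≤ ENNReal.ofReal (C ^ 2)) : ‖prodL2 g h‖ ≤ C := by
  have h1 : ‖prodL2 g h‖ₑ ^ 2 = ∫⁻ z, ‖g z * h z‖ₑ ^ 2 :=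
    (enorm_sq_eq_lintegral _).trans
      (lintegral_congr_ae ((coeFn_prodL2 hm).fun_comp fun w => ‖w‖ₑ ^ 2))
  rw [← h1, ofReal_sq_enorm, ENNReal.ofReal_le_ofReal_iff (sq_nonneg _)] at hle
  exact (sq_le_sq₀ (norm_nonneg _) hC).1 hle

theorem HasPD.norm_prodL2_le {g g' h h' : L2Fun} (hg : HasPD 0 g g') (hh : HasPD 1 h h') :
    ‖prodL2 g h‖ ≤ 2 * (‖g‖ + ‖g'‖) * (‖h‖ + ‖h'‖) :=
  MHD.norm_prodL2_le (hg.memLp_mul hh) (by positivity) (hg.lintegral_mul_sq_le hh)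

theorem HasPD.norm_prodL2_le_of_avg {g g' h h' : L2Fun} (hg : HasPD 0 g g') (hh : HasPD 1 h h')
    (h0 : avg g = 0) : ‖prodL2 g h‖ ≤ 2 * ‖g'‖ * (‖h‖ + ‖h'‖) :=
  MHD.norm_prodL2_le (hg.memLp_mul hh) (by positivity) (hg.lintegral_mul_sq_le_of_avg hh h0)

end MHD

namespace MHD

/-! ### Trilinear integrals -/

theorem IsH1.sub {f g : L2Fun} (hf : IsH1 f) (hg : IsH1 g) : IsH1 (f - g) := fun i => by
  have := (hf i).sub (hg i)
  rw [this.pd_eq]; exact this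

theorem pd_sub {f g : L2Fun} (hf : IsH1 f) (hg : IsH1 g) (i : Fin 2) :
    pd i (f - g) = pd i f - pd i g := ((hf i).sub (hg i)).pd_eq

theorem pd_shift {f : L2Fun} (hf : IsH1 f) (a : Strip) (i : Fin 2) :
    pd i (shift a f) = shift a (pd i f) := ((hf i).shift a).pd_eq

theorem IsH1.shift {f : L2Fun} (hf : IsH1 f) (a : Strip) : IsH1 (shift a f) := fun i => by
  rw [pd_shift hf]; exact (hf i).shift a

theorem IsH1.avg {f : L2Fun} (hf : IsH1 f) : IsH1 (avg f) := hf.map avg_shift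

theorem pd_avg {f : L2Fun} (hf : IsH1 f) (i : Fin 2) : pd i (MHD.avg f) = MHD.avg (pd i f) :=
  pd_map avg_shift hf i

theorem pd_zero_avg (f : L2Fun) : pd 0 (avg f) = 0 := (hasPD_zero_avg f).pd_eq

theorem avg_pd_zero {f : L2Fun} (hf : IsH1 f) : avg (pd 0 f) = 0 := by
  rw [← pd_avg hf, pd_zero_avg]

theorem IsH1.memLp_mul {g h : L2Fun} (hg : IsH1 g) (hh : IsH1 h) :
    MemLp (fun z => g z * h z) 2 volume := (hg 0).memLp_mul (hh 1)

/-- The integral of a product of three functions. -/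
def tri (f g h : L2Fun) : ℝ := ∫ z, f z * g z * h z

theorem tri_comm_left (f g h : L2Fun) : tri f g h = tri g f h := by
  unfold tri; simp only [mul_comm (f _)]

theorem tri_comm_right (f g h : L2Fun) : tri f g h = tri f h g := by
  unfold tri; congr 1; ext z; ring

theorem inner_prodL2 {g h : L2Fun} (hm : MemLp (fun z => g z * h z) 2 volume) (f : L2Fun) :
    inner ℝ f (prodL2 g h) = tri f g h := by
  rw [inner_eq_integral, tri]
  refine integral_congr_ae ?_
  filter_upwards [coeFn_prodL2 hm] with z hz
  rw [hz]; ring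

theorem prodL2_sub_right {f g h : L2Fun} (hg : MemLp (fun z => f z * g z) 2 volume)
    (hh : MemLp (fun z => f z * h z) 2 volume) :
    prodL2 f (g - h) = prodL2 f g - prodL2 f h := by
  have hm : MemLp (fun z => f z * (g - h) z) 2 volume := by
    refine (hg.sub hh).ae_eq ?_
    filter_upwards [Lp.coeFn_sub g h] with z hz
    rw [hz, Pi.sub_apply, Pi.sub_apply, mul_sub]
  apply Lp.ext
  filter_upwards [coeFn_prodL2 hm, coeFn_prodL2 hg, coeFn_prodL2 hh,
    Lp.coeFn_sub (prodL2 f g) (prodL2 f h), Lp.coeFn_sub g h] with z h1 h2 h3 h4 h5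
  rw [h1, h4, Pi.sub_apply, h2, h3, h5, Pi.sub_apply, mul_sub]

theorem prodL2_shift {g h : L2Fun} (hg : IsH1 g) (hh : IsH1 h) (a : Strip) :
    prodL2 (shift a g) (shift a h) = shift a (prodL2 g h) := by
  apply Lp.ext
  filter_upwards [coeFn_prodL2 ((hg.shift a).memLp_mul (hh.shift a)), coeFn_shift a (prodL2 g h),
    ae_shift a (coeFn_prodL2 (hg.memLp_mul hh)), coeFn_shift a g, coeFn_shift a h]
    with z h1 h2 h3 h4 h5
  rw [h1, h2, h3, h4, h5]

theorem tri_shift (a : Strip) (f g h : L2Fun) :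
    tri (shift a f) (shift a g) (shift a h) = tri f g h := by
  rw [tri, tri, ← integral_add_right_eq_self (fun z => f z * g z * h z) a]
  refine integral_congr_ae ?_
  filter_upwards [coeFn_shift a f, coeFn_shift a g, coeFn_shift a h] with z h1 h2 h3
  rw [h1, h2, h3]

theorem IsH1.norm_prodL2_le {g h : L2Fun} (hg : IsH1 g) (hh : IsH1 h) :
    ‖prodL2 g h‖ ≤ 2 * (‖g‖ + ‖pd 0 g‖) * (‖h‖ + ‖pd 1 h‖) := (hg 0).norm_prodL2_le (hh 1)

/-- Integration by parts in a trilinear integral. -/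
theorem tri_pd {f g h : L2Fun} (hf : IsH1 f) (hg : IsH1 g) (hh : IsH1 h) (i : Fin 2) :
    tri (pd i f) g h + tri f (pd i g) h + tri f g (pd i h) = 0 := by
  let τ : ℝ → L2Fun → L2Fun := fun s k => shift (dir i s) k
  let δ : ℝ → L2Fun → L2Fun := fun s k => s⁻¹ • (τ s k - k)
  have hτ : ∀ k : L2Fun, Tendsto (fun s => τ s k) (𝓝[≠] 0) (𝓝 k) := fun k => by
    have := ((continuous_shift_dir i k).tendsto 0).mono_left
      (nhdsWithin_le_nhds (s := ({0}ᶜ : Set ℝ)))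
    simpa using this
  -- The exact discrete product rule: changing one factor at a time from translated to untranslated
  -- telescopes, and the two end values agree by translation invariance.
  have hsum : ∀ s, inner ℝ (δ s f) (τ s (prodL2 g h)) + inner ℝ (δ s g) (prodL2 f (τ s h)) +
      inner ℝ (δ s h) (prodL2 f g) = 0 := by
    intro s
    have hsh : τ s (prodL2 g h) = prodL2 (shift (dir i s) g) (shift (dir i s) h) :=
      (prodL2_shift hg hh _).symm
    rw [hsh]
    simp only [δ, real_inner_smul_left, inner_sub_left]
    rw [inner_prodL2 ((hg.shift _).memLp_mul (hh.shift _)),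
      inner_prodL2 ((hg.shift _).memLp_mul (hh.shift _)),
      inner_prodL2 (hf.memLp_mul (hh.shift _)), inner_prodL2 (hf.memLp_mul (hh.shift _)),
      inner_prodL2 (hf.memLp_mul hg), inner_prodL2 (hf.memLp_mul hg)]
    have e1 : tri (τ s f) (shift (dir i s) g) (shift (dir i s) h) = tri f g h := tri_shift _ _ _ _
    have e2 : tri (τ s g) f (τ s h) = tri f (shift (dir i s) g) (shift (dir i s) h) :=
      tri_comm_left _ _ _
    have e3 : tri (τ s h) f g = tri g f (τ s h) := by
      rw [tri_comm_left, tri_comm_right, tri_comm_left]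
    have e4 : tri h f g = tri f g h := by rw [tri_comm_left, tri_comm_right]
    rw [e1, e2, e3, e4]; ring
  have h1 : Tendsto (fun s => inner ℝ (δ s f) (τ s (prodL2 g h))) (𝓝[≠] 0)
      (𝓝 (inner ℝ (pd i f) (prodL2 g h))) := (hf i).tendsto.inner (hτ _)
  have h3 : Tendsto (fun s => inner ℝ (δ s h) (prodL2 f g)) (𝓝[≠] 0)
      (𝓝 (inner ℝ (pd i h) (prodL2 f g))) := (hh i).tendsto.inner tendsto_const_nhds
  -- The product bound for `f * (τ h - h)` involves `∂₂` of the difference, which also vanishes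
  -- since differentiation commutes with translation.
  have h2' : Tendsto (fun s => prodL2 f (τ s h)) (𝓝[≠] 0) (𝓝 (prodL2 f h)) := by
    rw [tendsto_iff_norm_sub_tendsto_zero]
    have hb : Tendsto (fun s => 2 * (‖f‖ + ‖pd 0 f‖) *
        (‖τ s h - h‖ + ‖τ s (pd 1 h) - pd 1 h‖)) (𝓝[≠] 0) (𝓝 0) := by
      have ha := tendsto_iff_norm_sub_tendsto_zero.1 (hτ h)
      have hb := tendsto_iff_norm_sub_tendsto_zero.1 (hτ (pd 1 h))
      simpa using (ha.add hb).const_mul (2 * (‖f‖ + ‖pd 0 f‖))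
    refine squeeze_zero (fun _ => norm_nonneg _) (fun s => ?_) hb
    have hs := hh.shift (dir i s)
    rw [← prodL2_sub_right (hf.memLp_mul hs) (hf.memLp_mul hh)]
    refine (hf.norm_prodL2_le (hs.sub hh)).trans (le_of_eq ?_)
    rw [pd_sub hs hh, pd_shift hh]
  have h2 : Tendsto (fun s => inner ℝ (δ s g) (prodL2 f (τ s h))) (𝓝[≠] 0)
      (𝓝 (inner ℝ (pd i g) (prodL2 f h))) := (hg i).tendsto.inner h2'
  have hlim := (h1.add h2).add h3
  simp only [hsum] at hlim
  have := tendsto_nhds_unique hlim tendsto_const_nhds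
  rw [inner_prodL2 (hg.memLp_mul hh), inner_prodL2 (hf.memLp_mul hh),
    inner_prodL2 (hf.memLp_mul hg)] at this
  have e2 : tri (pd i g) f h = tri f (pd i g) h := tri_comm_left _ _ _
  have e3 : tri (pd i h) f g = tri f g (pd i h) := by rw [tri_comm_left, tri_comm_right]
  rw [← e2, ← e3]; exact this

/-- Transport by a divergence-free field is skew-symmetric. -/
theorem tri_transport {f₀ f₁ g h : L2Fun} (hf₀ : IsH1 f₀) (hf₁ : IsH1 f₁) (hg : IsH1 g)
    (hh : IsH1 h) (hdiv : pd 0 f₀ + pd 1 f₁ = 0) :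
    tri f₀ (pd 0 g) h + tri f₁ (pd 1 g) h = -(tri f₀ (pd 0 h) g + tri f₁ (pd 1 h) g) := by
  have h0 := tri_pd hf₀ hg hh 0
  have h1 := tri_pd hf₁ hg hh 1
  have h2 : tri (pd 0 f₀) g h + tri (pd 1 f₁) g h = 0 := by
    rw [← inner_prodL2 (hg.memLp_mul hh), ← inner_prodL2 (hg.memLp_mul hh), ← inner_add_left, hdiv,
      inner_zero_left]
  rw [tri_comm_right f₀ (pd 0 h), tri_comm_right f₁ (pd 1 h)]
  linarith

/-- Both averages depend on `y` alone, so on each slice the `x`-integral sees only the mean of `m`.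
-/
theorem tri_avg_avg {m a c : L2Fun} (hm : avg m = 0) : tri m (avg a) (avg c) = 0 := by
  by_cases hi : Integrable fun z => m z * avg a z * avg c z
  · rw [tri, integral_strip_symm hi]
    rw [← integral_zero ℝ ℝ (μ := volume)]
    refine integral_congr_ae ?_
    filter_upwards [xMean_eq_zero hm, ae_ae_of_ae_strip (coeFn_avg a),
      ae_ae_of_ae_strip (coeFn_avg c)] with y h1 h2 h3
    have : ∫ x : UnitAddCircle, m (x, y) * avg a (x, y) * avg c (x, y) =
        ∫ x : UnitAddCircle, m (x, y) * (xMean a y * xMean c y) := by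
      refine integral_congr_ae ?_
      filter_upwards [h2, h3] with x h2 h3
      rw [h2, h3, mul_assoc]
    rw [this, integral_mul_const]
    change xMean m y * _ = 0
    rw [h1, zero_mul]
  -- Without integrability the integral has the default value zero, so no hypothesis on the product
  -- is needed.
  · exact integral_undef hi

theorem avg_sub_avg (f : L2Fun) : avg (f - avg f) = 0 := by
  rw [map_sub, avg_avg, sub_self]

/-- Cauchy–Schwarz against `c`, with the mean-free product estimate for the oscillation of `a` times
`m`. -/
theorem tri_sub_avg_le {a m c : L2Fun} (ha : IsH1 a) (hm : IsH1 m) :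
    |tri c (a - avg a) m| ≤ ‖c‖ * (2 * ‖pd 0 a‖ * (‖m‖ + ‖pd 1 m‖)) := by
  have ha' := ha.sub ha.avg
  have h0 : pd 0 (a - avg a) = pd 0 a := by rw [pd_sub ha ha.avg, pd_zero_avg, sub_zero]
  rw [← inner_prodL2 (ha'.memLp_mul hm)]
  refine (abs_real_inner_le_norm _ _).trans ?_
  gcongr
  rw [← h0]
  exact (ha' 0).norm_prodL2_le_of_avg (hm 1) (avg_sub_avg a)

theorem tri_sub_left {g h : L2Fun} (hm : MemLp (fun z => g z * h z) 2 volume) (f f' : L2Fun) :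
    tri (f - f') g h = tri f g h - tri f' g h := by
  rw [← inner_prodL2 hm, inner_sub_left, inner_prodL2 hm, inner_prodL2 hm]

/-- Anisotropic trilinear estimate: one factor has zero horizontal mean. -/
theorem abs_tri_avg_le {a m c : L2Fun} (ha : IsH1 a) (hm : IsH1 m) (hc : IsH1 c)
    (h0 : avg m = 0) :
    |tri (avg a) m c| ≤ 2 * (‖a‖ * ‖pd 0 c‖) * (‖m‖ + ‖pd 1 m‖) := by
  -- Since `m` has zero mean, the average of `c` contributes nothing; only its oscillation remains,
  -- and this costs `∂₁c`.
  have e : tri (avg a) m c = tri (avg a) (c - avg c) m := by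
    rw [tri_comm_left (avg a) (c - avg c), tri_sub_left (ha.avg.memLp_mul hm), tri_comm_right (avg c),
      tri_comm_left (avg c), tri_avg_avg h0, sub_zero, tri_comm_left c, tri_comm_right]
  rw [e]
  calc _ ≤ ‖avg a‖ * (2 * ‖pd 0 c‖ * (‖m‖ + ‖pd 1 m‖)) := tri_sub_avg_le hc hm
    _ ≤ ‖a‖ * (2 * ‖pd 0 c‖ * (‖m‖ + ‖pd 1 m‖)) := by gcongr; exact norm_avg_le a
    _ = _ := by ring

/-- Splitting `a` into oscillation and mean puts a horizontal derivative on `a` in the first part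
and on `c` in the second. Every term thus carries one `∂₁` outside the factor of `m`. -/
theorem abs_tri_le {a m c : L2Fun} (ha : IsH1 a) (hm : IsH1 m) (hc : IsH1 c) (h0 : avg m = 0) :
    |tri a m c| ≤ 2 * (‖pd 0 a‖ * ‖c‖ + ‖a‖ * ‖pd 0 c‖) * (‖m‖ + ‖pd 1 m‖) := by
  have e : tri a m c = tri c (a - avg a) m + tri (avg a) m c := by
    rw [tri_comm_left c, tri_sub_left (hc.memLp_mul hm), tri_comm_right a c,
      tri_comm_right (avg a) c]
    ring
  rw [e]
  have h1 := tri_sub_avg_le (c := c) ha hm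
  have h2 := abs_tri_avg_le ha hm hc h0
  have h3 := abs_add_le (tri c (a - avg a) m) (tri (avg a) m c)
  nlinarith

end MHD

namespace MHD

/-! ### Instantaneous energy estimates -/

/-- The mixed second-order terms in a bilinear integration by parts agree. -/
theorem inner_pd_pd_swap {v w : L2Fun} (hv : IsH1 v) (hw : IsH1 w) (i j : Fin 2) :
    inner ℝ (pd i v) (pd j w) = inner ℝ (pd j v) (pd i w) := by
  have h1 : HasDerivAt (fun s : ℝ => inner ℝ (shift (dir i s) v) (pd j w))
      (inner ℝ (pd i v) (pd j w)) 0 := by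
    have h : HasDerivAt (fun s : ℝ => shift (dir i s) v) (pd i v) 0 := hv i
    simpa using h.inner ℝ (hasDerivAt_const (0 : ℝ) (pd j w))
  have h2 : HasDerivAt (fun s : ℝ => inner ℝ (pd j v) (shift (dir i (-s)) w))
      (-inner ℝ (pd j v) (pd i w)) 0 := by
    have h : HasDerivAt (fun s : ℝ => shift (dir i s) w) (pd i w) (-0) := by
      rw [neg_zero]; exact hw i
    have h' := HasDerivAt.scomp (0 : ℝ) h (hasDerivAt_neg (0 : ℝ))
    simpa [Function.comp_def] using (hasDerivAt_const (0 : ℝ) (pd j v)).inner ℝ h'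
  -- The derivative `j` is integrated by parts and the translation along `i` is moved to `w`;
  -- differentiating at zero then exchanges the directions without second derivatives.
  have h3 : (fun s : ℝ => inner ℝ (shift (dir i s) v) (pd j w)) =
      fun s => -inner ℝ (pd j v) (shift (dir i (-s)) w) := by
    ext s
    have h4 := ((hv.shift (dir i s)) j).inner_left (hw j)
    rw [pd_shift hv, inner_shift_left, ← dir_neg] at h4
    linarith
  rw [h3] at h1
  have := h1.unique h2.neg
  linarith

/-- A divergence-free vector field with components in `H²`. -/
structure IsSolenoidalH2 (f : Fin 2 → L2Fun) : Prop where
  isH2 : ∀ i, IsH2 (f i)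
  div : pd 0 (f 0) + pd 1 (f 1) = 0

/-- Averaging the divergence in `x` removes `∂₁f₀`, so the mean of `f₁` is constant in `y`; being in
`L²` it vanishes. -/
theorem avg_eq_zero_of_div {f₀ f₁ : L2Fun} (h₀ : IsH1 f₀) (h₁ : IsH1 f₁)
    (hdiv : pd 0 f₀ + pd 1 f₁ = 0) : avg f₁ = 0 := by
  refine eq_zero_of_hasPD_one_zero ?_
  have h := h₁.avg 1
  have h2 : avg (pd 1 f₁) = 0 := by
    have := congrArg avg hdiv
    rwa [map_add, avg_pd_zero h₀, zero_add, map_zero] at this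
  rwa [pd_avg h₁, h2] at h

theorem IsSolenoidalH2.avg_one {f : Fin 2 → L2Fun} (hf : IsSolenoidalH2 f) : avg (f 1) = 0 :=
  avg_eq_zero_of_div (hf.isH2 0).isH1 (hf.isH2 1).isH1 hf.div

/-- The advection term `f · ∇φ`. -/
def advect (f : Fin 2 → L2Fun) (φ : L2Fun) : L2Fun :=
  prodL2 (f 0) (pd 0 φ) + prodL2 (f 1) (pd 1 φ)

theorem inner_advect {f : Fin 2 → L2Fun} {φ : L2Fun} (hf : IsSolenoidalH2 f) (hφ : IsH2 φ)
    (ψ : L2Fun) : inner ℝ (advect f φ) ψ = tri (f 0) (pd 0 φ) ψ + tri (f 1) (pd 1 φ) ψ := by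
  rw [advect, inner_add_left, real_inner_comm, real_inner_comm ψ,
    inner_prodL2 ((hf.isH2 0).isH1.memLp_mul (hφ.isH1_pd 0)),
    inner_prodL2 ((hf.isH2 1).isH1.memLp_mul (hφ.isH1_pd 1)), tri_comm_left ψ, tri_comm_left ψ,
    tri_comm_right (f 0), tri_comm_right (f 1)]

theorem inner_advect_skew {f : Fin 2 → L2Fun} {φ ψ : L2Fun} (hf : IsSolenoidalH2 f)
    (hφ : IsH2 φ) (hψ : IsH2 ψ) :
    inner ℝ (advect f φ) ψ = -inner ℝ (advect f ψ) φ := by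
  rw [inner_advect hf hφ, inner_advect hf hψ]
  exact tri_transport (hf.isH2 0).isH1 (hf.isH2 1).isH1 hφ.isH1 hψ.isH1 hf.div

theorem inner_advect_self {f : Fin 2 → L2Fun} {φ : L2Fun} (hf : IsSolenoidalH2 f)
    (hφ : IsH2 φ) : inner ℝ (advect f φ) φ = 0 := by
  linarith [inner_advect_skew hf hφ hφ]

/-- The commutator of advection with the vertical derivative, tested with `∂₂ψ`. -/
def advectComm (f : Fin 2 → L2Fun) (φ ψ : L2Fun) : ℝ :=
  tri (pd 1 (f 0)) (pd 0 φ) (pd 1 ψ) + tri (pd 1 (f 1)) (pd 1 φ) (pd 1 ψ)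

/-- The transport of `∂₂φ`, tested with `∂₂ψ`. -/
def advectMain (f : Fin 2 → L2Fun) (φ ψ : L2Fun) : ℝ :=
  tri (f 0) (pd 0 (pd 1 φ)) (pd 1 ψ) + tri (f 1) (pd 1 (pd 1 φ)) (pd 1 ψ)

/-- One of the two vertical derivatives on `ψ` is integrated by parts. It falls either on the
advecting field, giving the commutator, or on `∇φ`, giving the transport of `∂₂φ`. -/
theorem inner_advect_pd_pd {f : Fin 2 → L2Fun} {φ ψ : L2Fun} (hf : IsSolenoidalH2 f)
    (hφ : IsH2 φ) (hψ : IsH2 ψ) :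
    inner ℝ (advect f φ) (pd 1 (pd 1 ψ)) = -advectComm f φ ψ - advectMain f φ ψ := by
  have h0 := tri_pd (hf.isH2 0).isH1 (hφ.isH1_pd 0) (hψ.isH1_pd 1) 1
  have h1 := tri_pd (hf.isH2 1).isH1 (hφ.isH1_pd 1) (hψ.isH1_pd 1) 1
  rw [hφ.pd_comm 1 0] at h0
  rw [inner_advect hf hφ, advectComm, advectMain]
  linarith

/-- Skewness of transport at the level of `∂₂φ` and `∂₂ψ`, which removes all terms of highest order
from the energy estimate. -/
theorem advectMain_skew {f : Fin 2 → L2Fun} {φ ψ : L2Fun} (hf : IsSolenoidalH2 f)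
    (hφ : IsH2 φ) (hψ : IsH2 ψ) : advectMain f φ ψ = -advectMain f ψ φ :=
  tri_transport (hf.isH2 0).isH1 (hf.isH2 1).isH1 (hφ.isH1_pd 1) (hψ.isH1_pd 1) hf.div

theorem norm_pd_one_eq {f : Fin 2 → L2Fun} (hf : IsSolenoidalH2 f) :
    ‖pd 1 (f 1)‖ = ‖pd 0 (f 0)‖ := by
  rw [eq_neg_of_add_eq_zero_right hf.div, norm_neg]

theorem norm_pd_one_pd_one_eq {f : Fin 2 → L2Fun} (hf : IsSolenoidalH2 f) :
    ‖pd 1 (pd 1 (f 1))‖ = ‖pd 0 (pd 1 (f 0))‖ := by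
  have h1 : pd 1 (f 1) = (-(1 : L2Fun →L[ℝ] L2Fun)) (pd 0 (f 0)) := by
    rw [eq_neg_of_add_eq_zero_right hf.div]; simp
  rw [h1, pd_map (by simp) ((hf.isH2 0).isH1_pd 0), (hf.isH2 0).pd_comm 1 0]
  simp

/-- The mean-free factor is `∂₁φ` in the first product and `∂₂f₁ = -∂₁f₀` in the second. In both
cases `abs_tri_le` leaves one vertical derivative, bounded by `e`, and two dissipated quantities,
bounded by `d`; each product contributes `8 e d²`. -/
theorem abs_advectComm_le {f : Fin 2 → L2Fun} {φ ψ : L2Fun} (hf : IsSolenoidalH2 f)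
    (hφ : IsH2 φ) (hψ : IsH2 ψ) {e d : ℝ}
    (hfe : ∀ i, ‖pd 1 (f i)‖ ≤ e) (hφe : ‖pd 1 φ‖ ≤ e) (hψe : ‖pd 1 ψ‖ ≤ e)
    (hfd : ∀ i, ‖pd 0 (f i)‖ ≤ d) (hφd : ‖pd 0 φ‖ ≤ d)
    (hfd2 : ∀ i, ‖pd 0 (pd 1 (f i))‖ ≤ d) (hφd2 : ‖pd 0 (pd 1 φ)‖ ≤ d)
    (hψd2 : ‖pd 0 (pd 1 ψ)‖ ≤ d) : |advectComm f φ ψ| ≤ 16 * e * d ^ 2 := by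
  have he : 0 ≤ e := (norm_nonneg _).trans hφe
  have hd : 0 ≤ d := (norm_nonneg _).trans hφd
  have h1 : |tri (pd 1 (f 0)) (pd 0 φ) (pd 1 ψ)| ≤ 2 * (d * e + e * d) * (d + d) := by
    refine (abs_tri_le ((hf.isH2 0).isH1_pd 1) (hφ.isH1_pd 0) (hψ.isH1_pd 1)
      (avg_pd_zero hφ.isH1)).trans ?_
    rw [hφ.pd_comm 1 0]
    gcongr
    · exact hfd2 0
    · exact hfe 0
  have h2 : |tri (pd 1 (f 1)) (pd 1 φ) (pd 1 ψ)| ≤ 2 * (d * e + e * d) * (d + d) := by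
    have h0 : avg (pd 1 (f 1)) = 0 := by
      rw [← pd_avg (hf.isH2 1).isH1, hf.avg_one]
      have : HasPD 1 (0 : L2Fun) 0 := by
        unfold HasPD; simp only [map_zero]; exact hasDerivAt_const _ _
      exact this.pd_eq
    rw [tri_comm_left]
    refine (abs_tri_le (hφ.isH1_pd 1) ((hf.isH2 1).isH1_pd 1) (hψ.isH1_pd 1) h0).trans ?_
    rw [norm_pd_one_eq hf, norm_pd_one_pd_one_eq hf]
    gcongr
    · exact hfd 0
    · exact hfd2 0
  calc |advectComm f φ ψ| ≤ _ := abs_add_le _ _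
    _ ≤ 2 * (d * e + e * d) * (d + d) + 2 * (d * e + e * d) * (d + d) := add_le_add h1 h2
    _ = _ := by ring

/-- Skewness moves the gradient to the average of `ψ`, which has no horizontal derivative. What
survives contains `f 1`, of zero mean: Poincaré bounds it by `∂₁(f 1)`, and its vertical derivative
equals `-∂₁(f 0)`. -/
theorem abs_inner_advect_avg_le {f : Fin 2 → L2Fun} {φ ψ : L2Fun} (hf : IsSolenoidalH2 f)
    (hφ : IsH2 φ) (hψ : IsH2 ψ) {e d : ℝ} (hψe : ‖pd 1 ψ‖ ≤ e)
    (hfd : ∀ i, ‖pd 0 (f i)‖ ≤ d) (hφd : ‖pd 0 φ‖ ≤ d) :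
    |inner ℝ (advect f φ) (avg ψ)| ≤ 4 * e * d ^ 2 := by
  have he : 0 ≤ e := (norm_nonneg _).trans hψe
  have hd : 0 ≤ d := (norm_nonneg _).trans hφd
  have hψa : IsH2 (avg ψ) := hψ.map avg_shift
  have h0 : tri (f 0) 0 φ = 0 := by
    rw [tri_comm_left, ← inner_prodL2 ((hf.isH2 0).isH1.memLp_mul hφ.isH1), inner_zero_left]
  rw [inner_advect_skew hf hφ hψa, inner_advect hf hψa, pd_zero_avg, h0, zero_add, abs_neg,
    pd_avg hψ.isH1, tri_comm_left]
  refine (abs_tri_avg_le (hψ.isH1_pd 1) (hf.isH2 1).isH1 hφ.isH1 hf.avg_one).trans ?_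
  have h1 : ‖f 1‖ ≤ d := by
    have := ((hf.isH2 1).isH1 0).norm_sub_avg_le
    rw [hf.avg_one, sub_zero] at this
    exact this.trans (hfd 1)
  rw [norm_pd_one_eq hf]
  calc _ ≤ 2 * (e * d) * (d + d) := by
        gcongr
        exact hfd 0
    _ = _ := by ring

/-- The right-hand side `b · ∇w - u · ∇v + κ ∂₁² v` of the evolution equation of `v`, without
pressure. -/
def rhs (κ : ℝ) (u v b w : Fin 2 → L2Fun) (i : Fin 2) : L2Fun :=
  advect b (w i) - advect u (v i) + κ • pd 0 (pd 0 (v i))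

variable {u b : Fin 2 → L2Fun}

theorem inner_pd_zero_pd_zero {v : L2Fun} (hv : IsH2 v) {w : L2Fun} (hw : IsH1 w) :
    inner ℝ (pd 0 (pd 0 v)) w = -inner ℝ (pd 0 v) (pd 0 w) :=
  (hv.isH1_pd 0 0).inner_left (hw 0)

/-- Self-transport by `u` vanishes, and the exchange terms `b · ∇b` against `u` and `b · ∇u` against
`b` cancel by skewness; only diffusion remains. -/
theorem inner_rhs_add (hu : IsSolenoidalH2 u) (hb : IsSolenoidalH2 b) (ν η : ℝ) (i : Fin 2) :
    inner ℝ (rhs ν u u b b i) (u i) + inner ℝ (rhs η u b b u i) (b i) =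
      -(ν * ‖pd 0 (u i)‖ ^ 2 + η * ‖pd 0 (b i)‖ ^ 2) := by
  simp only [rhs, inner_add_left, inner_sub_left, real_inner_smul_left]
  rw [inner_pd_zero_pd_zero (hu.isH2 i) (hu.isH2 i).isH1,
    inner_pd_zero_pd_zero (hb.isH2 i) (hb.isH2 i).isH1,
    inner_advect_self hu (hu.isH2 i), inner_advect_self hu (hb.isH2 i),
    inner_advect_skew hb (hb.isH2 i) (hu.isH2 i), real_inner_self_eq_norm_sq,
    real_inner_self_eq_norm_sq]
  ring

/-- The main transport parts cancel as in the basic energy identity. Four commutators remain, each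
at most `16 e d²`. -/
theorem inner_rhs_pd_pd_le (hu : IsSolenoidalH2 u) (hb : IsSolenoidalH2 b) (ν η : ℝ) {e d : ℝ}
    (hue : ∀ i, ‖pd 1 (u i)‖ ≤ e) (hbe : ∀ i, ‖pd 1 (b i)‖ ≤ e)
    (hud : ∀ i, ‖pd 0 (u i)‖ ≤ d) (hbd : ∀ i, ‖pd 0 (b i)‖ ≤ d)
    (hud2 : ∀ i, ‖pd 0 (pd 1 (u i))‖ ≤ d) (hbd2 : ∀ i, ‖pd 0 (pd 1 (b i))‖ ≤ d) (i : Fin 2) :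
    -(inner ℝ (rhs ν u u b b i) (pd 1 (pd 1 (u i))) +
        inner ℝ (rhs η u b b u i) (pd 1 (pd 1 (b i)))) ≤
      -(ν * ‖pd 0 (pd 1 (u i))‖ ^ 2 + η * ‖pd 0 (pd 1 (b i))‖ ^ 2) + 64 * e * d ^ 2 := by
  -- Exchanging the outer derivatives makes the diffusion a square while staying at second order.
  have hdiss : ∀ {v : L2Fun}, IsH2 v →
      inner ℝ (pd 0 (pd 0 v)) (pd 1 (pd 1 v)) = ‖pd 0 (pd 1 v)‖ ^ 2 := fun {v} hv => by
    rw [inner_pd_pd_swap (hv.isH1_pd 0) (hv.isH1_pd 1), hv.pd_comm 1 0,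
      real_inner_self_eq_norm_sq]
  have hui := hu.isH2 i
  have hbi := hb.isH2 i
  simp only [rhs, inner_add_left, inner_sub_left, real_inner_smul_left]
  rw [hdiss hui, hdiss hbi, inner_advect_pd_pd hb hbi hui, inner_advect_pd_pd hu hui hui,
    inner_advect_pd_pd hb hui hbi, inner_advect_pd_pd hu hbi hbi]
  have h1 := advectMain_skew hu hui hui
  have h2 := advectMain_skew hu hbi hbi
  have h3 := advectMain_skew hb hui hbi
  have n1 := abs_le.1 (abs_advectComm_le hu hui hui hue (hue i) (hue i) hud (hud i) hud2 (hud2 i)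
    (hud2 i))
  have n2 := abs_le.1 (abs_advectComm_le hu hbi hbi hue (hbe i) (hbe i) hud (hbd i) hud2 (hbd2 i)
    (hbd2 i))
  have n3 := abs_le.1 (abs_advectComm_le hb hui hbi hbe (hue i) (hbe i) hbd (hud i) hbd2 (hud2 i)
    (hbd2 i))
  have n4 := abs_le.1 (abs_advectComm_le hb hbi hui hbe (hbe i) (hue i) hbd (hbd i) hbd2 (hbd2 i)
    (hud2 i))
  linarith [n1.1, n1.2, n2.1, n2.2, n3.1, n3.2, n4.1, n4.2]

/-- This is the energy identity minus the same test with averages. Diffusion is orthogonal to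
averages, and the four advection terms cost `4 e d²` each. Here `d` bounds only first horizontal
derivatives. -/
theorem inner_rhs_sub_avg_le (hu : IsSolenoidalH2 u) (hb : IsSolenoidalH2 b) (ν η : ℝ) {e d : ℝ}
    (hue : ∀ i, ‖pd 1 (u i)‖ ≤ e) (hbe : ∀ i, ‖pd 1 (b i)‖ ≤ e)
    (hud : ∀ i, ‖pd 0 (u i)‖ ≤ d) (hbd : ∀ i, ‖pd 0 (b i)‖ ≤ d) (i : Fin 2) :
    inner ℝ (rhs ν u u b b i) (u i - avg (u i)) + inner ℝ (rhs η u b b u i) (b i - avg (b i)) ≤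
      -(ν * ‖pd 0 (u i)‖ ^ 2 + η * ‖pd 0 (b i)‖ ^ 2) + 16 * e * d ^ 2 := by
  have hui := hu.isH2 i
  have hbi := hb.isH2 i
  rw [inner_sub_right, inner_sub_right]
  have h0 := inner_rhs_add hu hb ν η i
  have hz : ∀ {v : L2Fun}, IsH2 v → inner ℝ (pd 0 (pd 0 v)) (avg v) = 0 := fun {v} hv => by
    rw [inner_pd_zero_pd_zero hv hv.isH1.avg, pd_zero_avg, inner_zero_right, neg_zero]
  have hru : inner ℝ (rhs ν u u b b i) (avg (u i)) =
      inner ℝ (advect b (b i)) (avg (u i)) - inner ℝ (advect u (u i)) (avg (u i)) := by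
    simp only [rhs, inner_add_left, inner_sub_left, real_inner_smul_left, hz hui, mul_zero,
      add_zero]
  have hrb : inner ℝ (rhs η u b b u i) (avg (b i)) =
      inner ℝ (advect b (u i)) (avg (b i)) - inner ℝ (advect u (b i)) (avg (b i)) := by
    simp only [rhs, inner_add_left, inner_sub_left, real_inner_smul_left, hz hbi, mul_zero,
      add_zero]
  have n1 := abs_le.1 (abs_inner_advect_avg_le hb hbi hui (hue i) hbd (hbd i))
  have n2 := abs_le.1 (abs_inner_advect_avg_le hu hui hui (hue i) hud (hud i))
  have n3 := abs_le.1 (abs_inner_advect_avg_le hb hui hbi (hbe i) hbd (hud i))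
  have n4 := abs_le.1 (abs_inner_advect_avg_le hu hbi hbi (hbe i) hud (hbd i))
  linarith [n1.1, n1.2, n2.1, n2.2, n3.1, n3.2, n4.1, n4.2]

end MHD

namespace MHD

/-! ### Test functions -/

/-- The lift of a function on the strip to the universal cover. -/
def lift (ψ : Strip → ℝ) (q : ℝ × ℝ) : ℝ := ψ ((q.1 : UnitAddCircle), q.2)

/-- The classical partial derivative in the `i`-th direction. -/
def cd (i : Fin 2) (ψ : Strip → ℝ) : Strip → ℝ := if i = 0 then d1 ψ else d2 ψ

/-- The coordinate vectors of the universal cover. -/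
def unitVec (i : Fin 2) : ℝ × ℝ := if i = 0 then (1, 0) else (0, 1)

theorem cd_eq_deriv (i : Fin 2) (ψ : Strip → ℝ) (z : Strip) :
    cd i ψ z = deriv (fun s : ℝ => ψ (z + dir i s)) 0 := by
  unfold cd dir
  split
  · rw [d1]; congr 1; ext s; congr 1; exact Prod.ext rfl (add_zero _).symm
  · rw [d2]
    have h := deriv_comp_const_add (fun y : ℝ => ψ (z.1, y)) z.2 0
    rw [add_zero] at h
    rw [← h]; congr 1; ext s; congr 1; exact Prod.ext (add_zero _).symm rfl

theorem lift_add_smul (ψ : Strip → ℝ) (i : Fin 2) (q : ℝ × ℝ) (s : ℝ) :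
    ψ (((q.1 : UnitAddCircle), q.2) + dir i s) = lift ψ (q + s • unitVec i) := by
  unfold lift dir unitVec
  split <;> simp

theorem exists_cover (z : Strip) : ∃ q : ℝ × ℝ, ((q.1 : UnitAddCircle), q.2) = z := by
  obtain ⟨x, hx⟩ := QuotientAddGroup.mk_surjective z.1
  exact ⟨(x, z.2), Prod.ext hx rfl⟩

namespace IsTestFunction

variable {ψ : Strip → ℝ}

theorem contDiff_lift (h : IsTestFunction ψ) : ContDiff ℝ ∞ (lift ψ) := h.smooth

theorem continuous (h : IsTestFunction ψ) : Continuous ψ := by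
  have hq : IsOpenQuotientMap (Prod.map ((↑) : ℝ → UnitAddCircle) (id : ℝ → ℝ)) :=
    QuotientAddGroup.isOpenQuotientMap_mk.prodMap IsOpenQuotientMap.id
  exact hq.isQuotientMap.continuous_iff.2 h.contDiff_lift.continuous

theorem hasDerivAt_cover (h : IsTestFunction ψ) (i : Fin 2) (q : ℝ × ℝ) (s : ℝ) :
    HasDerivAt (fun s : ℝ => lift ψ (q + s • unitVec i))
      (fderiv ℝ (lift ψ) (q + s • unitVec i) (unitVec i)) s := by
  have h1 : HasFDerivAt (lift ψ) (fderiv ℝ (lift ψ) (q + s • unitVec i)) (q + s • unitVec i) :=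
    (h.contDiff_lift.differentiable (by simp)).differentiableAt.hasFDerivAt
  have h2 : HasDerivAt (fun s : ℝ => q + s • unitVec i) (unitVec i) s := by
    simpa using ((hasDerivAt_id s).smul_const (unitVec i)).const_add q
  exact h1.comp_hasDerivAt s h2

theorem lift_cd (h : IsTestFunction ψ) (i : Fin 2) (q : ℝ × ℝ) :
    lift (cd i ψ) q = fderiv ℝ (lift ψ) q (unitVec i) := by
  rw [lift, cd_eq_deriv]
  simp only [lift_add_smul]
  have := (h.hasDerivAt_cover i q 0).deriv
  rw [this, zero_smul, add_zero]

theorem hasDerivAt (h : IsTestFunction ψ) (i : Fin 2) (z : Strip) (s : ℝ) :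
    HasDerivAt (fun s : ℝ => ψ (z + dir i s)) (cd i ψ (z + dir i s)) s := by
  obtain ⟨q, rfl⟩ := exists_cover z
  simp only [lift_add_smul]
  rw [h.lift_cd]
  exact h.hasDerivAt_cover i q s

theorem cd_eq_zero {i : Fin 2} {z : Strip} (hz : z ∉ tsupport ψ) : cd i ψ z = 0 := by
  rw [cd_eq_deriv]
  have h1 := notMem_tsupport_iff_eventuallyEq.1 hz
  have h2 : Tendsto (fun s : ℝ => z + dir i s) (𝓝 0) (𝓝 z) := by
    have : Continuous fun s : ℝ => z + dir i s := continuous_const.add (continuous_dir i)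
    simpa using this.tendsto 0
  have h3 : (fun s : ℝ => ψ (z + dir i s)) =ᶠ[𝓝 0] fun _ => 0 := h2.eventually h1
  rw [h3.deriv_eq, deriv_const]

protected theorem cd (h : IsTestFunction ψ) (i : Fin 2) : IsTestFunction (cd i ψ) where
  smooth := by
    change ContDiff ℝ ∞ (lift (MHD.cd i ψ))
    rw [funext (h.lift_cd i)]
    exact (h.contDiff_lift.fderiv_right (m := ∞) (by simp)).clm_apply contDiff_const
  compactSupport := h.compactSupport.mono' fun _ hz => by
    by_contra hn
    exact hz (cd_eq_zero hn)

theorem cd_comm (h : IsTestFunction ψ) (i j : Fin 2) : MHD.cd i (MHD.cd j ψ) = MHD.cd j (MHD.cd i ψ) := by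
  have key : ∀ i j q, lift (MHD.cd i (MHD.cd j ψ)) q =
      fderiv ℝ (fderiv ℝ (lift ψ)) q (unitVec i) (unitVec j) := by
    intro i j q
    rw [(h.cd j).lift_cd, funext (h.lift_cd j)]
    have hd : DifferentiableAt ℝ (fderiv ℝ (lift ψ)) q :=
      ((h.contDiff_lift.fderiv_right (m := ∞) (by simp)).differentiable (by simp)).differentiableAt
    have := (hd.hasFDerivAt.clm_apply (hasFDerivAt_const (unitVec j) q)).fderiv
    rw [this]; simp
  ext z
  obtain ⟨q, rfl⟩ := exists_cover z
  have hs : IsSymmSndFDerivAt ℝ (lift ψ) q :=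
    h.contDiff_lift.contDiffAt.isSymmSndFDerivAt (by
      rw [minSmoothness_of_isRCLikeNormedField]; exact WithTop.coe_le_coe.2 le_top)
  have h1 := key i j q
  have h2 := key j i q
  rw [hs.eq] at h1
  exact h1.trans h2.symm

theorem memLp (h : IsTestFunction ψ) (p : ℝ≥0∞) : MemLp ψ p volume :=
  h.continuous.memLp_of_hasCompactSupport h.compactSupport

/-- A test function as an element of `L²(Ω)`. -/
def toL2 (h : IsTestFunction ψ) : L2Fun := (h.memLp 2).toLp ψ

theorem coeFn_toL2 (h : IsTestFunction ψ) : h.toL2 =ᵐ[volume] ψ := (h.memLp 2).coeFn_toLp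

theorem exists_bound (h : IsTestFunction ψ) : ∃ C, 0 ≤ C ∧ ∀ z, |ψ z| ≤ C := by
  obtain ⟨C, hC⟩ := h.compactSupport.exists_bound_of_continuous h.continuous
  exact ⟨C, (norm_nonneg _).trans (hC 0), hC⟩

theorem inner_toL2 (h : IsTestFunction ψ) (f : L2Fun) : inner ℝ f h.toL2 = ∫ z, f z * ψ z := by
  rw [inner_eq_integral]
  refine integral_congr_ae ?_
  filter_upwards [h.coeFn_toL2] with z hz
  rw [hz]

/-- Classical derivatives of test functions are strong `L²` derivatives. -/
theorem hasPD (h : IsTestFunction ψ) (i : Fin 2) : HasPD i h.toL2 (h.cd i).toL2 := by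
  obtain ⟨C, hC0, hC⟩ := (h.cd i).exists_bound
  have hlip : ∀ z s, |ψ (z + dir i s) - ψ z| ≤ C * |s| := fun z s => by
    have := Convex.norm_image_sub_le_of_norm_hasDerivWithin_le (s := Set.univ)
      (f := fun s : ℝ => ψ (z + dir i s)) (C := C) (x := 0) (y := s)
      (fun x _ => (h.hasDerivAt i z x).hasDerivWithinAt) (fun x _ => hC _) convex_univ
      trivial trivial
    simpa using this
  -- A compact set containing the supports of all translates by at most one; together with the
  -- Lipschitz constant `C` it provides the dominating function.
  let K : Set Strip := (fun p : Strip × ℝ => p.1 - dir i p.2) '' (tsupport ψ ×ˢ Set.Icc (-1) 1)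
  have hK : IsCompact K := (h.compactSupport.isCompact.prod isCompact_Icc).image
    (continuous_fst.sub ((continuous_dir i).comp continuous_snd))
  have hKz : ∀ z ∉ K, ∀ s ∈ Set.Icc (-1 : ℝ) 1, z + dir i s ∉ tsupport ψ := fun z hz s hs hn =>
    hz ⟨(z + dir i s, s), ⟨hn, hs⟩, by simp⟩
  let g : ℝ → Strip → ℝ := fun s z => s⁻¹ * (ψ (z + dir i s) - ψ z) - MHD.cd i ψ z
  have hg : ∀ s, Continuous (g s) := fun s =>
    (continuous_const.mul ((h.continuous.comp (continuous_id.add continuous_const)).sub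
      h.continuous)).sub (h.cd i).continuous
  have hgb : ∀ᶠ s in 𝓝[≠] (0 : ℝ), ∀ z, ‖g s z‖ₑ ^ 2 ≤
      K.indicator (fun _ => ENNReal.ofReal ((2 * C) ^ 2)) z := by
    have h1 : Set.Icc (-1 : ℝ) 1 ∈ 𝓝[≠] (0 : ℝ) :=
      mem_nhdsWithin_of_mem_nhds (Icc_mem_nhds (by norm_num) (by norm_num))
    filter_upwards [h1, self_mem_nhdsWithin] with s hs hs0 z
    by_cases hz : z ∈ K
    · rw [Set.indicator_of_mem hz, ofReal_sq_enorm]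
      refine ENNReal.ofReal_le_ofReal (pow_le_pow_left₀ (norm_nonneg _) ?_ 2)
      have hs0' : s ≠ 0 := hs0
      calc ‖g s z‖ ≤ ‖s⁻¹ * (ψ (z + dir i s) - ψ z)‖ + ‖MHD.cd i ψ z‖ := norm_sub_le _ _
        _ ≤ |s|⁻¹ * (C * |s|) + C := by
            rw [norm_mul, norm_inv]
            exact add_le_add (mul_le_mul_of_nonneg_left (hlip z s) (by positivity)) (hC z)
        _ = 2 * C := by field_simp; ring
    · have h2 := hKz z hz s hs
      have h3 := hKz z hz 0 (by norm_num)
      rw [dir_zero, add_zero] at h3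
      have : g s z = 0 := by
        simp only [g, image_eq_zero_of_notMem_tsupport h2, image_eq_zero_of_notMem_tsupport h3,
          cd_eq_zero h3]
        ring
      rw [this]; simp
  have hlim : Tendsto (fun s => ∫⁻ z, ‖g s z‖ₑ ^ 2) (𝓝[≠] 0) (𝓝 (∫⁻ _ : Strip, 0)) := by
    refine tendsto_lintegral_filter_of_dominated_convergence
      (K.indicator fun _ => ENNReal.ofReal ((2 * C) ^ 2))
      (Eventually.of_forall fun s => (hg s).measurable.enorm.pow_const 2)
      (hgb.mono fun s hs => Eventually.of_forall hs) ?_ (Eventually.of_forall fun z => ?_)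
    · rw [lintegral_indicator hK.measurableSet, setLIntegral_const]
      exact ENNReal.mul_ne_top ENNReal.ofReal_ne_top hK.measure_lt_top.ne
    · have h1 := hasDerivAt_iff_tendsto_slope_zero.1 (h.hasDerivAt i z 0)
      simp only [zero_add, dir_zero, add_zero, smul_eq_mul] at h1
      have h2 : Tendsto (fun s => g s z) (𝓝[≠] 0) (𝓝 0) := by
        simpa using h1.sub_const (MHD.cd i ψ z)
      have h3 := (((ENNReal.continuous_pow 2).comp continuous_enorm).tendsto (0 : ℝ)).comp h2
      simpa [Function.comp_def] using h3
  rw [HasPD, hasDerivAt_iff_tendsto_slope_zero, tendsto_iff_edist_tendsto_0]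
  have hl2 := ((ENNReal.continuous_rpow_const (y := (1 / 2 : ℝ))).tendsto _).comp hlim
  simp only [lintegral_zero] at hl2
  rw [ENNReal.zero_rpow_of_pos (by norm_num)] at hl2
  refine hl2.congr fun s => ?_
  rw [Function.comp_apply, edist_eq_enorm_sub]
  have h4 : ‖s⁻¹ • (shift (dir i s) h.toL2 - h.toL2) - (h.cd i).toL2‖ₑ ^ 2 =
      ∫⁻ z, ‖g s z‖ₑ ^ 2 := by
    rw [enorm_sq_eq_lintegral]
    refine lintegral_congr_ae ?_
    filter_upwards [Lp.coeFn_sub (s⁻¹ • (shift (dir i s) h.toL2 - h.toL2)) (h.cd i).toL2,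
      Lp.coeFn_smul s⁻¹ (shift (dir i s) h.toL2 - h.toL2),
      Lp.coeFn_sub (shift (dir i s) h.toL2) h.toL2, coeFn_shift (dir i s) h.toL2,
      h.coeFn_toL2, ae_shift (dir i s) h.coeFn_toL2, (h.cd i).coeFn_toL2]
      with z h1 h2 h3 h4 h5 h6 h7
    rw [h1, Pi.sub_apply, h2, Pi.smul_apply, h3, Pi.sub_apply, h4, h5, h6, h7, smul_eq_mul]
  rw [← h4, ← ENNReal.rpow_natCast, ← ENNReal.rpow_mul]
  simp

theorem isH1 (h : IsTestFunction ψ) : IsH1 h.toL2 := fun i => by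
  rw [(h.hasPD i).pd_eq]; exact h.hasPD i

theorem pd_toL2 (h : IsTestFunction ψ) (i : Fin 2) : pd i h.toL2 = (h.cd i).toL2 :=
  (h.hasPD i).pd_eq

end IsTestFunction

/-- With `L` the real or the imaginary part, real test functions detect complex Fourier
coefficients. -/
theorem isTestFunction_fourier_mul (L : ℂ →L[ℝ] ℝ) (k : ℤ) {χ : ℝ → ℝ} (hχ : ContDiff ℝ ∞ χ)
    (hc : HasCompactSupport χ) :
    IsTestFunction fun z : Strip => L (fourier k z.1) * χ z.2 where
  smooth := by
    simp only [fourier_coe_apply]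
    refine ContDiff.mul (L.contDiff.comp (ContDiff.cexp ?_)) (hχ.comp contDiff_snd)
    exact (contDiff_const.mul (Complex.ofRealCLM.contDiff.comp contDiff_fst)).div_const _
  compactSupport := by
    refine HasCompactSupport.intro (isCompact_univ.prod hc.isCompact) fun z hz => ?_
    have : z.2 ∉ tsupport χ := fun h => hz ⟨trivial, h⟩
    rw [image_eq_zero_of_notMem_tsupport this, mul_zero]

/-- Test functions are dense in `L²(Ω)`. -/
theorem eq_zero_of_forall_test {f : L2Fun}
    (h : ∀ ψ : Strip → ℝ, IsTestFunction ψ → ∫ z, f z * ψ z = 0) : f = 0 := by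
  -- Testing with a character in `x` times a bump in `y` reduces density to the one-dimensional
  -- fundamental lemma; Parseval then concludes.
  have hx : ∀ k, xCoeff (complexify f) k =ᵐ[volume] 0 := by
    intro k
    have hloc : LocallyIntegrable (xCoeff (complexify f) k) volume :=
      (xCoeff_memLp (complexify f) k).locallyIntegrable (by norm_num)
    refine ae_eq_zero_of_integral_contDiff_smul_eq_zero hloc fun χ hχ hc => ?_
    have hre := isTestFunction_fourier_mul Complex.reCLM (-k) hχ hc
    have him := isTestFunction_fourier_mul Complex.imCLM (-k) hχ hc
    have hire := (Lp.memLp f).integrable_mul (hre.memLp 2)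
    have hiim := (Lp.memLp f).integrable_mul (him.memLp 2)
    have e : ∀ z : Strip, (f z : ℂ) * fourier (-k) z.1 * χ z.2 =
        ((f z * (Complex.reCLM (fourier (-k) z.1) * χ z.2) : ℝ) : ℂ) +
          Complex.I * ((f z * (Complex.imCLM (fourier (-k) z.1) * χ z.2) : ℝ) : ℂ) := by
      intro z
      conv_lhs => rw [← Complex.re_add_im (fourier (-k) z.1)]
      simp only [Complex.reCLM_apply, Complex.imCLM_apply]
      push_cast
      ring
    have h1 : Integrable (fun z : Strip => (f z : ℂ) * fourier (-k) z.1 * χ z.2) := by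
      simp only [e]
      exact hire.ofReal.add (hiim.ofReal.const_mul _)
    have h2 : ∫ z : Strip, (f z : ℂ) * fourier (-k) z.1 * χ z.2 = 0 := by
      simp only [e]
      rw [integral_add hire.ofReal (hiim.ofReal.const_mul _), integral_const_mul,
        integral_complex_ofReal, integral_complex_ofReal, h _ hre, h _ him]
      simp
    have h3 := integral_prod_symm (μ := (volume : Measure UnitAddCircle))
      (ν := (volume : Measure ℝ)) _ h1
    rw [← h2, show (∫ z : Strip, (f z : ℂ) * fourier (-k) z.1 * χ z.2) = _ from h3]
    refine integral_congr_ae ?_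
    filter_upwards [ae_ae_of_ae_strip (coeFn_complexify f)] with y hy
    rw [xCoeff, ← integral_smul]
    refine integral_congr_ae ?_
    filter_upwards [hy] with x hx
    rw [hx, Complex.real_smul]; ring
  have h0 : complexify f = 0 := by
    have h1 := enorm_sq_eq_lintegral (complexify f)
    rw [lintegral_enorm_sq_eq_tsum_xCoeff] at h1
    have h2 : ∀ k, ∫⁻ y, ‖xCoeff (complexify f) k y‖ₑ ^ 2 = 0 := fun k => by
      rw [lintegral_congr_ae (g := fun _ => 0)]
      · simp
      · filter_upwards [hx k] with y hy
        simp [hy]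
    simp only [h2, tsum_zero] at h1
    simpa using h1
  rw [← realPart_complexify f, h0, map_zero]

end MHD

namespace MHD

/-! ### Vector fields and their components -/

/-- The vector field whose `i`-th component is the given function, the other one being zero. -/
def embed (i : Fin 2) : L2Fun →L[ℝ] L2Field :=
  (ContinuousLinearMap.toSpanSingleton ℝ (EuclideanSpace.single i (1 : ℝ) : Vec)).compLpL 2 volume

theorem coeFn_embed (i : Fin 2) (f : L2Fun) :
    embed i f =ᵐ[volume] fun z => f z • (EuclideanSpace.single i (1 : ℝ) : Vec) :=
  (ContinuousLinearMap.toSpanSingleton ℝ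
    (EuclideanSpace.single i (1 : ℝ) : Vec)).coeFn_compLpL f

theorem embed_shift (i : Fin 2) (a : Strip) (f : L2Fun) :
    embed i (shift a f) = shift a (embed i f) := compLpL_shift _ a f

theorem coord_embed (i j : Fin 2) (f : L2Fun) :
    coord j (embed i f) = if j = i then f else 0 := by
  apply Lp.ext
  filter_upwards [coeFn_coord j (embed i f), coeFn_embed i f,
    Lp.coeFn_zero (E := ℝ) (p := 2) (μ := (volume : Measure Strip))] with z h1 h2 h3
  rw [h1, h2]
  split <;> simp_all

theorem l2Field_ext {v w : L2Field} (h : ∀ i, coord i v = coord i w) : v = w := by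
  apply Lp.ext
  filter_upwards [coeFn_coord 0 v, coeFn_coord 1 v, coeFn_coord 0 w, coeFn_coord 1 w]
    with z h1 h2 h3 h4
  ext i
  fin_cases i
  · change v z 0 = w z 0
    rw [← h1, ← h3, h]
  · change v z 1 = w z 1
    rw [← h2, ← h4, h]

/-- The vector field with given components. -/
def ofCoords (f : Fin 2 → L2Fun) : L2Field := embed 0 (f 0) + embed 1 (f 1)

@[simp] theorem coord_ofCoords (f : Fin 2 → L2Fun) (i : Fin 2) : coord i (ofCoords f) = f i := by
  rw [ofCoords, map_add, coord_embed, coord_embed]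
  fin_cases i <;> simp

theorem inner_l2Field (v w : L2Field) :
    inner ℝ v w = inner ℝ (coord 0 v) (coord 0 w) + inner ℝ (coord 1 v) (coord 1 w) := by
  have hi : ∀ i, Integrable fun z => coord i v z * coord i w z := fun i =>
    (Lp.memLp _).integrable_mul (Lp.memLp _)
  rw [inner_eq_integral, inner_eq_integral, L2.inner_def, ← integral_add (hi 0) (hi 1)]
  refine integral_congr_ae ?_
  filter_upwards [coeFn_coord 0 v, coeFn_coord 1 v, coeFn_coord 0 w, coeFn_coord 1 w]
    with z h1 h2 h3 h4
  rw [h1, h2, h3, h4, PiLp.inner_apply, Fin.sum_univ_two]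
  simp [mul_comm]

theorem norm_sq_l2Field (v : L2Field) : ‖v‖ ^ 2 = ‖coord 0 v‖ ^ 2 + ‖coord 1 v‖ ^ 2 := by
  simp only [← real_inner_self_eq_norm_sq]
  exact inner_l2Field v v

theorem norm_coord_le (v : L2Field) (i : Fin 2) : ‖coord i v‖ ≤ ‖v‖ := by
  refine (sq_le_sq₀ (norm_nonneg _) (norm_nonneg _)).1 ?_
  rw [norm_sq_l2Field v]
  fin_cases i <;> simp

/-- The componentwise action of an operator on vector fields. -/
def mapField (A : L2Fun →L[ℝ] L2Fun) : L2Field →L[ℝ] L2Field :=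
  embed 0 ∘L A ∘L coord 0 + embed 1 ∘L A ∘L coord 1

theorem coord_mapField (A : L2Fun →L[ℝ] L2Fun) (v : L2Field) (i : Fin 2) :
    coord i (mapField A v) = A (coord i v) :=
  coord_ofCoords (fun i => A (coord i v)) i

/-! ### Weak formulations of first-order identities -/

theorem weak_div_iff {v : L2Field} {ψ : Strip → ℝ} (hψ : IsTestFunction ψ) :
    ∫ z, (v z 0 * d1 ψ z + v z 1 * d2 ψ z) =
      inner ℝ (coord 0 v) (hψ.cd 0).toL2 + inner ℝ (coord 1 v) (hψ.cd 1).toL2 := by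
  have hi : ∀ i, Integrable fun z => coord i v z * cd i ψ z := fun i =>
    (Lp.memLp _).integrable_mul ((hψ.cd i).memLp 2)
  rw [(hψ.cd 0).inner_toL2, (hψ.cd 1).inner_toL2, ← integral_add (hi 0) (hi 1)]
  refine integral_congr_ae ?_
  filter_upwards [coeFn_coord 0 v, coeFn_coord 1 v] with z h1 h2
  rw [h1, h2]; rfl

theorem eq_zero_of_forall_inner {f : L2Fun}
    (h : ∀ ψ : Strip → ℝ, ∀ hψ : IsTestFunction ψ, inner ℝ f hψ.toL2 = 0) : f = 0 :=
  eq_zero_of_forall_test fun ψ hψ => by rw [← hψ.inner_toL2]; exact h ψ hψ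

theorem IsDivergenceFree.pd_add_pd {v : L2Field} (hv : IsDivergenceFree v)
    (h : ∀ i, IsH1 (coord i v)) : pd 0 (coord 0 v) + pd 1 (coord 1 v) = 0 := by
  refine eq_zero_of_forall_inner fun ψ hψ => ?_
  have h1 := hv ψ hψ
  rw [weak_div_iff hψ] at h1
  rw [inner_add_left, (h 0 0).inner_left (hψ.hasPD 0), (h 1 1).inner_left (hψ.hasPD 1)]
  linarith

theorem IsWeakD2.pd_eq {v w : L2Field} (hvw : IsWeakD2 v w) (i : Fin 2)
    (h : IsH1 (coord i v)) : pd 1 (coord i v) = coord i w := by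
  rw [← sub_eq_zero]
  refine eq_zero_of_forall_inner fun ψ hψ => ?_
  have h1 := hvw ψ hψ i
  rw [inner_sub_left, (h 1).inner_left (hψ.hasPD 1), (hψ.cd 1).inner_toL2, hψ.inner_toL2]
  have h2 : ∫ z, coord i v z * cd 1 ψ z = ∫ z, v z i * d2 ψ z := by
    refine integral_congr_ae ?_
    filter_upwards [coeFn_coord i v] with z hz
    rw [hz]; rfl
  have h3 : ∫ z, coord i w z * ψ z = ∫ z, w z i * ψ z := by
    refine integral_congr_ae ?_
    filter_upwards [coeFn_coord i w] with z hz
    rw [hz]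
  rw [h2, h3, h1]; ring

/-! ### Solenoidal fields are limits of curls of test functions -/

/-- The field `∇^⊥ψ = (∂₂ψ, -∂₁ψ)`. -/
def curl {ψ : Strip → ℝ} (hψ : IsTestFunction ψ) : L2Field :=
  ofCoords ![(hψ.cd 1).toL2, -(hψ.cd 0).toL2]

theorem coord_zero_curl {ψ : Strip → ℝ} (hψ : IsTestFunction ψ) :
    coord 0 (curl hψ) = (hψ.cd 1).toL2 := by simp [curl]

theorem coord_one_curl {ψ : Strip → ℝ} (hψ : IsTestFunction ψ) :
    coord 1 (curl hψ) = -(hψ.cd 0).toL2 := by simp [curl]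

/-- The linear span of the fields `∇^⊥ψ` with `ψ` a test function. -/
def curlSpan : Submodule ℝ L2Field :=
  Submodule.span ℝ {v | ∃ ψ : Strip → ℝ, ∃ hψ : IsTestFunction ψ, v = curl hψ}

theorem IsTestFunction.shift {ψ : Strip → ℝ} (hψ : IsTestFunction ψ) (a : Strip) :
    IsTestFunction fun z => ψ (z + a) where
  smooth := by
    obtain ⟨q, rfl⟩ := exists_cover a
    have : ContDiff ℝ ∞ fun p : ℝ × ℝ => lift ψ (p + q) :=
      hψ.contDiff_lift.comp (contDiff_id.add contDiff_const)
    convert! this using 1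
  compactSupport := hψ.compactSupport.comp_homeomorph (Homeomorph.addRight a)

theorem IsTestFunction.toL2_shift {ψ : Strip → ℝ} (hψ : IsTestFunction ψ) (a : Strip) :
    (hψ.shift a).toL2 = MHD.shift a hψ.toL2 := by
  apply Lp.ext
  filter_upwards [(hψ.shift a).coeFn_toL2, coeFn_shift a hψ.toL2, ae_shift a hψ.coeFn_toL2]
    with z h1 h2 h3
  rw [h1, h2, h3]

theorem shift_curl {ψ : Strip → ℝ} (hψ : IsTestFunction ψ) (a : Strip) :
    shift a (curl hψ) = curl (hψ.shift a) := by
  have key : ∀ i, ((hψ.shift a).cd i).toL2 = shift a (hψ.cd i).toL2 := fun i => by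
    rw [← (hψ.shift a).pd_toL2 i, hψ.toL2_shift, pd_shift hψ.isH1, hψ.pd_toL2]
  refine l2Field_ext fun i => ?_
  rw [coord_shift]
  fin_cases i
  · simp only [Fin.zero_eta, coord_zero_curl, key]
  · simp only [Fin.mk_one, coord_one_curl, key, map_neg]

theorem shift_mem_closure_curlSpan {v : L2Field} (hv : v ∈ curlSpan.topologicalClosure)
    (a : Strip) : shift a v ∈ curlSpan.topologicalClosure := by
  have h1 : ∀ w ∈ curlSpan, shift a w ∈ curlSpan := fun w hw => by
    induction hw using Submodule.span_induction with
    | mem x hx =>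
      obtain ⟨ψ, hψ, rfl⟩ := hx
      rw [shift_curl]
      exact Submodule.subset_span ⟨_, _, rfl⟩
    | zero => rw [map_zero]; exact Submodule.zero_mem _
    | add x y _ _ hx hy => rw [map_add]; exact Submodule.add_mem _ hx hy
    | smul c x _ hx => rw [map_smul]; exact Submodule.smul_mem _ c hx
  exact map_mem_closure (shift a).continuous hv h1

instance : CompleteSpace curlSpan.topologicalClosure :=
  curlSpan.isClosed_topologicalClosure.completeSpace_coe

/-- The orthogonal projection onto the closure of the curls of test functions. -/
def curlProj : L2Field →L[ℝ] L2Field := curlSpan.topologicalClosure.starProjection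

/-- The closed span of curls and its orthogonal complement are both translation invariant, so the
projection preserves strong differentiability. -/
theorem curlProj_shift (a : Strip) (v : L2Field) : curlProj (shift a v) = shift a (curlProj v) := by
  refine Submodule.eq_starProjection_of_mem_orthogonal
    (shift_mem_closure_curlSpan (Submodule.starProjection_apply_mem _ _) a) ?_
  rw [← map_sub, Submodule.mem_orthogonal]
  intro w hw
  rw [real_inner_comm, inner_shift_left, real_inner_comm]
  exact (Submodule.mem_orthogonal _ _).1
    (Submodule.sub_starProjection_mem_orthogonal v) _ (shift_mem_closure_curlSpan hw _)

/-- The residual `w` of the projection is again `H¹`. Orthogonality to curls makes it curl-free; it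
is divergence-free because `v` and all curls are orthogonal to gradients of test functions. A square
integrable field with both properties has zero gradient, hence is zero. -/
theorem mem_closure_curlSpan {v : L2Field} (hv : ∀ i, IsH1 (coord i v))
    (hdiv : pd 0 (coord 0 v) + pd 1 (coord 1 v) = 0) : v ∈ curlSpan.topologicalClosure := by
  set w := v - curlProj v with hw
  have hwo : w ∈ curlSpan.topologicalClosureᗮ := Submodule.sub_starProjection_mem_orthogonal v
  have hpd : ∀ i, HasPD i v (ofCoords fun j => pd i (coord j v)) := fun i => by
    have h0 := ((hv 0) i).map (embed 0) (embed_shift 0)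
    have h1 := ((hv 1) i).map (embed 1) (embed_shift 1)
    have h2 := h0.add h1
    have h3 : embed 0 (coord 0 v) + embed 1 (coord 1 v) = v :=
      l2Field_ext fun i => coord_ofCoords (fun i => coord i v) i
    rw [h3] at h2
    exact h2
  have hH1 : ∀ j, IsH1 (coord j w) := fun j i => by
    have h1 := (hpd i).sub ((hpd i).map curlProj curlProj_shift)
    have h2 := h1.map (coord j) (coord_shift j)
    rw [← hw] at h2
    rw [h2.pd_eq]; exact h2
  have hcurl : pd 1 (coord 0 w) - pd 0 (coord 1 w) = 0 := by
    refine eq_zero_of_forall_inner fun ψ hψ => ?_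
    have h1 : inner ℝ (curl hψ) w = 0 := (Submodule.mem_orthogonal _ _).1 hwo _
      (curlSpan.le_topologicalClosure (Submodule.subset_span ⟨ψ, hψ, rfl⟩))
    rw [real_inner_comm, inner_l2Field, coord_zero_curl, coord_one_curl, inner_neg_right] at h1
    rw [inner_sub_left, ((hH1 0) 1).inner_left (hψ.hasPD 1), ((hH1 1) 0).inner_left (hψ.hasPD 0)]
    linarith
  have hdivw : pd 0 (coord 0 w) + pd 1 (coord 1 w) = 0 := by
    refine eq_zero_of_forall_inner fun ψ hψ => ?_
    let G : L2Field := ofCoords fun i => (hψ.cd i).toL2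
    have hG : ∀ x : L2Field, inner ℝ x G =
        inner ℝ (coord 0 x) (hψ.cd 0).toL2 + inner ℝ (coord 1 x) (hψ.cd 1).toL2 := fun x => by
      rw [inner_l2Field, coord_ofCoords, coord_ofCoords]
    have h1 : ∀ x ∈ curlSpan, inner ℝ x G = 0 := fun x hx => by
      induction hx using Submodule.span_induction with
      | mem x hx =>
        obtain ⟨φ, hφ, rfl⟩ := hx
        rw [hG, coord_zero_curl, coord_one_curl, inner_neg_left]
        have := inner_pd_pd_swap hφ.isH1 hψ.isH1 1 0
        simp only [IsTestFunction.pd_toL2] at this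
        linarith
      | zero => exact inner_zero_left _
      | add x y _ _ hx hy => rw [inner_add_left, hx, hy, add_zero]
      | smul c x _ hx => rw [real_inner_smul_left, hx, mul_zero]
    have h2 : inner ℝ (curlProj v) G = 0 := by
      have hcl : IsClosed {x : L2Field | inner ℝ x G = 0} :=
        isClosed_eq (continuous_id.inner continuous_const) continuous_const
      exact closure_minimal (fun x hx => h1 x hx) hcl
        (Submodule.starProjection_apply_mem curlSpan.topologicalClosure v)
    have h3 : inner ℝ v G = 0 := by
      have h4 : inner ℝ (pd 0 (coord 0 v) + pd 1 (coord 1 v)) hψ.toL2 = 0 := by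
        rw [hdiv, inner_zero_left]
      rw [inner_add_left, ((hv 0) 0).inner_left (hψ.hasPD 0),
        ((hv 1) 1).inner_left (hψ.hasPD 1)] at h4
      rw [hG]; linarith
    have h5 : inner ℝ w G = 0 := by rw [hw, inner_sub_left, h2, h3, sub_zero]
    rw [hG] at h5
    rw [inner_add_left, ((hH1 0) 0).inner_left (hψ.hasPD 0), ((hH1 1) 1).inner_left (hψ.hasPD 1)]
    linarith
  have hsum : ‖pd 1 (coord 0 w)‖ ^ 2 + ‖pd 1 (coord 1 w)‖ ^ 2 ≤ 0 := by
    have h1 : inner ℝ (pd 0 (coord 0 w) + pd 1 (coord 1 w))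
        (pd 0 (coord 0 w) + pd 1 (coord 1 w)) = 0 := by rw [hdivw, inner_zero_left]
    have h2 : inner ℝ (pd 1 (coord 0 w) - pd 0 (coord 1 w))
        (pd 1 (coord 0 w) - pd 0 (coord 1 w)) = 0 := by rw [hcurl, inner_zero_left]
    rw [real_inner_add_add_self] at h1
    rw [real_inner_sub_sub_self] at h2
    -- The cross terms of the squared divergence and the squared curl cancel in the sum, leaving the
    -- full squared gradient.
    have h3 := inner_pd_pd_swap (hH1 0) (hH1 1) 0 1
    simp only [real_inner_self_eq_norm_sq] at h1 h2
    nlinarith [sq_nonneg ‖pd 0 (coord 0 w)‖, sq_nonneg ‖pd 0 (coord 1 w)‖]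
  have hz : ∀ i, coord i w = 0 := by
    have h0 : ‖pd 1 (coord 0 w)‖ = 0 := by
      nlinarith [sq_nonneg ‖pd 1 (coord 0 w)‖, sq_nonneg ‖pd 1 (coord 1 w)‖]
    have h1 : ‖pd 1 (coord 1 w)‖ = 0 := by
      nlinarith [sq_nonneg ‖pd 1 (coord 0 w)‖, sq_nonneg ‖pd 1 (coord 1 w)‖]
    intro i
    refine eq_zero_of_hasPD_one_zero ?_
    have h2 := hH1 i 1
    have h3 : pd 1 (coord i w) = 0 := by
      fin_cases i
      · exact norm_eq_zero.1 h0
      · exact norm_eq_zero.1 h1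
    rwa [h3] at h2
  have hw0 : w = 0 := l2Field_ext fun i => by rw [hz, map_zero]
  rw [sub_eq_zero.1 (hw.symm.trans hw0)]
  exact Submodule.starProjection_apply_mem _ _

end MHD

namespace MHD

/-! ### Evolution equations in a weak form -/

/-- A primitive of a mean-zero bump function on the half-line. -/
theorem exists_bump_primitive {h : ℝ → ℝ} (hs : ContDiff ℝ ∞ h) (hc : HasCompactSupport h)
    (hsub : tsupport h ⊆ Set.Ioi 0) (h0 : ∫ x, h x = 0) :
    ∃ θ : ℝ → ℝ, ContDiff ℝ ∞ θ ∧ HasCompactSupport θ ∧ tsupport θ ⊆ Set.Ioi 0 ∧ deriv θ = h := by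
  let θ : ℝ → ℝ := fun r => ∫ x in (0 : ℝ)..r, h x
  have hd : ∀ r, HasDerivAt θ (h r) r := fun r =>
    intervalIntegral.integral_hasDerivAt_right (hs.continuous.intervalIntegrable _ _)
      (hs.continuous.stronglyMeasurableAtFilter _ _) hs.continuous.continuousAt
  have hderiv : deriv θ = h := funext fun r => (hd r).deriv
  -- The support stays a positive distance `α` from zero, so the primitive started at zero is also
  -- supported inside the open half-line.
  obtain ⟨α, hα, hαs⟩ : ∃ α > 0, ∀ x < α, h x = 0 := by
    rcases (tsupport h).eq_empty_or_nonempty with he | hne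
    · exact ⟨1, one_pos, fun x _ => image_eq_zero_of_notMem_tsupport (by simp [he])⟩
    · obtain ⟨α, hα, hmin⟩ := hc.isCompact.exists_isLeast hne
      exact ⟨α, hsub hα, fun x hx => image_eq_zero_of_notMem_tsupport fun hm =>
        absurd (hmin hm) (not_le.2 hx)⟩
  obtain ⟨β, hβ⟩ : ∃ β, ∀ x > β, h x = 0 := by
    obtain ⟨β, hβ⟩ := hc.isCompact.bddAbove
    exact ⟨β, fun x hx => image_eq_zero_of_notMem_tsupport fun hm =>
      absurd (hβ hm) (not_le.2 hx)⟩
  have hz1 : ∀ r < α, θ r = 0 := fun r hr => by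
    refine (intervalIntegral.integral_congr (g := fun _ => 0) fun x hx => ?_).trans (by simp)
    refine hαs x (lt_of_le_of_lt hx.2 (max_lt hα hr))
  have hz2 : ∀ r > β, θ r = 0 := fun r hr => by
    have h1 : (∫ x in (0 : ℝ)..r, h x) = ∫ x, h x := by
      refine intervalIntegral.integral_eq_integral_of_support_subset fun x hx => ?_
      have hx0 : α ≤ x := by
        by_contra hn; exact hx (hαs x (not_le.1 hn))
      have hx1 : x ≤ β := by
        by_contra hn; exact hx (hβ x (not_le.1 hn))
      exact ⟨hα.trans_le hx0, hx1.trans hr.le⟩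
    exact h1.trans h0
  have hsupp : tsupport θ ⊆ Set.Icc α β := by
    refine closure_minimal (fun x hx => ?_) isClosed_Icc
    refine ⟨?_, ?_⟩
    · by_contra hn; exact hx (hz1 x (not_le.1 hn))
    · by_contra hn; exact hx (hz2 x (not_le.1 hn))
  refine ⟨θ, ?_, isCompact_Icc.of_isClosed_subset (isClosed_tsupport θ) hsupp,
    fun x hx => hα.trans_le (hsupp hx).1, hderiv⟩
  rw [contDiff_infty_iff_deriv, hderiv]
  exact ⟨fun r => (hd r).differentiableAt, hs⟩

/-- The lemma of du Bois-Reymond on the half-line. -/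
theorem eq_const_of_forall_integral_deriv {A : ℝ → ℝ} (hA : Continuous A)
    (h : ∀ θ : ℝ → ℝ, ContDiff ℝ ∞ θ → HasCompactSupport θ → tsupport θ ⊆ Set.Ioi 0 →
      ∫ t, deriv θ t * A t = 0) : ∀ t, 0 ≤ t → A t = A 0 := by
  obtain ⟨ρ, hρs, hρc, hρ1, hρsub⟩ : ∃ ρ : ℝ → ℝ, ContDiff ℝ ∞ ρ ∧ HasCompactSupport ρ ∧
      ∫ x, ρ x = 1 ∧ tsupport ρ ⊆ Set.Ioi 0 := by
    let β : ContDiffBump (2 : ℝ) := ⟨1 / 2, 1, by norm_num, by norm_num⟩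
    refine ⟨β.normed volume, β.contDiff_normed, β.hasCompactSupport_normed, β.integral_normed,
      fun x hx => ?_⟩
    rw [β.tsupport_normed_eq, Metric.mem_closedBall, Real.dist_eq] at hx
    have := (abs_le.1 hx).1
    simp only [Set.mem_Ioi]
    have h1 : β.rOut = 1 := rfl
    linarith
  set c := ∫ t, ρ t * A t with hc
  have hint : ∀ {g : ℝ → ℝ}, ContDiff ℝ ∞ g → HasCompactSupport g →
      ∀ {B : ℝ → ℝ}, Continuous B → Integrable fun t => g t * B t := fun {g} hg hgc {B} hB =>
    (hg.continuous.mul hB).integrable_of_hasCompactSupport hgc.mul_right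
  have key : ∀ᵐ t, t ∈ Set.Ioi (0 : ℝ) → A t - c = 0 := by
    refine isOpen_Ioi.ae_eq_zero_of_integral_contDiff_smul_eq_zero
      ((hA.sub continuous_const).locallyIntegrable.locallyIntegrableOn _) fun g hg hgc hgs => ?_
    set m := ∫ x, g x with hm
    have h1 : ContDiff ℝ ∞ fun x => g x - m * ρ x := hg.sub (contDiff_const.mul hρs)
    have h2 : HasCompactSupport fun x => g x - m * ρ x := hgc.sub hρc.mul_left
    have h3 : tsupport (fun x => g x - m * ρ x) ⊆ Set.Ioi 0 := by
      refine (tsupport_sub g _).trans (Set.union_subset hgs ?_)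
      exact (tsupport_mul_subset_right).trans hρsub
    have hgi := hg.continuous.integrable_of_hasCompactSupport hgc (μ := volume)
    have hρi := hρs.continuous.integrable_of_hasCompactSupport hρc (μ := volume)
    have h4 : ∫ x, (g x - m * ρ x) = 0 := by
      rw [integral_sub hgi (hρi.const_mul m), integral_const_mul, hρ1, ← hm]; ring
    -- Subtracting `m` times the unit-mass bump `ρ` makes `g` the derivative of an admissible `θ`;
    -- this forces `A` to equal its `ρ`-mean `c`.
    obtain ⟨θ, hθs, hθc, hθsub, hθd⟩ := exists_bump_primitive h1 h2 h3 h4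
    have h5 := h θ hθs hθc hθsub
    rw [hθd] at h5
    have h6 : (∫ x, g x * A x) - m * c = 0 := by
      rw [← h5, hc, ← integral_const_mul, ← integral_sub (hint hg hgc hA)
        ((hint hρs hρc hA).const_mul m)]
      congr 1; ext x; ring
    simp only [smul_eq_mul, mul_sub]
    rw [integral_sub (hint hg hgc hA) (hgi.mul_const c), integral_mul_const, ← hm, h6]
  have hpos : ∀ t, 0 < t → A t = c := by
    have h1 := (ae_restrict_iff' measurableSet_Ioi).2 key
    have h2 := Measure.eqOn_open_of_ae_eq (f := fun t => A t - c) (g := fun _ => 0) h1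
      isOpen_Ioi (hA.sub continuous_const).continuousOn continuousOn_const
    exact fun t ht => sub_eq_zero.1 (h2 ht)
  have h0 : A 0 = c := by
    have h1 : Tendsto A (𝓝[>] 0) (𝓝 (A 0)) := hA.continuousWithinAt
    refine tendsto_nhds_unique h1 (tendsto_const_nhds.congr' ?_)
    filter_upwards [self_mem_nhdsWithin] with t ht using (hpos t ht).symm
  intro t ht
  rcases ht.eq_or_lt with rfl | ht
  · rfl
  · rw [hpos t ht, h0]

/-- A weak evolution equation with continuous data holds in integrated form. -/
theorem sub_eq_integral_of_weak {a N : ℝ → ℝ} (ha : Continuous a) (hN : Continuous N)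
    (h : ∀ θ : ℝ → ℝ, ContDiff ℝ ∞ θ → HasCompactSupport θ → tsupport θ ⊆ Set.Ioi 0 →
      ∫ t in Set.Ioi (0 : ℝ), (deriv θ t * a t + θ t * N t) = 0) {s t : ℝ} (hs : 0 ≤ s)
    (ht : 0 ≤ t) : a t - a s = ∫ τ in s..t, N τ := by
  -- Subtracting a primitive of `N` reduces the weak equation to the lemma of du Bois-Reymond for `a
  -- - I`.
  let I : ℝ → ℝ := fun t => ∫ τ in (0 : ℝ)..t, N τ
  have hId : ∀ t, HasDerivAt I (N t) t := fun t =>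
    intervalIntegral.integral_hasDerivAt_right (hN.intervalIntegrable _ _)
      (hN.stronglyMeasurableAtFilter _ _) hN.continuousAt
  have hI : Continuous I := continuous_iff_continuousAt.2 fun t => (hId t).continuousAt
  have hA : ∀ t, 0 ≤ t → a t - I t = a 0 - I 0 := by
    refine eq_const_of_forall_integral_deriv (ha.sub hI) fun θ hθ hθc hθs => ?_
    have h1 := h θ hθ hθc hθs
    have hθ' : Continuous (deriv θ) := hθ.continuous_deriv (by simp)
    have hcd : HasCompactSupport (deriv θ) := hθc.deriv
    have h2 : (∫ t in Set.Ioi (0 : ℝ), (deriv θ t * a t + θ t * N t)) =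
        ∫ t, (deriv θ t * a t + θ t * N t) := by
      refine setIntegral_eq_integral_of_forall_compl_eq_zero fun x hx => ?_
      have h3 : x ∉ tsupport θ := fun hm => hx (hθs hm)
      have h4 : x ∉ tsupport (deriv θ) := fun hm => h3 (tsupport_deriv_subset (𝕜 := ℝ) hm)
      rw [image_eq_zero_of_notMem_tsupport h3, image_eq_zero_of_notMem_tsupport h4]; ring
    have i1 : ∀ {g : ℝ → ℝ}, Continuous g → Integrable fun t => deriv θ t * g t := fun {g} hg =>
      (hθ'.mul hg).integrable_of_hasCompactSupport hcd.mul_right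
    have i2 : ∀ {g : ℝ → ℝ}, Continuous g → Integrable fun t => θ t * g t := fun {g} hg =>
      (hθ.continuous.mul hg).integrable_of_hasCompactSupport hθc.mul_right
    have h5 : ∫ t, θ t * N t = -∫ t, deriv θ t * I t :=
      integral_mul_deriv_eq_deriv_mul_of_integrable
        (fun x _ => ((hθ.differentiable (by simp)).differentiableAt).hasDerivAt)
        (fun x _ => hId x) (i2 hN) (i1 hI) (i2 hI)
    rw [h2, integral_add (i1 ha) (i2 hN), h5] at h1
    simp only [mul_sub]
    rw [integral_sub (i1 ha) (i1 hI)]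
    linarith
  have h1 := hA s hs
  have h2 := hA t ht
  have h3 : I t - I s = ∫ τ in s..t, N τ :=
    intervalIntegral.integral_interval_sub_left (hN.intervalIntegrable _ _)
      (hN.intervalIntegrable _ _)
  linarith

/-! ### Balance laws for weak evolutions in a Hilbert space -/

section Hilbert

variable {X : Type*} [NormedAddCommGroup X] [InnerProductSpace ℝ X]

/-- Because `F` is bounded on each half-line `t ≤ T`, approximating `φ` from `V` is locally uniform
in time. No strong continuity of `F` is assumed. -/
theorem continuous_inner_of_mem_closure {F : ℝ → X} {V : Submodule ℝ X}
    (hF : ∀ T, ∃ R, ∀ t ≤ T, ‖F t‖ ≤ R)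
    (hV : ∀ φ ∈ V, Continuous fun t => inner ℝ (F t) φ) {φ : X}
    (hφ : φ ∈ V.topologicalClosure) : Continuous fun t => inner ℝ (F t) φ := by
  refine continuous_of_locally_uniform_approx_of_continuousAt fun t u hu => ?_
  obtain ⟨ε, hε, hεu⟩ := Metric.mem_uniformity_dist.1 hu
  obtain ⟨R, hR⟩ := hF (t + 1)
  have hR0 : 0 ≤ R := (norm_nonneg _).trans (hR t (by linarith))
  obtain ⟨ψ, hψ, hd⟩ := Metric.mem_closure_iff.1 hφ (ε / (R + 1)) (by positivity)
  refine ⟨Set.Iic (t + 1), Iic_mem_nhds (by linarith), _, (hV ψ hψ).continuousAt,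
    fun τ hτ => hεu ?_⟩
  rw [Real.dist_eq, ← inner_sub_right]
  refine (abs_real_inner_le_norm _ _).trans_lt ?_
  rw [dist_eq_norm, lt_div_iff₀ (by positivity)] at hd
  nlinarith [hR τ hτ, norm_nonneg (φ - ψ), norm_nonneg (F τ)]

/-- Dominated convergence along a sequence in `V` enlarges the class of test vectors, so that the
solution itself becomes admissible. -/
theorem inner_sub_eq_integral_of_mem_closure {U F : ℝ → X} {V : Submodule ℝ X}
    (hF : ∀ T, ∃ R, ∀ t ≤ T, ‖F t‖ ≤ R)
    (hV : ∀ φ ∈ V, Continuous fun t => inner ℝ (F t) φ) {s t : ℝ}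
    (hVe : ∀ φ ∈ V, inner ℝ (U t) φ - inner ℝ (U s) φ = ∫ τ in s..t, inner ℝ (F τ) φ)
    {φ : X} (hφ : φ ∈ V.topologicalClosure) :
    inner ℝ (U t) φ - inner ℝ (U s) φ = ∫ τ in s..t, inner ℝ (F τ) φ := by
  obtain ⟨φn, hφn, hlim⟩ := mem_closure_iff_seq_limit.1 hφ
  obtain ⟨R, hR⟩ := hF (max s t)
  obtain ⟨M, hM⟩ := (hlim.norm).bddAbove_range
  have h1 : Tendsto (fun n => inner ℝ (U t) (φn n) - inner ℝ (U s) (φn n)) atTop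
      (𝓝 (inner ℝ (U t) φ - inner ℝ (U s) φ)) :=
    (tendsto_const_nhds.inner hlim).sub (tendsto_const_nhds.inner hlim)
  have h2 : Tendsto (fun n => ∫ τ in s..t, inner ℝ (F τ) (φn n)) atTop
      (𝓝 (∫ τ in s..t, inner ℝ (F τ) φ)) := by
    refine intervalIntegral.tendsto_integral_filter_of_dominated_convergence (fun _ => R * M)
      (Eventually.of_forall fun n => (hV _ (hφn n)).aestronglyMeasurable)
      (Eventually.of_forall fun n => Eventually.of_forall fun τ hτ => ?_)
      intervalIntegrable_const (Eventually.of_forall fun τ _ => tendsto_const_nhds.inner hlim)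
    have hτ' : τ ≤ max s t := hτ.2
    refine (norm_inner_le_norm _ _).trans ?_
    exact mul_le_mul (hR τ hτ') (hM ⟨n, rfl⟩) (norm_nonneg _) ((norm_nonneg _).trans (hR τ hτ'))
  refine tendsto_nhds_unique h1 (h2.congr fun n => (hVe _ (hφn n)).symm)

/-- The balance law of a quadratic functional along a weak solution. -/
theorem quadratic_sub_eq_integral {U F : ℝ → X} {V : Submodule ℝ X} (hU : Continuous U)
    (hF : ∀ T, ∃ R, ∀ t ≤ T, ‖F t‖ ≤ R)
    (hV : ∀ φ ∈ V, Continuous fun t => inner ℝ (F t) φ)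
    (hVe : ∀ φ ∈ V, ∀ s t, 0 ≤ s → 0 ≤ t →
      inner ℝ (U t) φ - inner ℝ (U s) φ = ∫ τ in s..t, inner ℝ (F τ) φ)
    (hUV : ∀ t, U t ∈ V.topologicalClosure) (A : X →L[ℝ] X)
    (hA : ∀ x y, inner ℝ (A x) y = inner ℝ x (A y)) (hAV : ∀ t, A (U t) ∈ V.topologicalClosure) :
    (Continuous fun t => inner ℝ (F t) (A (U t))) ∧
    ∀ s t, 0 ≤ s → s ≤ t → inner ℝ (U t) (A (U t)) - inner ℝ (U s) (A (U s)) =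
      ∫ τ in s..t, 2 * inner ℝ (F τ) (A (U τ)) := by
  have hc : ∀ φ ∈ V.topologicalClosure, Continuous fun t => inner ℝ (F t) φ :=
    fun φ hφ => continuous_inner_of_mem_closure hF hV hφ
  have he : ∀ φ ∈ V.topologicalClosure, ∀ s t, 0 ≤ s → 0 ≤ t →
      inner ℝ (U t) φ - inner ℝ (U s) φ = ∫ τ in s..t, inner ℝ (F τ) φ :=
    fun φ hφ s t hs ht => inner_sub_eq_integral_of_mem_closure hF hV
      (fun φ hφ => hVe φ hφ s t hs ht) hφ
  have hcont : Continuous fun t => inner ℝ (F t) (A (U t)) := by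
    rw [continuous_iff_continuousAt]
    intro t
    obtain ⟨R, hR⟩ := hF (t + 1)
    have h1 := (hc _ (hAV t)).tendsto t
    have h2 : Tendsto (fun τ => inner ℝ (F τ) (A (U τ) - A (U t))) (𝓝 t) (𝓝 0) := by
      refine squeeze_zero_norm' (a := fun τ => R * ‖A (U τ) - A (U t)‖) ?_ ?_
      · filter_upwards [Iic_mem_nhds (show t < t + 1 by linarith)] with τ hτ
        refine (norm_inner_le_norm _ _).trans ?_
        gcongr
        exact hR τ hτ
      · have h3 : Tendsto (fun τ => A (U τ) - A (U t)) (𝓝 t) (𝓝 0) := by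
          have := ((A.continuous.comp hU).tendsto t).sub_const (A (U t))
          simpa using this
        simpa using (h3.norm).const_mul R
    have h3 := h1.add h2
    rw [add_zero] at h3
    refine h3.congr fun τ => ?_
    rw [← inner_add_right, add_sub_cancel]
  refine ⟨hcont, fun s t hs hst => ?_⟩
  -- The increment `U t - U s` lies in the closure of `V`, and testing the equation with it gives a
  -- local Lipschitz bound.
  have hlip : ∀ T, ∃ R, 0 ≤ R ∧ ∀ s t, 0 ≤ s → 0 ≤ t → s ≤ T → t ≤ T →
      ‖U t - U s‖ ≤ R * |t - s| := by
    intro T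
    obtain ⟨R, hR⟩ := hF T
    refine ⟨max R 0, le_max_right _ _, fun s t hs ht hsT htT => ?_⟩
    have hm : U t - U s ∈ V.topologicalClosure := Submodule.sub_mem _ (hUV t) (hUV s)
    have h1 := he _ hm s t hs ht
    rw [← inner_sub_left, real_inner_self_eq_norm_sq] at h1
    have h2 : ‖∫ τ in s..t, inner ℝ (F τ) (U t - U s)‖ ≤ (max R 0 * ‖U t - U s‖) * |t - s| := by
      refine intervalIntegral.norm_integral_le_of_norm_le_const fun τ hτ => ?_
      refine (norm_inner_le_norm _ _).trans ?_
      gcongr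
      exact (hR τ (hτ.2.trans (max_le hsT htT))).trans (le_max_left _ _)
    rw [← h1, Real.norm_of_nonneg (sq_nonneg _)] at h2
    rcases (norm_nonneg (U t - U s)).eq_or_lt with h0 | h0
    · rw [← h0]; positivity
    · nlinarith
  refine (intervalIntegral.integral_eq_sub_of_hasDerivAt_of_le (E := ℝ)
    (f := fun t => inner ℝ (U t) (A (U t))) hst ?_ (fun t0 ht0 => ?_) ?_).symm
  · exact (hU.inner (A.continuous.comp hU)).continuousOn
  · have ht0p : 0 < t0 := hs.trans_lt ht0.1
    have hcφ := hc _ (hAV t0)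
    have hlin : HasDerivAt (fun τ => inner ℝ (U τ) (A (U t0))) (inner ℝ (F t0) (A (U t0))) t0 := by
      have h0 : HasDerivAt (fun τ => ∫ r in (0 : ℝ)..τ, inner ℝ (F r) (A (U t0)))
          (inner ℝ (F t0) (A (U t0))) t0 :=
        intervalIntegral.integral_hasDerivAt_right (hcφ.intervalIntegrable _ _)
          (hcφ.stronglyMeasurableAtFilter _ _) hcφ.continuousAt
      have h1 := h0.const_add (inner ℝ (U 0) (A (U t0)))
      refine h1.congr_of_eventuallyEq ?_
      filter_upwards [Ioi_mem_nhds ht0p] with τ hτ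
      rw [← he _ (hAV t0) 0 τ le_rfl (le_of_lt hτ)]; ring
    -- Since `A` is symmetric, the functional is `2⟨U τ, A (U t0)⟩` plus this term minus a constant.
    -- The Lipschitz bound makes this term quadratic in `τ - t0`, so only the linear part, governed
    -- by the weak equation, is differentiated.
    have hquad : HasDerivAt (fun τ => inner ℝ (U τ - U t0) (A (U τ - U t0))) 0 t0 := by
      obtain ⟨R, hR0, hR⟩ := hlip (t0 + 1)
      rw [hasDerivAt_iff_isLittleO]
      simp only [sub_self, map_zero, inner_zero_left, sub_zero, smul_zero]
      refine Asymptotics.IsBigO.trans_isLittleO (g := fun τ => (τ - t0) ^ 2) ?_ ?_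
      · refine Asymptotics.IsBigO.of_bound (‖A‖ * R ^ 2) ?_
        filter_upwards [Ioi_mem_nhds ht0p, Iio_mem_nhds (show t0 < t0 + 1 by linarith)] with τ h1 h2
        have h3 := hR t0 τ ht0p.le (le_of_lt h1) (by linarith) (le_of_lt h2)
        calc ‖inner ℝ (U τ - U t0) (A (U τ - U t0))‖ ≤ ‖U τ - U t0‖ * ‖A (U τ - U t0)‖ :=
              norm_inner_le_norm _ _
          _ ≤ ‖U τ - U t0‖ * (‖A‖ * ‖U τ - U t0‖) := by gcongr; exact A.le_opNorm _
          _ = ‖A‖ * ‖U τ - U t0‖ ^ 2 := by ring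
          _ ≤ ‖A‖ * (R * |τ - t0|) ^ 2 := by gcongr
          _ = ‖A‖ * R ^ 2 * ‖(τ - t0) ^ 2‖ := by
            rw [mul_pow, sq_abs, Real.norm_of_nonneg (sq_nonneg _)]; ring
      · have h1 : Tendsto (fun τ : ℝ => τ - t0) (𝓝 t0) (𝓝 0) := by
          have : Continuous fun τ : ℝ => τ - t0 := by fun_prop
          simpa using this.tendsto t0
        have h2 := (Asymptotics.isLittleO_pow_id (one_lt_two) (𝕜 := ℝ)).comp_tendsto h1
        exact h2
    have h2 := (hlin.const_mul 2).add hquad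
    rw [add_zero] at h2
    have h3 := h2.sub_const (inner ℝ (U t0) (A (U t0)))
    refine h3.congr_of_eventuallyEq (Eventually.of_forall fun τ => ?_)
    simp only [Pi.add_apply, map_sub, inner_sub_left, inner_sub_right]
    have h4 : inner ℝ (U t0) (A (U τ)) = inner ℝ (U τ) (A (U t0)) := by
      rw [← hA, real_inner_comm]
    rw [h4]; ring
  · exact (continuous_const.mul hcont).intervalIntegrable _ _

/-- A continuous functional that does not increase below a threshold stays below its initial
value. -/
theorem le_initial_of_threshold {E : ℝ → ℝ} {ε : ℝ} (hE : ContinuousOn E (Set.Ici 0))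
    (h0 : E 0 < ε)
    (h : ∀ s t, 0 ≤ s → s ≤ t → (∀ τ ∈ Set.Icc s t, E τ ≤ ε) → E t ≤ E s) :
    ∀ t, 0 ≤ t → E t ≤ E 0 := by
  intro T hT
  have hc : ContinuousOn E (Set.Icc 0 T) := hE.mono Set.Icc_subset_Ici_self
  have hsub : Set.Icc 0 T ⊆ {t | E t ≤ E 0} := by
    -- Continuity induction: where `E ≤ E 0 < ε`, the threshold still holds for a short while, and
    -- monotonicity below it propagates the bound.
    refine IsClosed.Icc_subset_of_forall_exists_gt ?_ (show E 0 ≤ E 0 from le_rfl) ?_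
    · rw [Set.inter_comm]
      exact hc.preimage_isClosed_of_isClosed isClosed_Icc isClosed_Iic
    · rintro x ⟨hx, hx0, hxT⟩ y hy
      have hlt : E x < ε := lt_of_le_of_lt hx h0
      have hev : ∀ᶠ τ in 𝓝[Set.Ici 0] x, E τ < ε :=
        (hE x hx0).eventually (gt_mem_nhds hlt)
      rw [eventually_nhdsWithin_iff, Metric.eventually_nhds_iff] at hev
      obtain ⟨r, hr, hball⟩ := hev
      have hy' : x < y := hy
      refine ⟨min y (x + r / 2), ?_, lt_min hy' (by linarith), min_le_left _ _⟩
      refine (h x _ hx0 (le_min hy'.le (by linarith)) fun τ hτ => ?_).trans hx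
      refine (hball ?_ (hx0.trans hτ.1)).le
      rw [Real.dist_eq, abs_of_nonneg (by linarith [hτ.1])]
      linarith [hτ.2.trans (min_le_right _ _)]
  exact hsub ⟨hT, le_rfl⟩

end Hilbert

end MHD

namespace MHD

/-! ### The evolution equations tested with curls -/

/-- Multiplication by a test function. -/
def IsTestFunction.mulL2 {ψ : Strip → ℝ} (h : IsTestFunction ψ) : L2Fun →L[ℝ] L2Fun :=
  (ContinuousLinearMap.mul ℝ ℝ).holderL volume ⊤ 2 2 ((h.memLp ⊤).toLp ψ)

theorem IsTestFunction.coeFn_mulL2 {ψ : Strip → ℝ} (h : IsTestFunction ψ) (f : L2Fun) :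
    h.mulL2 f =ᵐ[volume] fun z => ψ z * f z := by
  filter_upwards [(ContinuousLinearMap.mul ℝ ℝ).coeFn_holder (r := 2) ((h.memLp ⊤).toLp ψ) f,
    (h.memLp ⊤).coeFn_toLp] with z h1 h2
  rw [← h2]; exact h1

theorem IsTestFunction.inner_mulL2 {ψ : Strip → ℝ} (h : IsTestFunction ψ) (f g : L2Fun) :
    inner ℝ (h.mulL2 f) g = ∫ z, f z * g z * ψ z := by
  rw [inner_eq_integral]
  refine integral_congr_ae ?_
  filter_upwards [h.coeFn_mulL2 f] with z hz
  rw [hz]; ring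

theorem IsTestFunction.inner_mulL2_eq_tri {ψ : Strip → ℝ} (h : IsTestFunction ψ) (f g : L2Fun) :
    inner ℝ (h.mulL2 f) g = tri f g h.toL2 := by
  rw [h.inner_mulL2, tri]
  refine integral_congr_ae ?_
  filter_upwards [h.coeFn_toL2] with z hz
  rw [hz]

theorem IsTestFunction.integrable_mul_mul {ψ : Strip → ℝ} (h : IsTestFunction ψ) (f g : L2Fun) :
    Integrable fun z => f z * g z * ψ z := by
  refine ((Lp.memLp (h.mulL2 f)).integrable_mul (Lp.memLp g)).congr ?_
  filter_upwards [h.coeFn_mulL2 f] with z hz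
  rw [Pi.mul_apply, hz]; ring

theorem IsTestFunction.integrable_mul {ψ : Strip → ℝ} (h : IsTestFunction ψ) (f : L2Fun) :
    Integrable fun z => f z * ψ z := (Lp.memLp f).integrable_mul (h.memLp 2)

/-- The components of a vector field. -/
def crd (v : L2Field) (i : Fin 2) : L2Fun := coord i v

/-- The right-hand side of an evolution equation without pressure, in weak form. -/
def weakRhs (κ : ℝ) (u v b w : Fin 2 → L2Fun) (i : Fin 2) {ψ : Strip → ℝ}
    (h : IsTestFunction ψ) : ℝ :=
  inner ℝ ((h.cd 0).mulL2 (v i)) (u 0) + inner ℝ ((h.cd 1).mulL2 (v i)) (u 1) +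
    κ * inner ℝ (v i) ((h.cd 0).cd 0).toL2 -
      (inner ℝ ((h.cd 0).mulL2 (w i)) (b 0) + inner ℝ ((h.cd 1).mulL2 (w i)) (b 1))

/-- The weak form makes sense for `L²` fields and is continuous in time; the strong form permits
energy estimates. They agree by skewness of solenoidal transport and integration by parts. -/
theorem weakRhs_eq_inner_rhs {κ : ℝ} {u v b w : Fin 2 → L2Fun} (hu : IsSolenoidalH2 u)
    (hb : IsSolenoidalH2 b) (hv : ∀ i, IsH2 (v i)) (hw : ∀ i, IsH2 (w i)) (i : Fin 2)
    {ψ : Strip → ℝ} (h : IsTestFunction ψ) :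
    weakRhs κ u v b w i h = inner ℝ (rhs κ u v b w i) h.toL2 := by
  have key : ∀ {f : Fin 2 → L2Fun} {g : L2Fun}, IsSolenoidalH2 f → IsH2 g →
      inner ℝ ((h.cd 0).mulL2 g) (f 0) + inner ℝ ((h.cd 1).mulL2 g) (f 1) =
        -inner ℝ (advect f g) h.toL2 := fun {f g} hf hg => by
    rw [inner_advect hf hg, tri_transport (hf.isH2 0).isH1 (hf.isH2 1).isH1 hg.isH1 h.isH1 hf.div,
      (h.cd 0).inner_mulL2_eq_tri, (h.cd 1).inner_mulL2_eq_tri, h.pd_toL2, h.pd_toL2, neg_neg,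
      tri_comm_left g, tri_comm_left g, tri_comm_right (f 0), tri_comm_right (f 1)]
  rw [weakRhs, key hu (hv i), key hb (hw i), rhs, inner_add_left, inner_sub_left,
    real_inner_smul_left, inner_pd_zero_pd_zero (hv i) h.isH1, h.pd_toL2,
    ((hv i).isH1 0).inner_left ((h.cd 0).hasPD 0)]
  ring

theorem continuous_weakRhs {κ : ℝ} {u v b w : ℝ → L2Field} (hu : Continuous u) (hv : Continuous v)
    (hb : Continuous b) (hw : Continuous w) (i : Fin 2) {ψ : Strip → ℝ} (h : IsTestFunction ψ) :
    Continuous fun t => weakRhs κ (crd (u t)) (crd (v t)) (crd (b t)) (crd (w t)) i h := by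
  unfold weakRhs crd
  fun_prop

/-- The weak form of `∂ₜv + u · ∇v - κ∂₁²v + ∇p = b · ∇w`. -/
def WeakEvolution (κ : ℝ) (u v b w : ℝ → L2Field) (p : ℝ → Strip → ℝ) : Prop :=
  ∀ φ : ℝ → Strip → ℝ, IsSpaceTimeTestFunction φ → ∀ i : Fin 2,
    ∫ t in Set.Ioi (0 : ℝ), ∫ z : Strip,
      (v t z i * deriv (fun τ => φ τ z) t
        + v t z i * (u t z 0 * d1 (φ t) z + u t z 1 * d2 (φ t) z)
        + κ * (v t z i * d1 (d1 (φ t)) z)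
        + p t z * (if i = 0 then d1 (φ t) z else d2 (φ t) z)
        - w t z i * (b t z 0 * d1 (φ t) z + b t z 1 * d2 (φ t) z)) = 0

theorem isSpaceTimeTestFunction_mul {θ : ℝ → ℝ} (hθ : ContDiff ℝ ∞ θ) (hθc : HasCompactSupport θ)
    (hθs : tsupport θ ⊆ Set.Ioi 0) {ψ : Strip → ℝ} (hψ : IsTestFunction ψ) :
    IsSpaceTimeTestFunction fun t z => θ t * ψ z where
  smooth := (hθ.comp contDiff_fst).mul (hψ.contDiff_lift.comp contDiff_snd)
  compactSupport := by
    refine HasCompactSupport.intro (hθc.isCompact.prod hψ.compactSupport.isCompact) fun q hq => ?_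
    by_cases h1 : q.1 ∈ tsupport θ
    · have h2 : q.2 ∉ tsupport ψ := fun h2 => hq ⟨h1, h2⟩
      rw [image_eq_zero_of_notMem_tsupport h2, mul_zero]
    · rw [image_eq_zero_of_notMem_tsupport h1, zero_mul]
  support_subset := by
    have h1 : tsupport (fun q : ℝ × Strip => θ q.1 * ψ q.2) ⊆ tsupport θ ×ˢ Set.univ := by
      refine closure_minimal (fun q hq => ⟨?_, trivial⟩)
        ((isClosed_tsupport θ).prod isClosed_univ)
      exact subset_tsupport θ (left_ne_zero_of_mul hq)
    exact h1.trans (Set.prod_mono hθs subset_rfl)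

theorem d1_const_mul (c : ℝ) (ψ : Strip → ℝ) : d1 (fun z => c * ψ z) = fun z => c * d1 ψ z := by
  ext z; exact deriv_const_mul_field c

theorem d2_const_mul (c : ℝ) (ψ : Strip → ℝ) : d2 (fun z => c * ψ z) = fun z => c * d2 ψ z := by
  ext z; exact deriv_const_mul_field c

theorem integral_linear_combination {α : Type*} [MeasurableSpace α] {μ : Measure α} (κ c c' : ℝ)
    {f₀ f₁ f₂ f₃ f₄ f₅ f₆ : α → ℝ} (h₀ : Integrable f₀ μ) (h₁ : Integrable f₁ μ)
    (h₂ : Integrable f₂ μ) (h₃ : Integrable f₃ μ) (h₄ : Integrable f₄ μ) (h₅ : Integrable f₅ μ)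
    (h₆ : Integrable f₆ μ) :
    c' * ∫ z, f₀ z ∂μ + c * (∫ z, f₁ z ∂μ + ∫ z, f₂ z ∂μ + κ * ∫ z, f₃ z ∂μ -
        (∫ z, f₄ z ∂μ + ∫ z, f₅ z ∂μ)) + ∫ z, f₆ z ∂μ =
      ∫ z, (c' * f₀ z + c * (f₁ z + f₂ z + κ * f₃ z - (f₄ z + f₅ z)) + f₆ z) ∂μ := by
  have h₁₂ : Integrable (fun z => f₁ z + f₂ z) μ := h₁.add h₂
  have h₁₃ : Integrable (fun z => f₁ z + f₂ z + κ * f₃ z) μ := h₁₂.add (h₃.const_mul κ)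
  have h₄₅ : Integrable (fun z => f₄ z + f₅ z) μ := h₄.add h₅
  have h₁₅ : Integrable (fun z => c * (f₁ z + f₂ z + κ * f₃ z - (f₄ z + f₅ z))) μ :=
    (h₁₃.sub h₄₅).const_mul c
  have h₀₅ : Integrable
      (fun z => c' * f₀ z + c * (f₁ z + f₂ z + κ * f₃ z - (f₄ z + f₅ z))) μ :=
    (h₀.const_mul c').add h₁₅
  rw [integral_add h₀₅ h₆, integral_add (h₀.const_mul c') h₁₅, integral_const_mul,
    integral_const_mul, integral_sub h₁₃ h₄₅, integral_add h₁₂ (h₃.const_mul κ),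
    integral_add h₁ h₂, integral_add h₄ h₅, integral_const_mul]

/-- At a fixed time with test function `θ(t)ψ`, the numbers `c` and `c'` stand for `θ(t)` and
`θ'(t)`. The factor `c` is kept in the integrability hypothesis because Fubini gives only the
weighted pressure. -/
theorem integral_weak_slice (κ c c' : ℝ) (u v b w : L2Field) (i : Fin 2) {ψ q : Strip → ℝ}
    (hψ : IsTestFunction ψ) (hq : Integrable fun z => c * (q z * cd i ψ z)) :
    ∫ z : Strip, (v z i * (c' * ψ z)
        + v z i * (u z 0 * (c * d1 ψ z) + u z 1 * (c * d2 ψ z))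
        + κ * (v z i * (c * d1 (d1 ψ) z))
        + q z * (if i = 0 then c * d1 ψ z else c * d2 ψ z)
        - w z i * (b z 0 * (c * d1 ψ z) + b z 1 * (c * d2 ψ z))) =
      (c' * inner ℝ (coord i v) hψ.toL2 + c * weakRhs κ (crd u) (crd v) (crd b) (crd w) i hψ) +
        ∫ z, c * (q z * cd i ψ z) := by
  rw [weakRhs, hψ.inner_toL2, IsTestFunction.inner_mulL2, IsTestFunction.inner_mulL2,
    IsTestFunction.inner_mulL2, IsTestFunction.inner_mulL2, IsTestFunction.inner_toL2]
  simp only [crd]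
  have i0 := hψ.integrable_mul (coord i v)
  have i1 := (hψ.cd 0).integrable_mul_mul (coord i v) (coord 0 u)
  have i2 := (hψ.cd 1).integrable_mul_mul (coord i v) (coord 1 u)
  have i3 := ((hψ.cd 0).cd 0).integrable_mul (coord i v)
  have i4 := (hψ.cd 0).integrable_mul_mul (coord i w) (coord 0 b)
  have i5 := (hψ.cd 1).integrable_mul_mul (coord i w) (coord 1 b)
  rw [integral_linear_combination κ c c' i0 i1 i2 i3 i4 i5 hq]
  refine integral_congr_ae ?_
  filter_upwards [coeFn_coord i v, coeFn_coord i w, coeFn_coord 0 u, coeFn_coord 1 u,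
    coeFn_coord 0 b, coeFn_coord 1 b] with z h1 h2 h3 h4 h5 h6
  have e0 : cd 0 ψ = d1 ψ := rfl
  have e1 : cd 1 ψ = d2 ψ := rfl
  have e2 : cd 0 (d1 ψ) = d1 (d1 ψ) := rfl
  have e3 : (if i = 0 then c * d1 ψ z else c * d2 ψ z) = c * cd i ψ z := by
    unfold cd; split <;> rfl
  simp only [h1, h2, h3, h4, h5, h6, e0, e1, e2, e3]
  ring

/-- The supports of `θ` and `ψ` span a compact subset of the open time domain, where local
integrability applies. -/
theorem integrable_pressure_mul {p : ℝ → Strip → ℝ}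
    (hp : LocallyIntegrableOn (fun q : ℝ × Strip => p q.1 q.2) (Set.Ioi (0 : ℝ) ×ˢ Set.univ))
    {θ : ℝ → ℝ} (hθ : Continuous θ) (hθc : HasCompactSupport θ) (hθs : tsupport θ ⊆ Set.Ioi 0)
    {ψ : Strip → ℝ} (hψ : IsTestFunction ψ) :
    Integrable fun q : ℝ × Strip => θ q.1 * (p q.1 q.2 * ψ q.2) := by
  set K : Set (ℝ × Strip) := tsupport θ ×ˢ tsupport ψ with hK
  have hKc : IsCompact K := hθc.isCompact.prod hψ.compactSupport.isCompact
  have h1 : IntegrableOn (fun q : ℝ × Strip => p q.1 q.2) K :=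
    hp.integrableOn_compact_subset (Set.prod_mono hθs (Set.subset_univ _)) hKc
  have h2 : IntegrableOn (fun q : ℝ × Strip => (θ q.1 * ψ q.2) * p q.1 q.2) K :=
    h1.continuousOn_mul ((hθ.comp continuous_fst).mul
      (hψ.continuous.comp continuous_snd)).continuousOn hKc
  have h3 : Function.support (fun q : ℝ × Strip => (θ q.1 * ψ q.2) * p q.1 q.2) ⊆ K := by
    intro q hq
    have h4 := left_ne_zero_of_mul hq
    exact ⟨subset_tsupport θ (left_ne_zero_of_mul h4), subset_tsupport ψ (right_ne_zero_of_mul h4)⟩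
  refine ((integrableOn_iff_integrable_of_support_subset h3).1 h2).congr
    (Eventually.of_forall fun q => ?_)
  simp only; ring

section

variable {κ : ℝ} {u v b w : ℝ → L2Field} {p : ℝ → Strip → ℝ}

/-- Testing with the product `θ(t)ψ(z)` isolates the pressure as one term, to be cancelled between
the two components. -/
theorem WeakEvolution.integral_component (hw : WeakEvolution κ u v b w p)
    (hp : LocallyIntegrableOn (fun q : ℝ × Strip => p q.1 q.2) (Set.Ioi (0 : ℝ) ×ˢ Set.univ))
    (hcu : Continuous u) (hcv : Continuous v) (hcb : Continuous b) (hcw : Continuous w)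
    {θ : ℝ → ℝ} (hθ : ContDiff ℝ ∞ θ) (hθc : HasCompactSupport θ) (hθs : tsupport θ ⊆ Set.Ioi 0)
    {ψ : Strip → ℝ} (hψ : IsTestFunction ψ) (i : Fin 2) :
    (Integrable fun t => deriv θ t * inner ℝ (coord i (v t)) hψ.toL2 +
      θ t * weakRhs κ (crd (u t)) (crd (v t)) (crd (b t)) (crd (w t)) i hψ) ∧
    ∫ t in Set.Ioi (0 : ℝ), (deriv θ t * inner ℝ (coord i (v t)) hψ.toL2 +
      θ t * weakRhs κ (crd (u t)) (crd (v t)) (crd (b t)) (crd (w t)) i hψ) =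
      -∫ t in Set.Ioi (0 : ℝ), ∫ z, θ t * (p t z * cd i ψ z) := by
  have hP := integrable_pressure_mul hp hθ.continuous hθc hθs (hψ.cd i)
  have hint : Integrable fun t => deriv θ t * inner ℝ (coord i (v t)) hψ.toL2 +
      θ t * weakRhs κ (crd (u t)) (crd (v t)) (crd (b t)) (crd (w t)) i hψ := by
    refine Integrable.add ?_ ?_
    · have hd : Continuous (deriv θ) := hθ.continuous_deriv (by simp)
      exact (hd.mul (by fun_prop)).integrable_of_hasCompactSupport hθc.deriv.mul_right
    · exact (hθ.continuous.mul
        (continuous_weakRhs hcu hcv hcb hcw i hψ)).integrable_of_hasCompactSupport hθc.mul_right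
  refine ⟨hint, ?_⟩
  have h0 := hw _ (isSpaceTimeTestFunction_mul hθ hθc hθs hψ) i
  have hP1 : Integrable fun t => ∫ z, θ t * (p t z * cd i ψ z) :=
    Integrable.integral_prod_left (μ := (volume : Measure ℝ)) (ν := (volume : Measure Strip)) hP
  have hP2 : ∀ᵐ t, Integrable fun z => θ t * (p t z * cd i ψ z) :=
    Integrable.prod_right_ae (μ := (volume : Measure ℝ)) (ν := (volume : Measure Strip)) hP
  rw [eq_neg_iff_add_eq_zero, ← integral_add hint.integrableOn hP1.integrableOn]
  refine (integral_congr_ae ?_).trans h0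
  filter_upwards [ae_restrict_of_ae hP2] with t ht
  rw [← integral_weak_slice κ (θ t) (deriv θ t) (u t) (v t) (b t) (w t) i hψ ht]
  simp only [d1_const_mul, d2_const_mul, deriv_mul_const_field]

/-- The evolution of the pairing with the curl of a test function, which the pressure does not
enter. -/
theorem WeakEvolution.inner_curl (hw : WeakEvolution κ u v b w p)
    (hp : LocallyIntegrableOn (fun q : ℝ × Strip => p q.1 q.2) (Set.Ioi (0 : ℝ) ×ˢ Set.univ))
    (hcu : Continuous u) (hcv : Continuous v) (hcb : Continuous b) (hcw : Continuous w)
    (hu : ∀ t, IsSolenoidalH2 (crd (u t))) (hb : ∀ t, IsSolenoidalH2 (crd (b t)))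
    (hv2 : ∀ t i, IsH2 (crd (v t) i)) (hw2 : ∀ t i, IsH2 (crd (w t) i))
    {F : ℝ → L2Field}
    (hF : ∀ t i, coord i (F t) = rhs κ (crd (u t)) (crd (v t)) (crd (b t)) (crd (w t)) i)
    {φ : L2Field} (hφ : φ ∈ curlSpan) :
    (Continuous fun t => inner ℝ (F t) φ) ∧ ∀ s t, 0 ≤ s → 0 ≤ t →
      inner ℝ (v t) φ - inner ℝ (v s) φ = ∫ τ in s..t, inner ℝ (F τ) φ := by
  have hcurl : ∀ {ψ : Strip → ℝ} (hψ : IsTestFunction ψ),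
      (Continuous fun t => inner ℝ (F t) (curl hψ)) ∧ ∀ s t, 0 ≤ s → 0 ≤ t →
        inner ℝ (v t) (curl hψ) - inner ℝ (v s) (curl hψ) =
          ∫ τ in s..t, inner ℝ (F τ) (curl hψ) := by
    intro ψ hψ
    have hFe : ∀ t, inner ℝ (F t) (curl hψ) =
        weakRhs κ (crd (u t)) (crd (v t)) (crd (b t)) (crd (w t)) 0 (hψ.cd 1) -
        weakRhs κ (crd (u t)) (crd (v t)) (crd (b t)) (crd (w t)) 1 (hψ.cd 0) := fun t => by
      rw [inner_l2Field, coord_zero_curl, coord_one_curl, inner_neg_right, hF, hF,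
        weakRhs_eq_inner_rhs (hu t) (hb t) (hv2 t) (hw2 t),
        weakRhs_eq_inner_rhs (hu t) (hb t) (hv2 t) (hw2 t), sub_eq_add_neg]
    have hFc : Continuous fun t => inner ℝ (F t) (curl hψ) := by
      simp only [hFe]
      exact (continuous_weakRhs hcu hcv hcb hcw 0 (hψ.cd 1)).sub
        (continuous_weakRhs hcu hcv hcb hcw 1 (hψ.cd 0))
    refine ⟨hFc, fun s t hs ht => ?_⟩
    refine sub_eq_integral_of_weak (hcv.inner continuous_const) hFc (fun θ hθ hθc hθs => ?_) hs ht
    obtain ⟨j0, e0⟩ := hw.integral_component hp hcu hcv hcb hcw hθ hθc hθs (hψ.cd 1) 0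
    obtain ⟨j1, e1⟩ := hw.integral_component hp hcu hcv hcb hcw hθ hθc hθs (hψ.cd 0) 1
    -- Component zero is tested with `∂₂ψ` and component one with `∂₁ψ`; since `∂₁∂₂ψ = ∂₂∂₁ψ`, the
    -- pressure terms coincide and drop out of the difference.
    rw [hψ.cd_comm 1 0, ← e0] at e1
    rw [← sub_eq_zero, ← integral_sub j1.integrableOn j0.integrableOn, ← neg_eq_zero,
      ← integral_neg] at e1
    refine (integral_congr_ae (Eventually.of_forall fun t => ?_)).trans e1
    simp only [hFe, inner_l2Field (v t), coord_zero_curl, coord_one_curl, inner_neg_right]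
    ring
  induction hφ using Submodule.span_induction with
  | mem x hx =>
    obtain ⟨ψ, hψ, rfl⟩ := hx
    exact hcurl hψ
  | zero => simp [continuous_const]
  | add x y _ _ hx hy =>
    simp only [inner_add_right]
    refine ⟨hx.1.add hy.1, fun s t hs ht => ?_⟩
    rw [intervalIntegral.integral_add (hx.1.intervalIntegrable _ _) (hy.1.intervalIntegrable _ _),
      ← hx.2 s t hs ht, ← hy.2 s t hs ht]
    ring
  | smul c x _ hx =>
    simp only [real_inner_smul_right]
    refine ⟨continuous_const.mul hx.1, fun s t hs ht => ?_⟩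
    rw [intervalIntegral.integral_const_mul, ← hx.2 s t hs ht]
    ring

end

end MHD

namespace MHD

/-! ### Solutions as flows of solenoidal fields -/

/-- A common bound for the derivatives of order at most two. -/
structure H2Bound (f : L2Fun) (M : ℝ) : Prop where
  norm_le : ‖f‖ ≤ M
  norm_pd_le : ∀ i, ‖pd i f‖ ≤ M
  norm_pd_pd_le : ∀ i j, ‖pd i (pd j f)‖ ≤ M

theorem norm_advect_le {f : Fin 2 → L2Fun} {φ : L2Fun} {M : ℝ} (hf : IsSolenoidalH2 f)
    (hφ : IsH2 φ) (hfM : ∀ i, H2Bound (f i) M) (hφM : H2Bound φ M) :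
    ‖advect f φ‖ ≤ 16 * M ^ 2 := by
  have hM : 0 ≤ M := (norm_nonneg _).trans hφM.norm_le
  have key : ∀ i, ‖prodL2 (f i) (pd i φ)‖ ≤ 2 * (M + M) * (M + M) := fun i => by
    refine ((hf.isH2 i).isH1.norm_prodL2_le (hφ.isH1_pd i)).trans ?_
    gcongr
    · exact (hfM i).norm_le
    · exact (hfM i).norm_pd_le 0
    · exact hφM.norm_pd_le i
    · exact hφM.norm_pd_pd_le 1 i
  refine (norm_add_le _ _).trans ((add_le_add (key 0) (key 1)).trans (le_of_eq ?_))
  ring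

theorem norm_rhs_le {κ : ℝ} {u v b w : Fin 2 → L2Fun} {M : ℝ} (hu : IsSolenoidalH2 u)
    (hb : IsSolenoidalH2 b) (hv : ∀ i, IsH2 (v i)) (hw : ∀ i, IsH2 (w i))
    (huM : ∀ i, H2Bound (u i) M) (hbM : ∀ i, H2Bound (b i) M) (hvM : ∀ i, H2Bound (v i) M)
    (hwM : ∀ i, H2Bound (w i) M) (i : Fin 2) :
    ‖rhs κ u v b w i‖ ≤ 32 * M ^ 2 + |κ| * M := by
  have h1 := norm_advect_le hb (hw i) hbM (hwM i)
  have h2 := norm_advect_le hu (hv i) huM (hvM i)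
  have h3 : ‖κ • pd 0 (pd 0 (v i))‖ ≤ |κ| * M := by
    rw [norm_smul, Real.norm_eq_abs]
    gcongr
    exact (hvM i).norm_pd_pd_le 0 0
  have h4 := norm_add_le (advect b (w i) - advect u (v i)) (κ • pd 0 (pd 0 (v i)))
  have h5 := norm_sub_le (advect b (w i)) (advect u (v i))
  rw [rhs]
  linarith

/-- The integrated vorticity form of an evolution equation with right-hand side `F`. -/
def SolvesAgainstCurls (v F : ℝ → L2Field) : Prop :=
  ∀ φ ∈ curlSpan, (Continuous fun t => inner ℝ (F t) φ) ∧ ∀ s t, 0 ≤ s → 0 ≤ t →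
    inner ℝ (v t) φ - inner ℝ (v s) φ = ∫ τ in s..t, inner ℝ (F τ) φ

/-- A solution of the system, extended to negative times by a constant. -/
structure IsFlow (ν η : ℝ) (u b : ℝ → L2Field) : Prop where
  continuous_u : Continuous u
  continuous_b : Continuous b
  solenoidal_u : ∀ t, IsSolenoidalH2 (crd (u t))
  solenoidal_b : ∀ t, IsSolenoidalH2 (crd (b t))
  bound : ∀ T, ∃ M, ∀ t ≤ T, ∀ i, H2Bound (crd (u t) i) M ∧ H2Bound (crd (b t) i) M
  solves_u : SolvesAgainstCurls u
    fun t => ofCoords (rhs ν (crd (u t)) (crd (u t)) (crd (b t)) (crd (b t)))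
  solves_b : SolvesAgainstCurls b
    fun t => ofCoords (rhs η (crd (u t)) (crd (b t)) (crd (b t)) (crd (u t)))

theorem isSolenoidalH2_crd {s : ℝ} (hs : 2 ≤ s) {v : L2Field} {M : ℝ≥0}
    (h : fieldSobolevNormSq s v ≤ M) (hv : IsDivergenceFree v) : IsSolenoidalH2 (crd v) where
  isH2 i := (isH2_coord hs h i).1
  div := hv.pd_add_pd fun i => (isH2_coord hs h i).1.isH1

theorem h2Bound_crd {s : ℝ} (hs : 2 ≤ s) {v : L2Field} {M : ℝ≥0}
    (h : fieldSobolevNormSq s v ≤ M) {N : ℝ} (hN : ‖v‖ ≤ N) (i : Fin 2) :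
    H2Bound (crd v i) (N + (M + 1)) := by
  obtain ⟨-, h1, h2⟩ := isH2_coord hs h i
  have hN0 : 0 ≤ N := (norm_nonneg _).trans hN
  have hM : (0 : ℝ) ≤ M := M.2
  -- Sobolev bounds control squares; `x² ≤ M` implies `x ≤ M + 1`, which avoids a square root.
  have key : ∀ {x : ℝ}, x ^ 2 ≤ M → x ≤ N + (M + 1) := fun {x} hx => by nlinarith
  exact ⟨(norm_coord_le v i).trans (by linarith), fun j => key (h1 j), fun j k => key (h2 j k)⟩

theorem WeakEvolution.congr {κ : ℝ} {u v b w u' v' b' w' : ℝ → L2Field} {p : ℝ → Strip → ℝ}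
    (h : WeakEvolution κ u v b w p) (hu : ∀ t, 0 ≤ t → u' t = u t) (hv : ∀ t, 0 ≤ t → v' t = v t)
    (hb : ∀ t, 0 ≤ t → b' t = b t) (hw : ∀ t, 0 ≤ t → w' t = w t) :
    WeakEvolution κ u' v' b' w' p := fun φ hφ i => by
  refine (setIntegral_congr_fun measurableSet_Ioi fun t ht => ?_).trans (h φ hφ i)
  have ht' : (0 : ℝ) ≤ t := le_of_lt ht
  simp only [hu t ht', hv t ht', hb t ht', hw t ht']

/-- Freezing the fields at their initial values for negative times makes them continuous on the
whole line. The equations concern only positive times and are unaffected. -/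
theorem IsGlobalSolution.isFlow {ν η s : ℝ} {u₀ b₀ : L2Field} {u b : ℝ → L2Field}
    (h : IsGlobalSolution ν η s u₀ b₀ u b) (hs : 2 ≤ s) :
    IsFlow ν η (fun t => u (max 0 t)) fun t => b (max 0 t) := by
  have hmax : Continuous fun t : ℝ => max 0 t := by fun_prop
  have hcu : Continuous fun t => u (max 0 t) :=
    h.continuousOn_u.comp_continuous hmax fun t => le_max_left 0 t
  have hcb : Continuous fun t => b (max 0 t) :=
    h.continuousOn_b.comp_continuous hmax fun t => le_max_left 0 t
  have hext : ∀ (f : ℝ → L2Field) (t : ℝ), 0 ≤ t → f (max 0 t) = f t := fun f t ht => by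
    rw [max_eq_right ht]
  have hmem : ∀ {t T : ℝ}, t ≤ T → max 0 t ∈ Set.Icc 0 (max 0 T) := fun hT =>
    ⟨le_max_left _ _, max_le_max le_rfl hT⟩
  have hsu : ∀ t, IsSolenoidalH2 (crd (u (max 0 t))) := fun t => by
    obtain ⟨M, hM⟩ := h.sobolev_bound (max 0 t)
    exact isSolenoidalH2_crd hs (hM _ (hmem le_rfl)).1 (h.divFree_u _ (le_max_left _ _))
  have hsb : ∀ t, IsSolenoidalH2 (crd (b (max 0 t))) := fun t => by
    obtain ⟨M, hM⟩ := h.sobolev_bound (max 0 t)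
    exact isSolenoidalH2_crd hs (hM _ (hmem le_rfl)).2 (h.divFree_b _ (le_max_left _ _))
  refine ⟨hcu, hcb, hsu, hsb, fun T => ?_, fun φ hφ => ?_, fun φ hφ => ?_⟩
  · obtain ⟨M, hM⟩ := h.sobolev_bound (max 0 T)
    obtain ⟨N, hN⟩ := (isCompact_Icc (a := 0) (b := max 0 T)).exists_bound_of_continuousOn
      (h.continuousOn_u.mono Set.Icc_subset_Ici_self)
    obtain ⟨N', hN'⟩ := (isCompact_Icc (a := 0) (b := max 0 T)).exists_bound_of_continuousOn
      (h.continuousOn_b.mono Set.Icc_subset_Ici_self)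
    refine ⟨max N N' + (M + 1), fun t ht i => ⟨?_, ?_⟩⟩
    · exact h2Bound_crd hs (hM _ (hmem ht)).1 ((hN _ (hmem ht)).trans (le_max_left _ _)) i
    · exact h2Bound_crd hs (hM _ (hmem ht)).2 ((hN' _ (hmem ht)).trans (le_max_right _ _)) i
  · obtain ⟨p, hp, hmom⟩ := h.momentum
    have hw : WeakEvolution ν u u b b p := hmom
    exact (hw.congr (hext u) (hext u) (hext b) (hext b)).inner_curl hp hcu hcu hcb hcb hsu hsb
      (fun t i => (hsu t).isH2 i) (fun t i => (hsb t).isH2 i) (fun t i => coord_ofCoords _ i) hφ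
  -- The induction equation is the common evolution equation with zero pressure and the roles of the
  -- transported fields exchanged.
  · have hw : WeakEvolution η u b b u 0 := fun φ hφ i => by
      simpa using h.induction φ hφ i
    exact (hw.congr (hext u) (hext b) (hext b) (hext u)).inner_curl
      (continuous_const.locallyIntegrable.locallyIntegrableOn _) hcu hcb hcb hcu hsu hsb
      (fun t i => (hsb t).isH2 i) (fun t i => (hsu t).isH2 i) (fun t i => coord_ofCoords _ i) hφ

/-! ### Balance laws for quadratic functionals -/

/-- The quadratic functional `⟨u, A u⟩ + ⟨b, A b⟩`. -/
def quad (A : L2Fun → L2Fun) (u b : Fin 2 → L2Fun) : ℝ :=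
  ∑ i, (inner ℝ (u i) (A (u i)) + inner ℝ (b i) (A (b i)))

/-- Half of the time derivative of the quadratic functional of `A` along the flow. -/
def flux (ν η : ℝ) (A : L2Fun → L2Fun) (u b : Fin 2 → L2Fun) : ℝ :=
  ∑ i, (inner ℝ (rhs ν u u b b i) (A (u i)) + inner ℝ (rhs η u b b u i) (A (b i)))

theorem inner_mapField_comm {A : L2Fun →L[ℝ] L2Fun}
    (hA : ∀ x y, inner ℝ (A x) y = inner ℝ x (A y)) (v w : L2Field) :
    inner ℝ (mapField A v) w = inner ℝ v (mapField A w) := by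
  simp only [inner_l2Field, coord_mapField, hA]

/-- Acting componentwise, a translation-invariant operator preserves vanishing divergence, so `A u`
is an admissible test vector. -/
theorem mapField_mem_closure_curlSpan {A : L2Fun →L[ℝ] L2Fun}
    (hA : ∀ a g, A (shift a g) = shift a (A g)) {v : L2Field} (hv : IsSolenoidalH2 (crd v)) :
    mapField A v ∈ curlSpan.topologicalClosure := by
  refine mem_closure_curlSpan (fun i => ?_) ?_
  · rw [coord_mapField]; exact (hv.isH2 i).isH1.map hA
  · rw [coord_mapField, coord_mapField, pd_map hA (f := coord 0 v) (hv.isH2 0).isH1,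
      pd_map hA (f := coord 1 v) (hv.isH2 1).isH1,
      ← map_add]
    have := hv.div
    simp only [crd] at this
    rw [this, map_zero]

theorem IsSolenoidalH2.mem_closure_curlSpan {v : L2Field} (hv : IsSolenoidalH2 (crd v)) :
    v ∈ curlSpan.topologicalClosure :=
  MHD.mem_closure_curlSpan (fun i => (hv.isH2 i).isH1) hv.div

namespace IsFlow

variable {ν η : ℝ} {u b : ℝ → L2Field}

theorem exists_norm_rhs_le (h : IsFlow ν η u b) (T : ℝ) : ∃ R, ∀ t ≤ T, ∀ i,
    ‖rhs ν (crd (u t)) (crd (u t)) (crd (b t)) (crd (b t)) i‖ ≤ R ∧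
    ‖rhs η (crd (u t)) (crd (b t)) (crd (b t)) (crd (u t)) i‖ ≤ R := by
  obtain ⟨M, hM⟩ := h.bound T
  refine ⟨max (32 * M ^ 2 + |ν| * M) (32 * M ^ 2 + |η| * M), fun t ht i => ⟨?_, ?_⟩⟩
  · exact (norm_rhs_le (h.solenoidal_u t) (h.solenoidal_b t) (h.solenoidal_u t).isH2
      (h.solenoidal_b t).isH2 (fun i => (hM t ht i).1) (fun i => (hM t ht i).2)
      (fun i => (hM t ht i).1) (fun i => (hM t ht i).2) i).trans (le_max_left _ _)
  · exact (norm_rhs_le (h.solenoidal_u t) (h.solenoidal_b t) (h.solenoidal_b t).isH2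
      (h.solenoidal_u t).isH2 (fun i => (hM t ht i).1) (fun i => (hM t ht i).2)
      (fun i => (hM t ht i).2) (fun i => (hM t ht i).1) i).trans (le_max_right _ _)

theorem norm_ofCoords_le {f : Fin 2 → L2Fun} {R : ℝ} (hf : ∀ i, ‖f i‖ ≤ R) :
    ‖ofCoords f‖ ≤ R + R := by
  have h1 := norm_sq_l2Field (ofCoords f)
  rw [coord_ofCoords, coord_ofCoords] at h1
  have h2 : ‖ofCoords f‖ ≤ ‖f 0‖ + ‖f 1‖ := by
    refine (sq_le_sq₀ (norm_nonneg _) (by positivity)).1 ?_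
    nlinarith [norm_nonneg (f 0), norm_nonneg (f 1)]
  linarith [hf 0, hf 1]

theorem balance (h : IsFlow ν η u b) {A : L2Fun →L[ℝ] L2Fun}
    (hA : ∀ x y, inner ℝ (A x) y = inner ℝ x (A y))
    (hAs : ∀ a g, A (shift a g) = shift a (A g)) :
    (Continuous fun t => flux ν η A (crd (u t)) (crd (b t))) ∧ ∀ s t, 0 ≤ s → s ≤ t →
      quad A (crd (u t)) (crd (b t)) - quad A (crd (u s)) (crd (b s)) =
        ∫ τ in s..t, 2 * flux ν η A (crd (u τ)) (crd (b τ)) := by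
  obtain ⟨c1, e1⟩ := quadratic_sub_eq_integral h.continuous_u
    (F := fun t => ofCoords (rhs ν (crd (u t)) (crd (u t)) (crd (b t)) (crd (b t))))
    (V := curlSpan) (fun T => by
      obtain ⟨R, hR⟩ := h.exists_norm_rhs_le T
      exact ⟨R + R, fun t ht => norm_ofCoords_le fun i => (hR t ht i).1⟩)
    (fun φ hφ => (h.solves_u φ hφ).1) (fun φ hφ => (h.solves_u φ hφ).2)
    (fun t => (h.solenoidal_u t).mem_closure_curlSpan) (mapField A) (inner_mapField_comm hA)
    (fun t => mapField_mem_closure_curlSpan hAs (h.solenoidal_u t))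
  obtain ⟨c2, e2⟩ := quadratic_sub_eq_integral h.continuous_b
    (F := fun t => ofCoords (rhs η (crd (u t)) (crd (b t)) (crd (b t)) (crd (u t))))
    (V := curlSpan) (fun T => by
      obtain ⟨R, hR⟩ := h.exists_norm_rhs_le T
      exact ⟨R + R, fun t ht => norm_ofCoords_le fun i => (hR t ht i).2⟩)
    (fun φ hφ => (h.solves_b φ hφ).1) (fun φ hφ => (h.solves_b φ hφ).2)
    (fun t => (h.solenoidal_b t).mem_closure_curlSpan) (mapField A) (inner_mapField_comm hA)
    (fun t => mapField_mem_closure_curlSpan hAs (h.solenoidal_b t))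
  have hflux : ∀ t, flux ν η A (crd (u t)) (crd (b t)) =
      inner ℝ (ofCoords (rhs ν (crd (u t)) (crd (u t)) (crd (b t)) (crd (b t)))) (mapField A (u t)) +
      inner ℝ (ofCoords (rhs η (crd (u t)) (crd (b t)) (crd (b t)) (crd (u t))))
        (mapField A (b t)) := fun t => by
    simp only [flux, inner_l2Field, coord_ofCoords, coord_mapField, Fin.sum_univ_two, crd]
    ring
  have hquad : ∀ t, quad A (crd (u t)) (crd (b t)) =
      inner ℝ (u t) (mapField A (u t)) + inner ℝ (b t) (mapField A (b t)) := fun t => by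
    simp only [quad, inner_l2Field, coord_mapField, Fin.sum_univ_two, crd]
    ring
  simp only [hflux, hquad]
  refine ⟨c1.add c2, fun s t hs hst => ?_⟩
  have d1 := e1 s t hs hst
  have d2 := e2 s t hs hst
  rw [intervalIntegral.integral_const_mul] at d1 d2 ⊢
  rw [intervalIntegral.integral_add (c1.intervalIntegrable _ _) (c2.intervalIntegrable _ _)]
  linarith

end IsFlow

/-! ### Difference quotients -/

/-- The difference quotient in the vertical direction. -/
def dq (h : ℝ) : L2Fun →L[ℝ] L2Fun :=
  h⁻¹ • ((shift (dir 1 h)).toContinuousLinearMap - ContinuousLinearMap.id ℝ L2Fun)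

theorem dq_apply (h : ℝ) (f : L2Fun) : dq h f = h⁻¹ • (shift (dir 1 h) f - f) := rfl

theorem dq_shift (h : ℝ) (a : Strip) (f : L2Fun) : dq h (shift a f) = shift a (dq h f) := by
  simp only [dq_apply, shift_shift, map_smul, map_sub, add_comm]

theorem inner_dq_left (h : ℝ) (f g : L2Fun) : inner ℝ (dq h f) g = -inner ℝ f (dq (-h) g) := by
  simp only [dq_apply, real_inner_smul_left, real_inner_smul_right, inner_sub_left,
    inner_sub_right, inner_shift_left, dir_neg, inv_neg]
  ring

theorem norm_dq_le {f : L2Fun} (hf : IsH1 f) (h : ℝ) : ‖dq h f‖ ≤ ‖pd 1 f‖ := by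
  rw [dq_apply, norm_smul, norm_inv, Real.norm_eq_abs]
  rcases eq_or_ne h 0 with rfl | h0
  · simp
  · rw [inv_mul_le_iff₀ (abs_pos.2 h0), mul_comm]
    exact (hf 1).norm_shift_sub_le h

theorem tendsto_dq {f : L2Fun} (hf : IsH1 f) :
    Tendsto (fun h => dq h f) (𝓝[≠] 0) (𝓝 (pd 1 f)) := (hf 1).tendsto

theorem norm_dq_dq_le {f : L2Fun} (hf : IsH2 f) (h k : ℝ) : ‖dq k (dq h f)‖ ≤ ‖pd 1 (pd 1 f)‖ := by
  refine (norm_dq_le (hf.isH1.map (dq_shift h)) k).trans ?_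
  rw [pd_map (dq_shift h) hf.isH1]
  exact norm_dq_le (hf.isH1_pd 1) h

/-- The step `-h` makes `-dq (-h)` the adjoint of `dq h`. The outer quotient is bounded by `∂₂`
uniformly in `h`, so replacing the inner one by `∂₂f` costs only `‖dq h (∂₂f) - ∂₂∂₂f‖`. -/
theorem tendsto_neg_dq_dq {f : L2Fun} (hf : IsH2 f) :
    Tendsto (fun h => dq (-h) (dq h f)) (𝓝[≠] 0) (𝓝 (pd 1 (pd 1 f))) := by
  have hneg : Tendsto (fun h : ℝ => -h) (𝓝[≠] 0) (𝓝[≠] 0) := by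
    refine tendsto_nhdsWithin_iff.2 ⟨?_, ?_⟩
    · have : Tendsto (fun h : ℝ => -h) (𝓝 0) (𝓝 0) := by simpa using continuous_neg.tendsto (0 : ℝ)
      exact this.mono_left nhdsWithin_le_nhds
    · filter_upwards [self_mem_nhdsWithin] with h hh using neg_ne_zero.2 hh
  have h1 : Tendsto (fun h => dq (-h) (pd 1 f)) (𝓝[≠] 0) (𝓝 (pd 1 (pd 1 f))) :=
    (tendsto_dq (hf.isH1_pd 1)).comp hneg
  have h2 : Tendsto (fun h => dq (-h) (dq h f - pd 1 f)) (𝓝[≠] 0) (𝓝 0) := by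
    refine squeeze_zero_norm (a := fun h => ‖dq h (pd 1 f) - pd 1 (pd 1 f)‖) (fun h => ?_) ?_
    · have h3 : IsH1 (dq h f) := hf.isH1.map (dq_shift h)
      refine (norm_dq_le (h3.sub (hf.isH1_pd 1)) _).trans (le_of_eq ?_)
      rw [pd_sub h3 (hf.isH1_pd 1), pd_map (dq_shift h) hf.isH1]
    · have := ((tendsto_dq (hf.isH1_pd 1)).sub_const (pd 1 (pd 1 f))).norm
      simpa using this
  have h3 := h2.add h1
  rw [zero_add] at h3
  refine h3.congr fun h => ?_
  rw [← map_add, sub_add_cancel]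

/-- The operator `1 - ∂₂²`. -/
def oneSubLap (f : L2Fun) : L2Fun := f - pd 1 (pd 1 f)

/-- The difference approximation of `1 - ∂₂²`. -/
def oneSubDq (h : ℝ) : L2Fun →L[ℝ] L2Fun := ContinuousLinearMap.id ℝ L2Fun - dq (-h) ∘L dq h

theorem oneSubDq_apply (h : ℝ) (f : L2Fun) : oneSubDq h f = f - dq (-h) (dq h f) := rfl

namespace IsFlow

variable {ν η : ℝ} {u b : ℝ → L2Field}

theorem tendsto_oneSubDq {f : L2Fun} (hf : IsH2 f) (g : L2Fun) :
    Tendsto (fun h => inner ℝ g (oneSubDq h f)) (𝓝[≠] 0) (𝓝 (inner ℝ g (oneSubLap f))) :=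
  tendsto_const_nhds.inner (tendsto_const_nhds.sub (tendsto_neg_dq_dq hf))

theorem norm_oneSubDq_le {f : L2Fun} (hf : IsH2 f) (h : ℝ) {M : ℝ} (hM : H2Bound f M) :
    ‖oneSubDq h f‖ ≤ M + M := by
  rw [oneSubDq_apply]
  refine (norm_sub_le _ _).trans (add_le_add hM.norm_le ?_)
  exact (norm_dq_dq_le hf _ _).trans (hM.norm_pd_pd_le 1 1)

theorem norm_oneSubLap_le {f : L2Fun} {M : ℝ} (hM : H2Bound f M) : ‖oneSubLap f‖ ≤ M + M :=
  (norm_sub_le _ _).trans (add_le_add hM.norm_le (hM.norm_pd_pd_le 1 1))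

/-- The constant is uniform over operators with the stated bound, so it serves `1 - ∂₂²` and all its
difference approximations together. -/
theorem exists_abs_flux_le (h : IsFlow ν η u b) (T : ℝ) : ∃ K, ∀ A : L2Fun → L2Fun,
    (∀ f : L2Fun, ∀ M, IsH2 f → H2Bound f M → ‖A f‖ ≤ M + M) → ∀ t ≤ T,
      |flux ν η A (crd (u t)) (crd (b t))| ≤ K := by
  obtain ⟨R, hR⟩ := h.exists_norm_rhs_le T
  obtain ⟨M, hM⟩ := h.bound T
  refine ⟨4 * (R * (M + M)), fun A hA t ht => ?_⟩
  have key : ∀ {x y : L2Fun}, ‖x‖ ≤ R → ‖y‖ ≤ M + M → |inner ℝ x y| ≤ R * (M + M) :=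
    fun {x y} hx hy => (abs_real_inner_le_norm x y).trans
      (mul_le_mul hx hy (norm_nonneg _) ((norm_nonneg _).trans hx))
  have h1 : ∀ i, _ := fun i => key (hR t ht i).1
    (hA _ M ((h.solenoidal_u t).isH2 i) (hM t ht i).1)
  have h2 : ∀ i, _ := fun i => key (hR t ht i).2
    (hA _ M ((h.solenoidal_b t).isH2 i) (hM t ht i).2)
  rw [flux, Fin.sum_univ_two, abs_le]
  have a0 := abs_le.1 (h1 0)
  have a1 := abs_le.1 (h1 1)
  have a2 := abs_le.1 (h2 0)
  have a3 := abs_le.1 (h2 1)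
  constructor <;> linarith [a0.1, a0.2, a1.1, a1.2, a2.1, a2.2, a3.1, a3.2]

/-- The operator `1 - ∂₂²` is unbounded, so the balance law is used for its bounded symmetric
translation-invariant approximations. Dominated convergence then passes to the limit on both sides.
-/
theorem energy_balance (h : IsFlow ν η u b) {s t : ℝ} (hs : 0 ≤ s) (hst : s ≤ t) :
    quad oneSubLap (crd (u t)) (crd (b t)) - quad oneSubLap (crd (u s)) (crd (b s)) =
      ∫ τ in s..t, 2 * flux ν η oneSubLap (crd (u τ)) (crd (b τ)) := by
  have hself : ∀ k x y, inner ℝ (oneSubDq k x) y = inner ℝ x (oneSubDq k y) := fun k x y => by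
    rw [oneSubDq_apply, oneSubDq_apply, inner_sub_left, inner_sub_right, inner_dq_left, neg_neg,
      inner_dq_left]
    have := inner_dq_left k x (dq k y)
    linarith
  have hsh : ∀ k a g, oneSubDq k (shift a g) = shift a (oneSubDq k g) := fun k a g => by
    simp only [oneSubDq_apply, dq_shift, map_sub]
  have hq : ∀ r, Tendsto (fun k => quad (oneSubDq k) (crd (u r)) (crd (b r))) (𝓝[≠] 0)
      (𝓝 (quad oneSubLap (crd (u r)) (crd (b r)))) := fun r =>
    tendsto_finsetSum _ fun i _ => (tendsto_oneSubDq ((h.solenoidal_u r).isH2 i) _).add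
      (tendsto_oneSubDq ((h.solenoidal_b r).isH2 i) _)
  have hf : ∀ r, Tendsto (fun k => 2 * flux ν η (oneSubDq k) (crd (u r)) (crd (b r))) (𝓝[≠] 0)
      (𝓝 (2 * flux ν η oneSubLap (crd (u r)) (crd (b r)))) := fun r =>
    (tendsto_finsetSum _ fun i _ => (tendsto_oneSubDq ((h.solenoidal_u r).isH2 i) _).add
      (tendsto_oneSubDq ((h.solenoidal_b r).isH2 i) _)).const_mul 2
  obtain ⟨K, hK⟩ := h.exists_abs_flux_le t
  refine tendsto_nhds_unique ((hq t).sub (hq s)) ?_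
  have hlim : Tendsto
      (fun k => ∫ τ in s..t, 2 * flux ν η (oneSubDq k) (crd (u τ)) (crd (b τ))) (𝓝[≠] 0)
      (𝓝 (∫ τ in s..t, 2 * flux ν η oneSubLap (crd (u τ)) (crd (b τ)))) := by
    refine intervalIntegral.tendsto_integral_filter_of_dominated_convergence (fun _ => 2 * K)
      (Eventually.of_forall fun k =>
        (continuous_const.mul (h.balance (hself k) (hsh k)).1).aestronglyMeasurable)
      (Eventually.of_forall fun k => Eventually.of_forall fun τ hτ => ?_)
      intervalIntegrable_const (Eventually.of_forall fun τ _ => hf τ)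
    rw [Set.uIoc_of_le hst] at hτ
    rw [norm_mul, Real.norm_ofNat, Real.norm_eq_abs]
    gcongr
    exact hK _ (fun f M hf hM => norm_oneSubDq_le hf k hM) τ hτ.2
  exact hlim.congr fun k => ((h.balance (hself k) (hsh k)).2 s t hs hst).symm

/-- The solution is continuous only in `L²`, so continuity of `‖∂₂(u,b)‖` is not given. It comes
from the balance law, whose bounded flux makes the energy Lipschitz on bounded intervals. -/
theorem continuousOn_energy (h : IsFlow ν η u b) :
    ContinuousOn (fun t => quad oneSubLap (crd (u t)) (crd (b t))) (Set.Ici 0) := by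
  have key : ∀ T, ∃ K : ℝ≥0, LipschitzOnWith K
      (fun t => quad oneSubLap (crd (u t)) (crd (b t))) (Set.Icc 0 T) := by
    intro T
    obtain ⟨K, hK⟩ := h.exists_abs_flux_le T
    refine ⟨Real.toNNReal (2 * K), LipschitzOnWith.of_dist_le_mul fun x hx y hy => ?_⟩
    have main : ∀ {x y : ℝ}, x ∈ Set.Icc 0 T → y ∈ Set.Icc 0 T → x ≤ y →
        |quad oneSubLap (crd (u y)) (crd (b y)) - quad oneSubLap (crd (u x)) (crd (b x))| ≤
          Real.toNNReal (2 * K) * |y - x| := fun {x y} hx hy hxy => by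
      rw [h.energy_balance hx.1 hxy]
      rw [← Real.norm_eq_abs]
      refine intervalIntegral.norm_integral_le_of_norm_le_const fun τ hτ => ?_
      rw [Set.uIoc_of_le hxy] at hτ
      rw [norm_mul, Real.norm_ofNat, Real.norm_eq_abs]
      refine le_trans ?_ (Real.le_coe_toNNReal _)
      gcongr
      exact hK _ (fun f M _ hM => norm_oneSubLap_le hM) τ (hτ.2.trans hy.2)
    rw [Real.dist_eq, Real.dist_eq]
    rcases le_total x y with hxy | hxy
    · rw [abs_sub_comm, abs_sub_comm x]; exact main hx hy hxy
    · exact main hy hx hxy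
  intro t ht
  obtain ⟨K, hK⟩ := key (t + 1)
  have h1 := hK.continuousOn t ⟨ht, by linarith⟩
  refine h1.mono_of_mem_nhdsWithin ?_
  filter_upwards [self_mem_nhdsWithin, mem_nhdsWithin_of_mem_nhds
    (Iic_mem_nhds (show t < t + 1 by linarith))] with x hx hx'
  exact ⟨hx, hx'⟩

end IsFlow

end MHD

namespace MHD

/-! ### A priori estimates -/

section

variable {u b : Fin 2 → L2Fun}

theorem quad_oneSubLap (hu : IsSolenoidalH2 u) (hb : IsSolenoidalH2 b) :
    quad oneSubLap u b =
      ∑ i, ((‖u i‖ ^ 2 + ‖pd 1 (u i)‖ ^ 2) + (‖b i‖ ^ 2 + ‖pd 1 (b i)‖ ^ 2)) := by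
  have key : ∀ {f : L2Fun}, IsH2 f → inner ℝ f (oneSubLap f) = ‖f‖ ^ 2 + ‖pd 1 f‖ ^ 2 :=
    fun {f} hf => by
      have h := (hf.isH1 1).inner_left (hf.isH1_pd 1 1)
      rw [oneSubLap, inner_sub_right, real_inner_self_eq_norm_sq,
        ← real_inner_self_eq_norm_sq (pd 1 f)]
      linarith
  exact Finset.sum_congr rfl fun i _ => by rw [key (hu.isH2 i), key (hb.isH2 i)]

theorem norm_pd_one_le_sqrt (hu : IsSolenoidalH2 u) (hb : IsSolenoidalH2 b) (i : Fin 2) :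
    ‖pd 1 (u i)‖ ≤ √(quad oneSubLap u b) ∧ ‖pd 1 (b i)‖ ≤ √(quad oneSubLap u b) := by
  rw [quad_oneSubLap hu hb]
  have h1 := Finset.single_le_sum
    (f := fun i => (‖u i‖ ^ 2 + ‖pd 1 (u i)‖ ^ 2) + (‖b i‖ ^ 2 + ‖pd 1 (b i)‖ ^ 2))
    (fun i _ => by positivity) (Finset.mem_univ i)
  constructor <;> refine Real.le_sqrt_of_sq_le (le_trans ?_ h1)
  · nlinarith [sq_nonneg ‖u i‖, sq_nonneg ‖b i‖, sq_nonneg ‖pd 1 (b i)‖]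
  · nlinarith [sq_nonneg ‖u i‖, sq_nonneg ‖b i‖, sq_nonneg ‖pd 1 (u i)‖]

theorem sqrt_le_of_le_sq {x m : ℝ} (hm : 0 ≤ m) (h : x ≤ (m / 128) ^ 2) : √x ≤ m / 128 :=
  (Real.sqrt_le_sqrt h).trans (le_of_eq (Real.sqrt_sq (by positivity)))

/-- Here `D` collects all dissipated squares. Each component contributes an error `64 e D`, so the
flux is at most `(128 e - m) D`; this fixes the threshold `e ≤ m / 128`. -/
theorem flux_oneSubLap_nonpos (hu : IsSolenoidalH2 u) (hb : IsSolenoidalH2 b) {ν η m : ℝ}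
    (hm : 0 ≤ m) (hν : m ≤ ν) (hη : m ≤ η) (hE : quad oneSubLap u b ≤ (m / 128) ^ 2) :
    flux ν η oneSubLap u b ≤ 0 := by
  set e := √(quad oneSubLap u b) with he
  have he1 : e ≤ m / 128 := sqrt_le_of_le_sq hm hE
  let a : Fin 2 → ℝ := fun i => (‖pd 0 (u i)‖ ^ 2 + ‖pd 0 (b i)‖ ^ 2) +
    (‖pd 0 (pd 1 (u i))‖ ^ 2 + ‖pd 0 (pd 1 (b i))‖ ^ 2)
  have ha : ∀ i, 0 ≤ a i := fun i => by positivity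
  set D := ∑ i, a i with hD
  have hD0 : 0 ≤ D := Finset.sum_nonneg fun i _ => ha i
  have hle : ∀ {x : ℝ} (i : Fin 2), x ^ 2 ≤ a i → x ≤ √D := fun {x} i hx =>
    Real.le_sqrt_of_sq_le (hx.trans (Finset.single_le_sum (fun i _ => ha i) (Finset.mem_univ i)))
  have hparts : ∀ i, ‖pd 0 (u i)‖ ≤ √D ∧ ‖pd 0 (b i)‖ ≤ √D ∧ ‖pd 0 (pd 1 (u i))‖ ≤ √D ∧
      ‖pd 0 (pd 1 (b i))‖ ≤ √D := fun i => by
    have p1 := sq_nonneg ‖pd 0 (u i)‖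
    have p2 := sq_nonneg ‖pd 0 (b i)‖
    have p3 := sq_nonneg ‖pd 0 (pd 1 (u i))‖
    have p4 := sq_nonneg ‖pd 0 (pd 1 (b i))‖
    refine ⟨hle i ?_, hle i ?_, hle i ?_, hle i ?_⟩ <;> simp only [a] <;> linarith
  have key : ∀ i, inner ℝ (rhs ν u u b b i) (oneSubLap (u i)) +
      inner ℝ (rhs η u b b u i) (oneSubLap (b i)) ≤ -(m * a i) + 64 * e * D := fun i => by
    have h1 := inner_rhs_add hu hb ν η i
    have h2 := inner_rhs_pd_pd_le hu hb ν η (e := e) (d := √D)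
      (fun i => (norm_pd_one_le_sqrt hu hb i).1) (fun i => (norm_pd_one_le_sqrt hu hb i).2)
      (fun i => (hparts i).1) (fun i => (hparts i).2.1) (fun i => (hparts i).2.2.1)
      (fun i => (hparts i).2.2.2) i
    rw [Real.sq_sqrt hD0] at h2
    have h3 := mul_le_mul_of_nonneg_right hν (sq_nonneg ‖pd 0 (u i)‖)
    have h4 := mul_le_mul_of_nonneg_right hη (sq_nonneg ‖pd 0 (b i)‖)
    have h5 := mul_le_mul_of_nonneg_right hν (sq_nonneg ‖pd 0 (pd 1 (u i))‖)
    have h6 := mul_le_mul_of_nonneg_right hη (sq_nonneg ‖pd 0 (pd 1 (b i))‖)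
    simp only [oneSubLap, inner_sub_right, a]
    linarith
  have hsum : flux ν η oneSubLap u b ≤ -(m * D) + 128 * e * D := by
    have := Finset.sum_le_sum fun i (_ : i ∈ Finset.univ) => key i
    simp only [Fin.sum_univ_two] at this
    simp only [flux, hD, Fin.sum_univ_two] at this ⊢
    linarith
  nlinarith

theorem norm_sub_avg_sq (f : L2Fun) : inner ℝ f (f - avg f) = ‖f - avg f‖ ^ 2 := by
  have h1 : inner ℝ (avg f) (f - avg f) = 0 := by
    rw [inner_avg_left, map_sub, avg_avg, sub_self, inner_zero_right]
  rw [← real_inner_self_eq_norm_sq, inner_sub_left, h1, sub_zero]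

theorem quad_sub_avg (u b : Fin 2 → L2Fun) : quad (fun f => f - avg f) u b =
    ∑ i, (‖u i - avg (u i)‖ ^ 2 + ‖b i - avg (b i)‖ ^ 2) := by
  simp only [quad, norm_sub_avg_sq]

/-- The error is `32 e D ≤ m D / 4`, so twice the flux is at most `-(3/2) m D`. Poincaré bounds the
squared remainder by `D`, which leaves the rate `m`. -/
theorem flux_sub_avg_le (hu : IsSolenoidalH2 u) (hb : IsSolenoidalH2 b) {ν η m : ℝ}
    (hm : 0 ≤ m) (hν : m ≤ ν) (hη : m ≤ η) (hE : quad oneSubLap u b ≤ (m / 128) ^ 2) :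
    2 * flux ν η (fun f => f - avg f) u b ≤ -m * quad (fun f => f - avg f) u b := by
  set e := √(quad oneSubLap u b) with he
  have he1 : e ≤ m / 128 := sqrt_le_of_le_sq hm hE
  let a : Fin 2 → ℝ := fun i => ‖pd 0 (u i)‖ ^ 2 + ‖pd 0 (b i)‖ ^ 2
  have ha : ∀ i, 0 ≤ a i := fun i => by positivity
  set D := ∑ i, a i with hD
  have hD0 : 0 ≤ D := Finset.sum_nonneg fun i _ => ha i
  have hle : ∀ {x : ℝ} (i : Fin 2), x ^ 2 ≤ a i → x ≤ √D := fun {x} i hx =>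
    Real.le_sqrt_of_sq_le (hx.trans (Finset.single_le_sum (fun i _ => ha i) (Finset.mem_univ i)))
  have key : ∀ i, inner ℝ (rhs ν u u b b i) (u i - avg (u i)) +
      inner ℝ (rhs η u b b u i) (b i - avg (b i)) ≤ -(m * a i) + 16 * e * D := fun i => by
    have h2 := inner_rhs_sub_avg_le hu hb ν η (e := e) (d := √D)
      (fun i => (norm_pd_one_le_sqrt hu hb i).1) (fun i => (norm_pd_one_le_sqrt hu hb i).2)
      (fun i => hle i (by simp only [a]; nlinarith [sq_nonneg ‖pd 0 (b i)‖]))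
      (fun i => hle i (by simp only [a]; nlinarith [sq_nonneg ‖pd 0 (u i)‖])) i
    rw [Real.sq_sqrt hD0] at h2
    have h3 := mul_le_mul_of_nonneg_right hν (sq_nonneg ‖pd 0 (u i)‖)
    have h4 := mul_le_mul_of_nonneg_right hη (sq_nonneg ‖pd 0 (b i)‖)
    simp only [a]
    linarith
  have hsum : flux ν η (fun f => f - avg f) u b ≤ -(m * D) + 32 * e * D := by
    have := Finset.sum_le_sum fun i (_ : i ∈ Finset.univ) => key i
    simp only [Fin.sum_univ_two] at this
    simp only [flux, hD, Fin.sum_univ_two] at this ⊢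
    linarith
  have hq : quad (fun f => f - avg f) u b ≤ D := by
    rw [quad_sub_avg]
    refine Finset.sum_le_sum fun i _ => add_le_add ?_ ?_
    · exact pow_le_pow_left₀ (norm_nonneg _) ((hu.isH2 i).isH1 0).norm_sub_avg_le 2
    · exact pow_le_pow_left₀ (norm_nonneg _) ((hb.isH2 i).isH1 0).norm_sub_avg_le 2
  nlinarith

end

/-! ### Global smallness of the energy and exponential decay -/

/-- Exponential decay from a differential inequality in integrated form. -/
theorem le_exp_of_balance {q g : ℝ → ℝ} {m : ℝ} (hg : Continuous g)
    (h : ∀ s t, 0 ≤ s → s ≤ t → q t - q s = ∫ τ in s..t, g τ)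
    (hle : ∀ t, 0 ≤ t → g t ≤ -m * q t) {t : ℝ} (ht : 0 ≤ t) :
    q t ≤ q 0 * Real.exp (-m * t) := by
  -- The balance is known only for nonnegative times; `I` agrees with `q` there and is
  -- differentiable everywhere.
  let I : ℝ → ℝ := fun t => q 0 + ∫ τ in (0 : ℝ)..t, g τ
  have hI : ∀ t, 0 ≤ t → I t = q t := fun t ht => by
    simp only [I, ← h 0 t le_rfl ht]; ring
  have hId : ∀ t, HasDerivAt I (g t) t := fun t =>
    HasDerivAt.const_add (q 0) (intervalIntegral.integral_hasDerivAt_right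
      (hg.intervalIntegrable _ _) (hg.stronglyMeasurableAtFilter _ _) hg.continuousAt)
  have hfd : ∀ t, HasDerivAt (fun t => I t * Real.exp (m * t))
      (g t * Real.exp (m * t) + I t * (Real.exp (m * t) * m)) t := fun t => by
    have h1 : HasDerivAt (fun t => m * t) m t := by simpa using (hasDerivAt_id t).const_mul m
    exact (hId t).mul h1.exp
  have hanti : AntitoneOn (fun t => I t * Real.exp (m * t)) (Set.Ici 0) := by
    refine antitoneOn_of_deriv_nonpos (convex_Ici 0)
      (fun t _ => (hfd t).continuousAt.continuousWithinAt)
      (fun t _ => (hfd t).differentiableAt.differentiableWithinAt) fun t ht => ?_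
    rw [interior_Ici, Set.mem_Ioi] at ht
    rw [(hfd t).deriv, hI t ht.le]
    have := hle t ht.le
    nlinarith [Real.exp_pos (m * t)]
  have h1 := hanti (Set.mem_Ici.2 le_rfl) (Set.mem_Ici.2 ht) ht
  simp only [hI 0 le_rfl, hI t ht, mul_zero, Real.exp_zero, mul_one] at h1
  rw [neg_mul, Real.exp_neg, ← div_eq_mul_inv, le_div_iff₀ (Real.exp_pos _)]
  exact h1

/-- The threshold argument keeps the energy small for all times. The operator `1 - avg` is bounded,
symmetric and translation invariant, so the balance law applies to it without approximation. -/
theorem IsFlow.quad_sub_avg_le {ν η m : ℝ} {u b : ℝ → L2Field} (h : IsFlow ν η u b)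
    (hm : 0 < m) (hν : m ≤ ν) (hη : m ≤ η)
    (h0 : quad oneSubLap (crd (u 0)) (crd (b 0)) < (m / 128) ^ 2) {t : ℝ} (ht : 0 ≤ t) :
    quad (fun f => f - avg f) (crd (u t)) (crd (b t)) ≤
      quad (fun f => f - avg f) (crd (u 0)) (crd (b 0)) * Real.exp (-m * t) := by
  have hE : ∀ t, 0 ≤ t → quad oneSubLap (crd (u t)) (crd (b t)) ≤ (m / 128) ^ 2 := fun t ht => by
    refine (le_initial_of_threshold (E := fun t => quad oneSubLap (crd (u t)) (crd (b t)))
      h.continuousOn_energy h0 (fun s t hs hst hle => ?_) t ht).trans h0.le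
    rw [← sub_nonpos, h.energy_balance hs hst, ← neg_nonneg, ← intervalIntegral.integral_neg]
    refine intervalIntegral.integral_nonneg hst fun τ hτ => ?_
    have := flux_oneSubLap_nonpos (h.solenoidal_u τ) (h.solenoidal_b τ) hm.le hν hη (hle τ hτ)
    linarith
  obtain ⟨hc, he⟩ := h.balance (A := ContinuousLinearMap.id ℝ L2Fun - avg)
    (fun x y => by
      simp only [sub_apply, ContinuousLinearMap.id_apply, inner_sub_left,
        inner_sub_right, inner_avg_left])
    (fun a g => by simp [avg_shift])
  exact le_exp_of_balance (q := fun t => quad (fun f => f - avg f) (crd (u t)) (crd (b t)))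
    (continuous_const.mul hc) he
    (fun t ht => flux_sub_avg_le (h.solenoidal_u t) (h.solenoidal_b t) hm.le hν hη (hE t ht)) ht

/-! ### The remainder -/

theorem remainder_ae_eq (v : L2Field) :
    remainder v =ᵐ[volume] (v - mapField avg v : L2Field) := by
  have h : ∀ i, ∀ᵐ z : Strip, (Integrable fun x : UnitAddCircle => v (x, z.2) i) ∧
      xMean (coord i v) z.2 = ∫ x : UnitAddCircle, v (x, z.2) i := fun i => by
    refine ae_snd (p := fun y => (Integrable fun x : UnitAddCircle => v (x, y) i) ∧
      xMean (coord i v) y = ∫ x : UnitAddCircle, v (x, y) i) ?_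
    filter_upwards [ae_integrable_slice (coord i v), ae_ae_of_ae_strip (coeFn_coord i v)]
      with y h1 h2
    exact ⟨h1.congr h2, integral_congr_ae h2⟩
  have hc : ∀ i, ∀ᵐ z : Strip, (v - mapField avg v : L2Field) z i =
      v z i - xMean (coord i v) z.2 := fun i => by
    filter_upwards [coeFn_coord i (v - mapField avg v), coeFn_coord i v, coeFn_avg (coord i v),
      Lp.coeFn_sub (coord i v) (avg (coord i v))] with z h1 h2 h3 h4
    rw [← h1, map_sub, coord_mapField, h4, Pi.sub_apply, h2, h3]
  filter_upwards [h 0, h 1, hc 0, hc 1] with z h0 h1 c0 c1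
  have hint : ∀ i, Integrable fun x : UnitAddCircle => v (x, z.2) i := by
    intro i; fin_cases i
    exacts [h0.1, h1.1]
  ext i
  rw [remainder, PiLp.sub_apply, xAverage, eval_integral_piLp hint]
  fin_cases i
  · exact (c0.trans (congrArg _ h0.2)).symm
  · exact (c1.trans (congrArg _ h1.2)).symm

theorem eLpNorm_remainder (v : L2Field) :
    eLpNorm (remainder v) 2 volume = ENNReal.ofReal ‖v - mapField avg v‖ := by
  rw [eLpNorm_congr_ae (remainder_ae_eq v), ← Lp.enorm_def, ofReal_norm]

theorem norm_sub_mapField_avg_sq (v w : L2Field) :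
    ‖v - mapField avg v‖ ^ 2 + ‖w - mapField avg w‖ ^ 2 =
      quad (fun f => f - avg f) (crd v) (crd w) := by
  rw [quad_sub_avg, Fin.sum_univ_two, norm_sq_l2Field, norm_sq_l2Field]
  simp only [map_sub, coord_mapField, crd]
  ring

theorem pairL2Norm_remainder_le {v w : L2Field} {c : ℝ} (hc : 0 ≤ c)
    (h : quad (fun f => f - avg f) (crd v) (crd w) ≤ c ^ 2) :
    pairL2Norm (remainder v) (remainder w) ≤ ENNReal.ofReal c := by
  rw [pairL2Norm, eLpNorm_remainder, eLpNorm_remainder, ← ENNReal.ofReal_pow (norm_nonneg _),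
    ← ENNReal.ofReal_pow (norm_nonneg _), ← ENNReal.ofReal_add (sq_nonneg _) (sq_nonneg _),
    norm_sub_mapField_avg_sq]
  refine (ENNReal.rpow_le_rpow (ENNReal.ofReal_le_ofReal h) (by norm_num)).trans (le_of_eq ?_)
  rw [ENNReal.ofReal_rpow_of_nonneg (sq_nonneg c) (by norm_num), ← Real.sqrt_eq_rpow,
    Real.sqrt_sq hc]

theorem eLpNorm_le_pairL2Norm_left (f g : Strip → Vec) :
    eLpNorm f 2 volume ≤ pairL2Norm f g := by
  have h : eLpNorm f 2 volume = (eLpNorm f 2 volume ^ 2) ^ (1 / 2 : ℝ) := by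
    rw [← ENNReal.rpow_natCast, ← ENNReal.rpow_mul]; norm_num
  rw [h]
  exact ENNReal.rpow_le_rpow le_self_add (by norm_num)

theorem eLpNorm_le_pairL2Norm_right (f g : Strip → Vec) :
    eLpNorm g 2 volume ≤ pairL2Norm f g := by
  rw [pairL2Norm, add_comm]
  exact eLpNorm_le_pairL2Norm_left g f

/-- Sobolev regularity makes the distributional `∂₂` of the data a strong derivative, so the
smallness assumption concerns the initial energy of the flow. -/
theorem quad_oneSubLap_initial {s : ℝ} (hs : 2 ≤ s) {v w v' w' : L2Field} (hv : MemSobolev s v)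
    (hw : MemSobolev s w) (hdv : IsDivergenceFree v) (hdw : IsDivergenceFree w)
    (hv' : IsWeakD2 v v') (hw' : IsWeakD2 w w') :
    quad oneSubLap (crd v) (crd w) = (‖v‖ ^ 2 + ‖w‖ ^ 2) + (‖v'‖ ^ 2 + ‖w'‖ ^ 2) := by
  have h1 := isSolenoidalH2_crd hs (M := (fieldSobolevNormSq s v).toNNReal)
    (ENNReal.coe_toNNReal hv.ne).ge hdv
  have h2 := isSolenoidalH2_crd hs (M := (fieldSobolevNormSq s w).toNNReal)
    (ENNReal.coe_toNNReal hw.ne).ge hdw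
  have e1 : ∀ i, pd 1 (crd v i) = coord i v' := fun i => hv'.pd_eq i (h1.isH2 i).isH1
  have e2 : ∀ i, pd 1 (crd w i) = coord i w' := fun i => hw'.pd_eq i (h2.isH2 i).isH1
  rw [quad_oneSubLap h1 h2, Fin.sum_univ_two, e1, e1, e2, e2, norm_sq_l2Field v,
    norm_sq_l2Field w, norm_sq_l2Field v', norm_sq_l2Field w']
  simp only [crd]
  ring

end MHD

end

/-! ### Conclusion -/

theorem theorem1p2 (ν η : ℝ) (hν : 0 < ν) (hη : 0 < η) :
    ∃ δ : ℝ, 0 < δ ∧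
      ∀ u₀ b₀ d2u₀ d2b₀ : MHD.L2Field,
        MHD.IsDivergenceFree u₀ → MHD.IsDivergenceFree b₀ →
        MHD.IsWeakD2 u₀ d2u₀ → MHD.IsWeakD2 b₀ d2b₀ →
        (‖u₀‖ ^ 2 + ‖b₀‖ ^ 2) + (‖d2u₀‖ ^ 2 + ‖d2b₀‖ ^ 2) ≤ δ →
        ∃ C : ℝ, 0 < C ∧ ∃ C' : ℝ, 0 < C' ∧
          ∀ s : ℝ, 2 ≤ s → MHD.MemSobolev s u₀ → MHD.MemSobolev s b₀ →
            ∀ u b : ℝ → MHD.L2Field, MHD.IsGlobalSolution ν η s u₀ b₀ u b →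
              (∀ t : ℝ, 0 ≤ t →
                MHD.pairL2Norm (MHD.remainder (u t)) (MHD.remainder (b t))
                  ≤ ENNReal.ofReal (C * Real.exp (-C' * t))) ∧
              Tendsto (fun t : ℝ => eLpNorm (fun z => u t z - MHD.xAverage (u t) z.2) 2 volume)
                atTop (𝓝 0) ∧
              Tendsto (fun t : ℝ => eLpNorm (fun z => b t z - MHD.xAverage (b t) z.2) 2 volume)
                atTop (𝓝 0) := by
  set m := min ν η with hm
  have hm0 : 0 < m := lt_min hν hη
  -- Half the threshold, because the continuity argument needs the initial energy strictly below it.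
  refine ⟨(m / 128) ^ 2 / 2, by positivity, fun u₀ b₀ d2u₀ d2b₀ hdu hdb hu' hb' hδ => ?_⟩
  set q₀ := MHD.quad (fun f => f - MHD.avg f) (MHD.crd u₀) (MHD.crd b₀) with hq₀
  have hq₀0 : 0 ≤ q₀ := by
    rw [hq₀, MHD.quad_sub_avg]
    exact Finset.sum_nonneg fun i _ => by positivity
  -- The squared remainder decays at rate `m`, its root at rate `m / 2`. The added one keeps the
  -- constant positive when the initial remainder vanishes.
  refine ⟨√q₀ + 1, by positivity, m / 2, by positivity, fun s hs hu₀ hb₀ u b h => ?_⟩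
  have hflow := h.isFlow hs
  have h0 : MHD.quad MHD.oneSubLap (MHD.crd u₀) (MHD.crd b₀) < (m / 128) ^ 2 := by
    rw [MHD.quad_oneSubLap_initial hs hu₀ hb₀ hdu hdb hu' hb']
    have : 0 < (m / 128) ^ 2 := by positivity
    linarith
  have hdecay : ∀ t : ℝ, 0 ≤ t → MHD.pairL2Norm (MHD.remainder (u t)) (MHD.remainder (b t))
      ≤ ENNReal.ofReal ((√q₀ + 1) * Real.exp (-(m / 2) * t)) := fun t ht => by
    refine MHD.pairL2Norm_remainder_le (by positivity) ?_
    have h1 := hflow.quad_sub_avg_le hm0 (min_le_left ν η) (min_le_right ν η)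
      (by simpa only [max_self, h.initial_u, h.initial_b] using h0) ht
    simp only [max_self, max_eq_right ht, h.initial_u, h.initial_b] at h1
    refine h1.trans ?_
    rw [mul_pow, ← Real.exp_nat_mul]
    have h2 : ((2 : ℕ) : ℝ) * (-(m / 2) * t) = -m * t := by push_cast; ring
    rw [h2]
    refine mul_le_mul_of_nonneg_right ?_ (Real.exp_pos _).le
    nlinarith [Real.sq_sqrt hq₀0, Real.sqrt_nonneg q₀]
  have hlim : Tendsto (fun t : ℝ => ENNReal.ofReal ((√q₀ + 1) * Real.exp (-(m / 2) * t))) atTop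
      (𝓝 0) := by
    have h1 : Tendsto (fun t : ℝ => -(m / 2) * t) atTop atBot :=
      tendsto_id.const_mul_atTop_of_neg (by linarith)
    have h2 := (Real.tendsto_exp_atBot.comp h1).const_mul (√q₀ + 1)
    rw [mul_zero] at h2
    simpa using ENNReal.tendsto_ofReal h2
  refine ⟨hdecay, ?_, ?_⟩
  · refine tendsto_of_tendsto_of_tendsto_of_le_of_le' tendsto_const_nhds hlim
      (Eventually.of_forall fun _ => zero_le) ?_
    filter_upwards [eventually_ge_atTop 0] with t ht
    exact (MHD.eLpNorm_le_pairL2Norm_left _ (MHD.remainder (b t))).trans (hdecay t ht)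
  · refine tendsto_of_tendsto_of_tendsto_of_le_of_le' tendsto_const_nhds hlim
      (Eventually.of_forall fun _ => zero_le) ?_
    filter_upwards [eventually_ge_atTop 0] with t ht
    exact (MHD.eLpNorm_le_pairL2Norm_right (MHD.remainder (u t)) _).trans (hdecay t ht)
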